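/- **Setting.** Each unit has a sample label $P_i\in\{E,O\}$ (experimental/observational), covariates $X_i\in\mathcal X$, a binary treatment $W_i$, potential surrogates $S_i(0),S_i(1)\in\mathcal S$ and potential real outcomes $Y_i(0),Y_i(1)$ ($\mathcal X,\mathcal S$ standard Borel); $S_i=S_i(W_i)$, $Y_i=Y_i(W_i)$. The units are i.i.d. with law $P$ and one observes $Z_i=(P_i,X_i,S_i,\mathbf 1_{P_i=E}W_i,\mathbf 1_{P_i=O}Y_i)$, $i\le n$. Let $\rho(x)=\mathbb P(W_i=1\mid X_i=x,P_i=E)$, $\rho(s,x)=\mathbb P(W_i=1\mid S_i=s,X_i=x,P_i=E)$, $\varphi(x)=\mathbb P(P_i=E\mid X_i=x)$, $\varphi(s,x)=\mathbb P(P_i=E\mid S_i=s,X_i=x)$, $\varphi=\mathbb P(P_i=E)$, $\mu(s,x,O)=\mathbb E[Y_i\mid S_i=s,X_i=x,P_i=O]$, and let $F_Y^{-1}(\cdot\mid s,x,O)$ be the quantile function of $Y_i$ given $S_i=s,X_i=x,P_i=O$. Put $q_{C_+}(s,x)=F_Y^{-1}(1-\rho(s,x)\mid s,x,O)$ and $q_{C_-}(s,x)=F_Y^{-1}(\rho(s,x)\mid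 s,x,O)$. For $C\in\{C_+,C_-\}$, $C_+(u,v)=\min(u,v)$, $C_-(u,v)=\max(u+v-1,0)$, with $C(\alpha\mid u)=\Pr(V\le\alpha\mid U=u)$ for $(U,V)\sim C$, and $w\in\{0,1\}$, put $$\mu_{C,w}(s,x)=\int_0^1F_Y^{-1}(u\mid s,x,O)\,\frac{w-C(1-\rho(s,x)\mid u)}{w-(1-\rho(s,x))}\,du,\qquad \bar\mu_{C,w}(x)=\mathbb E[\mu_{C,w}(S_i,X_i)\mid W_i=w,X_i=x,P_i=E],$$ $$\tau_C=\mathbb E\Big[\mu_{C,1}(S_i,X_i)\tfrac{W_i}{\rho(X_i)}\,\Big|\,P_i=E\Big]-\mathbb E\Big[\mu_{C,0}(S_i,X_i)\tfrac{1-W_i}{1-\rho(X_i)}\,\Big|\,P_i=E\Big].$$ Let $\eta$ collect $\mu_{C,w},\bar\mu_{C,w},q_C$ $(C=C_\pm,\ w=0,1)$, $\rho(s,x),\rho(x),\varphi(x),\varphi(s,x),\varphi$. With $H_U(y,s,\alpha)=s+\alpha^{-1}(y-s)_+$, $H_L(y,s,\alpha)=s-\alpha^{-1}(y-s)_-$,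 let $(H_1,H_0)=(H_U,H_L)$ for $C_+$ and $(H_L,H_U)$ for $C_-$, and (all functions evaluated at $X_i$ or $(S_i,X_i)$; write $\rho_X=\rho(X_i)$, $\rho_{SX}=\rho(S_i,X_i)$, $\varphi_{SX}=\varphi(S_i,X_i)$) $$\begin{aligned}m_C(Z_i,\tau,\eta)={}&\tfrac{\mathbf 1_{P_i=E}}{\varphi}\Big[\tfrac{W_i}{\rho_X}(\mu_{C,1}-\bar\mu_{C,1})-\tfrac{1-W_i}{1-\rho_X}(\mu_{C,0}-\bar\mu_{C,0})+\bar\mu_{C,1}-\bar\mu_{C,0}-\tau\Big]\\&+\tfrac{\mathbf 1_{P_i=O}}{\varphi}\tfrac{\varphi_{SX}}{1-\varphi_{SX}}\Big[\tfrac{\rho_{SX}}{\rho_X}\big(H_1(Y_i,q_C,\rho_{SX})-\mu_{C,1}\big)-\tfrac{1-\rho_{SX}}{1-\rho_X}\big(H_0(Y_i,q_C,1-\rho_{SX})-\mu_{C,0}\big)\Big]\\&+\tfrac{\mathbf 1_{P_i=E}}{\varphi}\Big[\tfrac{q_C-\mu_{C,1}}{\rho_X}+\tfrac{q_C-\mu_{C,0}}{1-\rho_X}\Big](W_i-\rho_{SX}).\end{aligned}$$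 **Assumptions.** 1. $W_i\perp(Y_i(0),Y_i(1),S_i(0),S_i(1))\mid X_i,P_i=E$, and $0<\rho(x)<1$ for almost every $x$. 2. $P_i\perp Y_i\mid S_i,X_i$, and $\varphi(s,x)<1$ for almost every $(s,x)$. 3. Either (continuous outcome) $Y_i$ is absolutely continuous with bounded support and, for almost every $(s,x)$, its conditional law given $S_i=s,X_i=x,P_i=O$ has a density that on its support is continuous and lies between two positive constants not depending on $(s,x)$; or (binary outcome) $Y_i\in\{0,1\}$ and $\mu(S_i,X_i,O)-\rho(S_i,X_i)$ has a bounded density. 4. There is $t>0$ such that for each $C\in\{C_+,C_-\}$, almost surely, either $\mathbb E[(\bar\mu_{C,1}(X_i)-\bar\mu_{C,0}(X_i)-\tau_C)^2\mid X_i,P_i=E]>t$, or both $\mathrm{Var}\big(\tfrac{(Y_i-q_{C_+})_+}{\rho_X}+\tfrac{(Y_i-q_{C_+})_-}{1-\rho_X}\mid S_i,X_i,P_i=O\big)>t$ and $\mathrm{Var}\big(\tfrac{(Y_i-q_{C_-})_+}{1-\rho_X}+\tfrac{(Y_i-q_{C_-})_-}{\rho_X}\mid S_i,X_i,P_i=O\big)>t$.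 5. There are constants $q>2$, $0<\epsilon<1/2$, $B<\infty$ and sequences $\Delta_n\to0$, $\delta_n\to0$, $\delta_n\ge n^{-1/2}$, such that each cross-fitted estimator $\hat\eta_{n,k}$ below lies with probability at least $1-\Delta_n$ in the set $R_n$ of those $\tilde\eta$ for which $\|\tilde\eta-\eta\|_{P,q}\le B$; $\tilde\rho(S_i,X_i)$, $\tilde\rho(X_i)$, $\tilde\varphi(S_i,X_i)$ lie in $[\epsilon,1-\epsilon]$ almost surely; $\|\tilde\eta-\eta\|_{P,2}\le\delta_n$; $\|\tilde\omega-\omega\|_{P,2}\|\tilde\kappa-\kappa\|_{P,2}\le\delta_nn^{-1/2}$; $\|\tilde\omega_\rho-\omega_\rho\|_{P,2}\|\tilde\omega_\varphi-\omega_\varphi\|_{P,2}\le\delta_nn^{-1/2}$; and, for continuous outcomes, $\|\tilde q_{C_+}-q_{C_+}\|_{P,2}^2\le\delta_nn^{-1/2}$, for binary outcomes, $\|\tilde\mu-\mu\|_\infty\le\delta_n$ and $\|\tilde\mu-\mu\|_\infty^2\le\delta_nn^{-1/2}$, where $\tilde\mu$ is the accompanying estimate of $\mu(\cdot,\cdot,O)$.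 Here $\omega=(\omega_\rho,\omega_\varphi)$, $\omega_\rho=(\rho(S_i,X_i),\rho(X_i))$, $\omega_\varphi=(\varphi(S_i,X_i),\varphi)$, $\kappa$ consists of all $\mu_{C,w},\bar\mu_{C,w},q_C$, and $\|f\|_{P,p}=(\mathbb E|f|^p)^{1/p}$ over a fresh unit, $|\cdot|$ being the Euclidean norm. 6. $\delta_n\ge n^{-[(1-2/q)\wedge1/2]}$ for all $n\ge1$. **Estimators.** Fix $K\ge2$. For each $n$, split $\{1,\dots,n\}$ into $K$ even folds $\mathcal F_1,\dots,\mathcal F_K$ (sizes $\lfloor n/K\rfloor$ or $\lfloor n/K\rfloor+1$). For each $k$, $\hat\eta_{n,k}$ is computed from $(Z_i)_{i\le n,\,i\notin\mathcal F_k}$ and, possibly, randomness of the learner independent of the data. Let $\hat\tau_C$ solve $\frac1n\sum_{k=1}^K\sum_{i\in\mathcal F_k}m_C(Z_i,\hat\tau_C,\hat\eta_{n,k})=0$ (whenever a solution exists), and let $r=\lfloor n/K\rfloor$. **Theorem.** Under Assumptions 1–6, the entries of $$V=\mathbb E\big[(m_{C_+},m_{C_-})^\top(m_{C_+},m_{C_-})\big],\qquad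 m_C=m_C(Z_i,\tau_C,\eta),$$ the asymptotic covariance matrix of $(\hat\tau_{C_+},\hat\tau_{C_-})$, are finite and, as $n\to\infty$, $$\frac1K\sum_{k=1}^K\frac1r\sum_{i\in\mathcal F_k}\hat m_{i}^\top\hat m_i\ \longrightarrow\ V\quad\text{in probability},\qquad \hat m_i=\big(m_{C_+}(Z_i,\hat\tau_{C_+},\hat\eta_{n,k}),\,m_{C_-}(Z_i,\hat\tau_{C_-},\hat\eta_{n,k})\big)\ (i\in\mathcal F_k).$$ -/

import Mathlib

open MeasureTheory ProbabilityTheory Filter Topology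
open scoped ENNReal NNReal

namespace SurrogateBounds

noncomputable section

/-- Complete data of one unit: sample label (`true` is the experimental sample `E`, `false` the
observational sample `O`), covariates `X`, treatment `W` (`true` is treated), potential surrogates
`(S(0), S(1))`, potential primary outcomes `(Y(0), Y(1))`. -/
abbrev UnitData (𝒳 𝒮 : Type*) := Bool × 𝒳 × Bool × (𝒮 × 𝒮) × (ℝ × ℝ)

/-- Observed data of one unit, `Z = (P, X, S, 1{P = E} W, 1{P = O} Y)`. -/
abbrev ObsData (𝒳 𝒮 : Type*) := Bool × 𝒳 × 𝒮 × ℝ × ℝ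

/-- The outcome is either continuous or binary. -/
inductive OutcomeKind
  | continuous
  | binary

/-- The two Fréchet–Hoeffding bound copulas `C₋(u,v) = max(u+v-1,0)` and `C₊(u,v) = min(u,v)`. -/
inductive Bound
  | minus
  | plus

section Data

variable {𝒳 𝒮 : Type*}

/-- The sample label `P`. -/
def label (r : UnitData 𝒳 𝒮) : Bool := r.1

/-- The covariates `X`. -/
def covX (r : UnitData 𝒳 𝒮) : 𝒳 := r.2.1

/-- The treatment `W`. -/
def treat (r : UnitData 𝒳 𝒮) : Bool := r.2.2.1

/-- The realized surrogate `S = W S(1) + (1 - W) S(0)`. -/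
def surr (r : UnitData 𝒳 𝒮) : 𝒮 := if treat r = true then r.2.2.2.1.2 else r.2.2.2.1.1

/-- The realized primary outcome `Y = W Y(1) + (1 - W) Y(0)`. -/
def outcome (r : UnitData 𝒳 𝒮) : ℝ := if treat r = true then r.2.2.2.2.2 else r.2.2.2.2.1

/-- `((Y(0), Y(1)), (S(0), S(1)))`. -/
def potential (r : UnitData 𝒳 𝒮) : (ℝ × ℝ) × (𝒮 × 𝒮) := (r.2.2.2.2, r.2.2.2.1)

/-- `(S, X)`. -/
def surrX (r : UnitData 𝒳 𝒮) : 𝒮 × 𝒳 := (surr r, covX r)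

/-- `W` as a real number. -/
def treatR (r : UnitData 𝒳 𝒮) : ℝ := if treat r = true then 1 else 0

/-- The observed data `Z` of a unit. -/
def observe (r : UnitData 𝒳 𝒮) : ObsData 𝒳 𝒮 :=
  (label r, covX r, surr r,
    if label r = true then treatR r else 0, if label r = true then 0 else outcome r)

end Data

variable {𝒳 𝒮 : Type*} [MeasurableSpace 𝒳] [MeasurableSpace 𝒮]

lemma measurable_covX : Measurable (covX : UnitData 𝒳 𝒮 → 𝒳) := by
  unfold covX; fun_prop

lemma measurable_treat : Measurable (treat : UnitData 𝒳 𝒮 → Bool) := by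
  unfold treat; fun_prop

lemma measurable_surr : Measurable (surr : UnitData 𝒳 𝒮 → 𝒮) := by
  unfold surr
  exact Measurable.ite (measurable_treat (measurableSet_singleton true)) (by fun_prop)
    (by fun_prop)

lemma measurable_surrX : Measurable (surrX : UnitData 𝒳 𝒮 → 𝒮 × 𝒳) :=
  measurable_surr.prodMk measurable_covX

/-! ### Population quantities determined by the law of a unit -/

/-- Conditional law of a unit given `P = E`. -/
def expLaw (P : Measure (UnitData 𝒳 𝒮)) : Measure (UnitData 𝒳 𝒮) := P[|{r | label r = true}]

/-- Conditional law of a unit given `P = O`. -/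
def obsLaw (P : Measure (UnitData 𝒳 𝒮)) : Measure (UnitData 𝒳 𝒮) := P[|{r | label r = false}]

instance (P : Measure (UnitData 𝒳 𝒮)) : IsZeroOrProbabilityMeasure (expLaw P) := by
  unfold expLaw; infer_instance

instance (P : Measure (UnitData 𝒳 𝒮)) : IsZeroOrProbabilityMeasure (obsLaw P) := by
  unfold obsLaw; infer_instance

/-- The regression function `b ↦ E_Q[f | g = b]`. -/
def condMean {β : Type*} [MeasurableSpace β] (Q : Measure (UnitData 𝒳 𝒮)) [IsFiniteMeasure Q]
    (f : UnitData 𝒳 𝒮 → ℝ) (g : UnitData 𝒳 𝒮 → β) (b : β) : ℝ :=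
  ∫ y, y ∂(condDistrib f g Q b)

/-- The conditional variance function `b ↦ Var_Q(f | g = b)`. -/
def condVariance {β : Type*} [MeasurableSpace β] (Q : Measure (UnitData 𝒳 𝒮)) [IsFiniteMeasure Q]
    (f : UnitData 𝒳 𝒮 → ℝ) (g : UnitData 𝒳 𝒮 → β) (b : β) : ℝ :=
  Var[fun y : ℝ => y; condDistrib f g Q b]

/-- `φ = P(P = E)`. -/
def phi (P : Measure (UnitData 𝒳 𝒮)) : ℝ := P.real {r | label r = true}

/-- `φ(x) = P(P = E | X = x)`. -/
def phiX (P : Measure (UnitData 𝒳 𝒮)) [IsFiniteMeasure P] (x : 𝒳) : ℝ :=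
  (condDistrib label covX P x).real {true}

/-- `φ(s,x) = P(P = E | S = s, X = x)`. -/
def phiSX (P : Measure (UnitData 𝒳 𝒮)) [IsFiniteMeasure P] (z : 𝒮 × 𝒳) : ℝ :=
  (condDistrib label surrX P z).real {true}

/-- Propensity score `ρ(x) = P(W = 1 | X = x, P = E)`. -/
def rhoX (P : Measure (UnitData 𝒳 𝒮)) (x : 𝒳) : ℝ :=
  (condDistrib treat covX (expLaw P) x).real {true}

/-- Surrogacy score `ρ(s,x) = P(W = 1 | S = s, X = x, P = E)`. -/
def rhoSX (P : Measure (UnitData 𝒳 𝒮)) (z : 𝒮 × 𝒳) : ℝ :=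
  (condDistrib treat surrX (expLaw P) z).real {true}

/-- Conditional law of `Y` given `(S, X) = z` and `P = O`. -/
def outcomeKernel (P : Measure (UnitData 𝒳 𝒮)) : Kernel (𝒮 × 𝒳) ℝ :=
  condDistrib outcome surrX (obsLaw P)

/-- The surrogate index `μ(s,x,O) = E[Y | S = s, X = x, P = O]`. -/
def surrogateIndex (P : Measure (UnitData 𝒳 𝒮)) (z : 𝒮 × 𝒳) : ℝ :=
  ∫ y, y ∂(outcomeKernel P z)

/-- The quantile function `F⁻¹(u) = inf {y | u ≤ F(y)}`. -/
def quantile (ν : Measure ℝ) (u : ℝ) : ℝ := sInf {y : ℝ | u ≤ cdf ν y}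

/-- `q_{C₊}(s,x,O) = F_Y⁻¹(1 - ρ(s,x) | s,x,O)` and `q_{C₋}(s,x,O) = F_Y⁻¹(ρ(s,x) | s,x,O)`. -/
def qBound (P : Measure (UnitData 𝒳 𝒮)) : Bound → 𝒮 × 𝒳 → ℝ
  | .plus, z => quantile (outcomeKernel P z) (1 - rhoSX P z)
  | .minus, z => quantile (outcomeKernel P z) (rhoSX P z)

/-- `C(α | u) = Pr(V ≤ α | U = u)` for `(U,V) ∼ C`; here `V = U` under `C₊`
and `V = 1 - U` under `C₋`. -/
def condCopula : Bound → ℝ → ℝ → ℝ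
  | .plus, α, u => if u ≤ α then 1 else 0
  | .minus, α, u => if 1 - u ≤ α then 1 else 0

/-- `w ∈ {0,1}` as a real number. -/
def armR (w : Bool) : ℝ := if w = true then 1 else 0

/-- The weight `σ_{C,w}(u; α) = (w - C(α | u)) / (w - α)`. -/
def weight (b : Bound) (w : Bool) (u α : ℝ) : ℝ := (armR w - condCopula b α u) / (armR w - α)

/-- The weighted surrogate index
`μ_{C,w}(s,x,O) = ∫₀¹ F_Y⁻¹(u | s,x,O) σ_{C,w}(u; 1 - ρ(s,x)) du`. -/
def wsi (P : Measure (UnitData 𝒳 𝒮)) (b : Bound) (w : Bool) (z : 𝒮 × 𝒳) : ℝ :=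
  ∫ u in (0 : ℝ)..1, quantile (outcomeKernel P z) u * weight b w u (1 - rhoSX P z)

/-- `μ̄_{C,w}(x) = E[μ_{C,w}(S,X,O) | W = w, X = x, P = E]`. -/
def wsiBar (P : Measure (UnitData 𝒳 𝒮)) (b : Bound) (w : Bool) (x : 𝒳) : ℝ :=
  condMean (expLaw P) (fun r => wsi P b w (surrX r)) (fun r => (treat r, covX r)) (w, x)

/-- The bound
`τ_C = E[μ_{C,1}(S,X,O) W / ρ(X) | P = E] - E[μ_{C,0}(S,X,O) (1 - W) / (1 - ρ(X)) | P = E]`. -/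
def tauBound (P : Measure (UnitData 𝒳 𝒮)) (b : Bound) : ℝ :=
  (∫ r, wsi P b true (surrX r) * (treatR r / rhoX P (covX r)) ∂(expLaw P))
    - ∫ r, wsi P b false (surrX r) * ((1 - treatR r) / (1 - rhoX P (covX r))) ∂(expLaw P)

/-! ### Nuisance functions and moment functions -/

/-- A candidate value of the nuisance parameter: the entries of `η`, and (used for binary outcomes
only, and not an entry of `η`) a candidate `muO` for the surrogate index `μ(s,x,O)`. -/
structure Nuisance (𝒳 𝒮 : Type*) where
  mu : Bound → Bool → 𝒮 × 𝒳 → ℝ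
  mubar : Bound → Bool → 𝒳 → ℝ
  q : Bound → 𝒮 × 𝒳 → ℝ
  rhoSX : 𝒮 × 𝒳 → ℝ
  rhoX : 𝒳 → ℝ
  phiX : 𝒳 → ℝ
  phiSX : 𝒮 × 𝒳 → ℝ
  phi : ℝ
  muO : 𝒮 × 𝒳 → ℝ

/-- The true nuisance parameter. -/
def trueNuisance (P : Measure (UnitData 𝒳 𝒮)) [IsFiniteMeasure P] : Nuisance 𝒳 𝒮 where
  mu := wsi P
  mubar := wsiBar P
  q := qBound P
  rhoSX := rhoSX P
  rhoX := rhoX P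
  phiX := phiX P
  phiSX := phiSX P
  phi := phi P
  muO := surrogateIndex P

namespace Nuisance

variable {𝒳 𝒮 : Type*}

/-- `ω_ρ = (ρ(S,X), ρ(X))`. -/
def omegaRho (η : Nuisance 𝒳 𝒮) (z : 𝒮 × 𝒳) : Fin 2 → ℝ := ![η.rhoSX z, η.rhoX z.2]

/-- `ω_φ = (φ(S,X), φ)`. -/
def omegaPhi (η : Nuisance 𝒳 𝒮) (z : 𝒮 × 𝒳) : Fin 2 → ℝ := ![η.phiSX z, η.phi]

/-- `ω = (ω_ρ, ω_φ)`. -/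
def omega (η : Nuisance 𝒳 𝒮) (z : 𝒮 × 𝒳) : Fin 4 → ℝ :=
  ![η.rhoSX z, η.rhoX z.2, η.phiSX z, η.phi]

/-- `κ`: the weighted surrogate indices, their regressions on `X`, and the quantiles. -/
def kappa (η : Nuisance 𝒳 𝒮) (z : 𝒮 × 𝒳) : Fin 10 → ℝ :=
  ![η.mu .plus true z, η.mu .plus false z, η.mu .minus true z, η.mu .minus false z,
    η.mubar .plus true z.2, η.mubar .plus false z.2,
    η.mubar .minus true z.2, η.mubar .minus false z.2, η.q .plus z, η.q .minus z]

/-- All entries of `η`. -/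
def vec (η : Nuisance 𝒳 𝒮) (z : 𝒮 × 𝒳) : Fin 15 → ℝ :=
  ![η.mu .minus false z, η.mu .minus true z, η.mu .plus false z, η.mu .plus true z,
    η.mubar .minus false z.2, η.mubar .minus true z.2,
    η.mubar .plus false z.2, η.mubar .plus true z.2, η.q .plus z, η.q .minus z,
    η.rhoSX z, η.rhoX z.2, η.phiX z.2, η.phiSX z, η.phi]

end Nuisance

/-- `H_U(y, s, α) = s + (y - s)₊ / α`. -/
def HU (y s α : ℝ) : ℝ := s + 1 / α * max (y - s) 0

/-- `H_L(y, s, α) = s - (y - s)₋ / α`, with `(t)₋ = max(-t, 0)`. -/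
def HL (y s α : ℝ) : ℝ := s - 1 / α * max (-(y - s)) 0

/-- The function whose conditional mean represents `μ_{C,w}`: `H_U` for `(C₊,1)` and `(C₋,0)`,
`H_L` for `(C₊,0)` and `(C₋,1)`. -/
def dualH : Bound → Bool → ℝ → ℝ → ℝ → ℝ
  | .plus, true => HU
  | .plus, false => HL
  | .minus, true => HL
  | .minus, false => HU

/-- The orthogonal moment functions `m_{C₊}(z, τ, η)` and `m_{C₋}(z, τ, η)`. -/
def moment {𝒳 𝒮 : Type*} (b : Bound) (d : ObsData 𝒳 𝒮) (τ : ℝ) (η : Nuisance 𝒳 𝒮) : ℝ :=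
  let x : 𝒳 := d.2.1
  let z : 𝒮 × 𝒳 := (d.2.2.1, d.2.1)
  let w : ℝ := d.2.2.2.1
  let y : ℝ := d.2.2.2.2
  let e : ℝ := if d.1 = true then 1 else 0
  let o : ℝ := if d.1 = true then 0 else 1
  e / η.phi * (w / η.rhoX x * (η.mu b true z - η.mubar b true x)
      - (1 - w) / (1 - η.rhoX x) * (η.mu b false z - η.mubar b false x))
    + e / η.phi * (η.mubar b true x - η.mubar b false x - τ)
    + o / η.phi * (η.phiSX z / (1 - η.phiSX z)) *
      (η.rhoSX z / η.rhoX x * (dualH b true y (η.q b z) (η.rhoSX z) - η.mu b true z)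
      - (1 - η.rhoSX z) / (1 - η.rhoX x) *
        (dualH b false y (η.q b z) (1 - η.rhoSX z) - η.mu b false z))
    + e / η.phi * (1 / η.rhoX x) * (η.q b z - η.mu b true z) * (w - η.rhoSX z)
    + e / η.phi * (1 / (1 - η.rhoX x)) * (η.q b z - η.mu b false z) * (w - η.rhoSX z)

/-- The moment function at the true parameters, as a function of a unit's data. -/
def trueMoment (P : Measure (UnitData 𝒳 𝒮)) [IsFiniteMeasure P] (b : Bound)
    (r : UnitData 𝒳 𝒮) : ℝ :=
  moment b (observe r) (tauBound P b) (trueNuisance P)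

/-- The entries of `V = E[(m_{C₊}, m_{C₋}) (m_{C₊}, m_{C₋})ᵀ]` at the true parameters. -/
def asympCov (P : Measure (UnitData 𝒳 𝒮)) [IsFiniteMeasure P] (a b : Bound) : ℝ :=
  ∫ r, trueMoment P a r * trueMoment P b r ∂P

/-! ### Assumptions on the population -/

/-- Unconfounded treatment assignment in the experimental sample. -/
structure Unconfounded [StandardBorelSpace 𝒳] [StandardBorelSpace 𝒮]
    (P : Measure (UnitData 𝒳 𝒮)) : Prop where
  indep : CondIndepFun (MeasurableSpace.comap (covX : UnitData 𝒳 𝒮 → 𝒳) inferInstance)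
    measurable_covX.comap_le treat potential (expLaw P)
  overlap : ∀ᵐ x ∂((expLaw P).map covX), 0 < rhoX P x ∧ rhoX P x < 1

/-- Comparability of the two samples. -/
structure Comparable [StandardBorelSpace 𝒳] [StandardBorelSpace 𝒮]
    (P : Measure (UnitData 𝒳 𝒮)) [IsFiniteMeasure P] : Prop where
  indep : CondIndepFun (MeasurableSpace.comap (surrX : UnitData 𝒳 𝒮 → 𝒮 × 𝒳) inferInstance)
    measurable_surrX.comap_le label outcome P
  overlap : ∀ᵐ z ∂(P.map surrX), phiSX P z < 1

/-- Regularity of the outcome distribution. Continuous outcome: absolutely continuous with bounded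
support, and the conditional law of `Y` given `S, X, P = O` has a density that is continuous and
bounded above and below by positive constants on its support. Binary outcome: `Y ∈ {0,1}` and
`μ(S,X,O) - ρ(S,X)` has a bounded density. -/
def OutcomeRegular (P : Measure (UnitData 𝒳 𝒮)) : OutcomeKind → Prop
  | .continuous =>
      P.map outcome ≪ volume ∧
      (∃ M : ℝ, ∀ᵐ r ∂P, |outcome r| ≤ M) ∧
      ∃ (f : 𝒮 × 𝒳 → ℝ → ℝ) (lo hi : ℝ), 0 < lo ∧
        ∀ᵐ z ∂((obsLaw P).map surrX),
          Measurable (f z) ∧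
          outcomeKernel P z = volume.withDensity (fun y => ENNReal.ofReal (f z y)) ∧
          ContinuousOn (f z) (outcomeKernel P z).support ∧
          ∀ y ∈ (outcomeKernel P z).support, lo ≤ f z y ∧ f z y ≤ hi
  | .binary =>
      (∀ᵐ r ∂P, outcome r = 0 ∨ outcome r = 1) ∧
      ∃ (g : ℝ → ℝ≥0∞) (B : ℝ≥0), Measurable g ∧ (∀ y, g y ≤ B) ∧
        P.map (fun r => surrogateIndex P (surrX r) - rhoSX P (surrX r)) = volume.withDensity g

/-- Non-degeneracy: for each bound, almost surely either (1) or both (2-1) and (2-2) hold. -/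
def NonDegenerate (P : Measure (UnitData 𝒳 𝒮)) : Prop :=
  ∃ t : ℝ, 0 < t ∧ ∀ b : Bound, ∀ᵐ r ∂P,
    (t < condMean (expLaw P)
        (fun r' => (wsiBar P b true (covX r') - wsiBar P b false (covX r') - tauBound P b) ^ 2)
        covX (covX r)) ∨
    (t < condVariance (obsLaw P)
        (fun r' => 1 / rhoX P (covX r') * max (outcome r' - qBound P .plus (surrX r')) 0
          + 1 / (1 - rhoX P (covX r')) * max (-(outcome r' - qBound P .plus (surrX r'))) 0)
        surrX (surrX r) ∧
     t < condVariance (obsLaw P)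
        (fun r' => 1 / (1 - rhoX P (covX r')) * max (outcome r' - qBound P .minus (surrX r')) 0
          + 1 / rhoX P (covX r') * max (-(outcome r' - qBound P .minus (surrX r'))) 0)
        surrX (surrX r))

/-! ### The realization set -/

/-- `‖f(S,X) - g(S,X)‖_{P,p} = (E |f(S,X) - g(S,X)|^p)^{1/p}` for vector-valued `f`, `g`,
with `|·|` the Euclidean norm. -/
def lpDist {m : ℕ} (P : Measure (UnitData 𝒳 𝒮)) (p : ℝ≥0∞) (f g : 𝒮 × 𝒳 → Fin m → ℝ) : ℝ≥0∞ :=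
  eLpNorm (fun r => (WithLp.toLp 2 (f (surrX r) - g (surrX r)) : EuclideanSpace ℝ (Fin m))) p P

/-- The realization set `R_n`, where `δ` stands for `δ_n`. -/
def realizationSet (P : Measure (UnitData 𝒳 𝒮)) [IsFiniteMeasure P] (kind : OutcomeKind)
    (q ε C : ℝ) (n : ℕ) (δ : ℝ) : Set (Nuisance 𝒳 𝒮) :=
  {η |
    lpDist P (ENNReal.ofReal q) η.vec (trueNuisance P).vec ≤ ENNReal.ofReal C ∧
    (∀ᵐ r ∂P, ε ≤ η.rhoSX (surrX r) ∧ η.rhoSX (surrX r) ≤ 1 - ε) ∧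
    (∀ᵐ r ∂P, ε ≤ η.rhoX (covX r) ∧ η.rhoX (covX r) ≤ 1 - ε) ∧
    (∀ᵐ r ∂P, ε ≤ η.phiSX (surrX r) ∧ η.phiSX (surrX r) ≤ 1 - ε) ∧
    lpDist P 2 η.vec (trueNuisance P).vec ≤ ENNReal.ofReal δ ∧
    lpDist P 2 η.omega (trueNuisance P).omega * lpDist P 2 η.kappa (trueNuisance P).kappa
      ≤ ENNReal.ofReal (δ * (n : ℝ) ^ (-(1 / 2) : ℝ)) ∧
    lpDist P 2 η.omegaRho (trueNuisance P).omegaRho *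
        lpDist P 2 η.omegaPhi (trueNuisance P).omegaPhi
      ≤ ENNReal.ofReal (δ * (n : ℝ) ^ (-(1 / 2) : ℝ)) ∧
    match kind with
    | .continuous =>
        eLpNorm (fun r => η.q .plus (surrX r) - qBound P .plus (surrX r)) 2 P ^ 2
          ≤ ENNReal.ofReal (δ * (n : ℝ) ^ (-(1 / 2) : ℝ))
    | .binary =>
        eLpNorm (fun r => η.muO (surrX r) - surrogateIndex P (surrX r)) ∞ P
          ≤ ENNReal.ofReal δ ∧
        eLpNorm (fun r => η.muO (surrX r) - surrogateIndex P (surrX r)) ∞ P ^ 2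
          ≤ ENNReal.ofReal (δ * (n : ℝ) ^ (-(1 / 2) : ℝ))}

/-! ### Sampling, cross-fitting and the estimators -/

/-- `F 0, …, F (K-1)` is a partition of the observation indices `{0, …, n-1}` into `K` folds of
even size: `⌊n/K⌋` each, up to one more where `K` does not divide `n`. -/
structure IsFoldPartition {K : ℕ} (n : ℕ) (F : Fin K → Finset ℕ) : Prop where
  disjoint : ∀ k l, k ≠ l → Disjoint (F k) (F l)
  union : Finset.univ.biUnion F = Finset.range n
  card_ge : ∀ k, n / K ≤ (F k).card
  card_le : ∀ k, (F k).card ≤ n / K + 1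

section Estimation

variable {Ω : Type*} {K : ℕ}

/-- The information available outside the fold `Fk`: the observed data of the units of
`{0, …, n-1}` not in `Fk`, together with the learner's own randomness `aux`. -/
@[reducible]
def outOfFold (D : ℕ → Ω → UnitData 𝒳 𝒮) (aux : MeasurableSpace Ω) (n : ℕ) (Fk : Finset ℕ) :
    MeasurableSpace Ω :=
  aux ⊔ ⨆ i ∈ Finset.range n \ Fk,
    MeasurableSpace.comap (fun ω => observe (D i ω)) inferInstance

/-- `η̂_{n,k}` is a cross-fitted nuisance estimator: for every `n` and every fold `k`, it is a
(jointly measurable) function of the data outside the `k`-th fold and of extra randomness of the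
learner that is independent of the data (trivial for a deterministic learner). -/
structure IsCrossFitted [mΩ : MeasurableSpace Ω] (μ : Measure Ω) (D : ℕ → Ω → UnitData 𝒳 𝒮)
    (F : ℕ → Fin K → Finset ℕ) (aux : ℕ → MeasurableSpace Ω)
    (ηhat : ℕ → Fin K → Ω → Nuisance 𝒳 𝒮) : Prop where
  aux_le : ∀ n, aux n ≤ mΩ
  aux_indep : ∀ n, Indep (aux n)
    (⨆ i ∈ Finset.range n, MeasurableSpace.comap (D i) inferInstance) μ
  measurable_vec : ∀ n k,
    @Measurable (Ω × (𝒮 × 𝒳)) (Fin 15 → ℝ)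
      (@Prod.instMeasurableSpace _ _ (outOfFold D (aux n) n (F n k)) inferInstance) inferInstance
      (fun p => (ηhat n k p.1).vec p.2)
  measurable_muO : ∀ n k,
    @Measurable (Ω × (𝒮 × 𝒳)) ℝ
      (@Prod.instMeasurableSpace _ _ (outOfFold D (aux n) n (F n k)) inferInstance) inferInstance
      (fun p => (ηhat n k p.1).muO p.2)

/-- The cross-fitted empirical moment `(1/n) ∑ᵢ m_C(Zᵢ, τ, η̂)`, where `η̂` is `η̂_k` for `i` in the
`k`-th fold. -/
def empMoment (D : ℕ → Ω → UnitData 𝒳 𝒮) (F : ℕ → Fin K → Finset ℕ)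
    (ηhat : ℕ → Fin K → Ω → Nuisance 𝒳 𝒮) (b : Bound) (n : ℕ) (ω : Ω) (τ : ℝ) : ℝ :=
  1 / (n : ℝ) * ∑ k, ∑ i ∈ F n k, moment b (observe (D i ω)) τ (ηhat n k ω)

/-- `τ̂` solves the empirical moment equation whenever that equation has a solution. -/
def IsDebiasedEstimator (D : ℕ → Ω → UnitData 𝒳 𝒮) (F : ℕ → Fin K → Finset ℕ)
    (ηhat : ℕ → Fin K → Ω → Nuisance 𝒳 𝒮) (τhat : Bound → ℕ → Ω → ℝ) : Prop :=
  ∀ b n ω, (∃ t : ℝ, empMoment D F ηhat b n ω t = 0) →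
    empMoment D F ηhat b n ω (τhat b n ω) = 0

/-- The entries of the variance estimator
`(1/K) ∑ₖ r⁻¹ ∑_{i ∈ F_k} m(Zᵢ, τ̂, η̂_k) m(Zᵢ, τ̂, η̂_k)ᵀ`, `r = ⌊n/K⌋`. -/
def covEstimator (D : ℕ → Ω → UnitData 𝒳 𝒮) (F : ℕ → Fin K → Finset ℕ)
    (ηhat : ℕ → Fin K → Ω → Nuisance 𝒳 𝒮) (τhat : Bound → ℕ → Ω → ℝ) (a b : Bound)
    (n : ℕ) (ω : Ω) : ℝ :=
  1 / (K : ℝ) * ∑ k, ((n / K : ℕ) : ℝ)⁻¹ * ∑ i ∈ F n k,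
    moment a (observe (D i ω)) (τhat a n ω) (ηhat n k ω) *
      moment b (observe (D i ω)) (τhat b n ω) (ηhat n k ω)

end Estimation

end

end SurrogateBounds

open SurrogateBounds

namespace SurrogateBounds

/-! ### Quantile functions -/

/-! The estimated moment functions are compared with the true ones in mean square over each fold; a
weak law for products of true moment functions then gives the limit.

Boundedness. Realization sets of arbitrarily small L² radius are nonempty, so the true scores
inherit the bounds ε and 1 - ε (`scoreBounds_of_estimator`). As the outcome is bounded, so are the
quantiles and the weighted surrogate indices (`ScoreBounds.exists_truthBounds`), and with them the
true moment functions. In particular the entries of V are finite.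

Nuisance error. On the realization set the moment functions at η̃ and η differ by at most c ‖η̃ - η‖
(`exists_lipschitz_moment`). Estimated conditional means and quantiles may be unbounded, but they
enter with linear growth, against bounded factors made of scores. By cross-fitting, η̂ is
independent of the fold it is evaluated on. Given the data outside the fold, the expected squared
error per unit is therefore at most c²δₙ², and Markov's inequality applies
(`whp_sum_momentError_sq_le`).

Consistency of τ̂. The moment function is affine in τ with slope -1{P = E}/φ and has mean zero at
the truth (`TruthBounds.integral_trueMoment`). Three facts give mean zero: the
inverse-probability-weighted term has mean τ_C by definition; the terms in W - ρ are residuals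
orthogonal to functions of X or of (S,X); and H(Y, q_C, ·) has conditional mean μ_{C,w}, by the
Rockafellar–Uryasev representation `integral_quantile_mul_weight`. So the constant term of the
estimating equation is o(n) while its slope is of order n (`abs_tauhat_sub_le`).

Products. Since the true moment functions are bounded, mean-square closeness passes to averaged
products (`abs_sum_mul_sub_le`). Chebyshev's inequality handles the averages of true products
(`whp_sum_sub_le`), and dividing by r instead of the fold size changes a fold sum by at most one
multiple of V. -/

lemma bddBelow_quantile_set (ν : Measure ℝ) {u : ℝ} (hu : 0 < u) :
    BddBelow {y : ℝ | u ≤ cdf ν y} := by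
  have h := (tendsto_cdf_atBot ν).eventually (gt_mem_nhds hu)
  obtain ⟨a, ha⟩ := eventually_atBot.1 h
  refine ⟨a, fun y hy => ?_⟩
  by_contra hlt
  exact absurd (ha y (not_le.1 hlt).le) (not_lt.2 hy)

/-- Right continuity of the distribution function turns the infimum into a minimum, whence the
Galois connection. The two hypotheses exclude the default values of `sInf`. -/
lemma quantile_le_iff (ν : Measure ℝ) {u : ℝ} (hu : 0 < u) (hne : ∃ y, u ≤ cdf ν y) (y : ℝ) :
    quantile ν u ≤ y ↔ u ≤ cdf ν y := by
  have hb := bddBelow_quantile_set ν hu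
  constructor
  · intro h
    have hlim : Tendsto (cdf ν) (𝓝[>] y) (𝓝 (cdf ν y)) :=
      ((cdf ν).right_continuous y).mono_left (nhdsWithin_mono _ Set.Ioi_subset_Ici_self)
    refine ge_of_tendsto hlim ?_
    filter_upwards [self_mem_nhdsWithin] with z hz
    obtain ⟨w, hw, hwz⟩ := (csInf_lt_iff hb hne).1 (lt_of_le_of_lt h hz)
    exact le_trans hw (monotone_cdf ν hwz.le)
  · intro h
    exact csInf_le hb h

lemma exists_le_cdf (ν : Measure ℝ) {u : ℝ} (hu : u < 1) : ∃ y, u ≤ cdf ν y := by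
  obtain ⟨y, hy⟩ := ((tendsto_cdf_atTop ν).eventually (lt_mem_nhds hu)).exists
  exact ⟨y, hy.le⟩

lemma quantile_le_iff_of_mem (ν : Measure ℝ) {u : ℝ} (hu : u ∈ Set.Ioo (0 : ℝ) 1) (y : ℝ) :
    quantile ν u ≤ y ↔ u ≤ cdf ν y :=
  quantile_le_iff ν hu.1 (exists_le_cdf ν hu.2) y

lemma quantile_mono (ν : Measure ℝ) {u v : ℝ} (hu : u ∈ Set.Ioo (0 : ℝ) 1)
    (hv : v ∈ Set.Ioo (0 : ℝ) 1) (huv : u ≤ v) : quantile ν u ≤ quantile ν v := by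
  rw [quantile_le_iff_of_mem ν hu]
  exact huv.trans ((quantile_le_iff_of_mem ν hv _).1 le_rfl)

lemma measurable_quantile {α : Type*} [MeasurableSpace α] (κ : Kernel α ℝ) [IsMarkovKernel κ]
    {u : α → ℝ} (hu : Measurable u) : Measurable fun a => quantile (κ a) (u a) := by
  have hcdf : ∀ y : ℝ, Measurable fun a => cdf (κ a) y := fun y => by
    simp_rw [cdf_eq_real]
    exact (κ.measurable_coe measurableSet_Iic).ennreal_toReal
  -- On `G` the infimum is genuine and sublevel sets are read off from the Galois connection. Off
  -- `G` the defining set is empty or all of ℝ, and `sInf` is 0 in both cases.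
  set G : Set α := {a | 0 < u a} ∩ ⋃ n : ℕ, {a | u a ≤ cdf (κ a) n} with hG
  have hGm : MeasurableSet G := (measurableSet_lt measurable_const hu).inter
    (MeasurableSet.iUnion fun n => measurableSet_le hu (hcdf n))
  have hGmem : ∀ a ∈ G, 0 < u a ∧ ∃ y, u a ≤ cdf (κ a) y := by
    rintro a ⟨h, h'⟩
    obtain ⟨n, hn⟩ := Set.mem_iUnion.1 h'
    exact ⟨h, n, hn⟩
  have hoff : ∀ a ∉ G, quantile (κ a) (u a) = 0 := by
    intro a ha
    by_cases h0 : 0 < u a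
    · have : {y : ℝ | u a ≤ cdf (κ a) y} = ∅ := by
        refine Set.eq_empty_of_forall_notMem fun y hy => ha ⟨h0, Set.mem_iUnion.2 ?_⟩
        obtain ⟨n, hn⟩ := exists_nat_ge y
        exact ⟨n, le_trans hy (monotone_cdf _ hn)⟩
      simp [quantile, this]
    · have : {y : ℝ | u a ≤ cdf (κ a) y} = Set.univ :=
        Set.eq_univ_of_forall fun y => (not_lt.1 h0).trans (cdf_nonneg _ _)
      simp [quantile, this]
  refine measurable_of_Iic fun y => ?_
  have : (fun a => quantile (κ a) (u a)) ⁻¹' Set.Iic y =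
      (G ∩ {a | u a ≤ cdf (κ a) y}) ∪ (Gᶜ ∩ {_a | (0 : ℝ) ≤ y}) := by
    ext a
    by_cases ha : a ∈ G
    · have := quantile_le_iff (κ a) (hGmem a ha).1 (hGmem a ha).2 y
      simp [ha, this]
    · simp [ha, hoff a ha]
  rw [this]
  exact (hGm.inter (measurableSet_le hu (hcdf y))).union (hGm.compl.inter (MeasurableSet.const _))

/-- The quantile transform: `F⁻¹(U) ∼ ν` for `U` uniform on `(0,1)`. -/
lemma map_quantile (ν : Measure ℝ) [IsProbabilityMeasure ν] :
    (volume.restrict (Set.Ioo (0 : ℝ) 1)).map (quantile ν) = ν := by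
  have hm : Measurable (quantile ν) :=
    measurable_quantile (Kernel.const ℝ ν) (u := fun u => u) measurable_id
  have : IsProbabilityMeasure (volume.restrict (Set.Ioo (0 : ℝ) 1)) := ⟨by simp⟩
  have : IsProbabilityMeasure ((volume.restrict (Set.Ioo (0 : ℝ) 1)).map (quantile ν)) :=
    Measure.isProbabilityMeasure_map hm.aemeasurable
  refine Measure.ext_of_Iic _ _ fun y => ?_
  rw [Measure.map_apply hm measurableSet_Iic, Measure.restrict_apply (hm measurableSet_Iic),
    ← ofReal_cdf]
  have h1 : quantile ν ⁻¹' Set.Iic y ∩ Set.Ioo 0 1 = Set.Ioo 0 1 ∩ Set.Iic (cdf ν y) := by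
    ext u
    simp only [Set.mem_inter_iff, Set.mem_preimage, Set.mem_Iic]
    constructor
    · rintro ⟨h, hu⟩
      exact ⟨hu, (quantile_le_iff_of_mem ν hu y).1 h⟩
    · rintro ⟨hu, h⟩
      exact ⟨(quantile_le_iff_of_mem ν hu y).2 h, hu⟩
  rw [h1]
  -- The set lies between (0, F(y)) and (0, F(y)], both of length F(y); the point F(y) itself is
  -- excluded when F(y) = 1.
  refine le_antisymm ?_ ?_
  · refine (measure_mono (t := Set.Ioc 0 (cdf ν y)) fun u hu => ⟨hu.1.1, hu.2⟩).trans ?_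
    simp
  · refine le_trans ?_ (measure_mono (s := Set.Ioo 0 (cdf ν y)) fun u hu =>
      ⟨⟨hu.1, hu.2.trans_le (cdf_le_one _ _)⟩, hu.2.le⟩)
    simp

lemma abs_quantile_le (ν : Measure ℝ) [IsProbabilityMeasure ν] {M u : ℝ}
    (hM : ∀ᵐ y ∂ν, |y| ≤ M) (hu : u ∈ Set.Ioo (0 : ℝ) 1) : |quantile ν u| ≤ M := by
  rw [abs_le]
  constructor
  · refine le_csInf (exists_le_cdf ν hu.2) fun y hy => ?_
    by_contra hlt
    have : ν (Set.Iic y) = 0 := by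
      refine measure_mono_null (fun z hz => ?_) hM
      simp only [Set.mem_compl_iff, Set.mem_ofPred_eq, abs_le, not_and_or, not_le]
      left
      exact lt_of_le_of_lt hz (not_le.1 hlt)
    have h0 : cdf ν y = 0 := by rw [cdf_eq_real, measureReal_def, this]; simp
    have : u ≤ cdf ν y := hy
    linarith [hu.1]
  · rw [quantile_le_iff_of_mem ν hu]
    have : ν (Set.Iic M) = 1 := by
      rw [← prob_compl_eq_zero_iff measurableSet_Iic]
      refine measure_mono_null (fun z hz => ?_) hM
      simp only [Set.mem_compl_iff, Set.mem_ofPred_eq, Set.mem_Iic] at hz ⊢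
      exact fun h => hz ((le_abs_self z).trans h)
    rw [cdf_eq_real, measureReal_def, this]
    simpa using hu.2.le

/-! ### The dual representation of the weighted surrogate index -/

/-- The level `q_C = F⁻¹(level)` at which the outcome distribution is split, if `ρ(s,x) = ρ`. -/
noncomputable def level : Bound → ℝ → ℝ
  | .plus, ρ => 1 - ρ
  | .minus, ρ => ρ

lemma level_mem {ρ : ℝ} (h : ρ ∈ Set.Ioo (0 : ℝ) 1) (b : Bound) :
    level b ρ ∈ Set.Ioo (0 : ℝ) 1 := by
  cases b <;> simp only [level, Set.mem_Ioo] at h ⊢ <;> constructor <;> linarith [h.1, h.2]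

/-- `ρ` for the treated arm and `1 - ρ` for the control arm. -/
noncomputable def armProb (w : Bool) (ρ : ℝ) : ℝ := if w = true then ρ else 1 - ρ

/-- Each weight is the density of the uniform law on a tail interval of (0,1): the upper tail for
(C₊,1) and (C₋,0), the lower tail for the other two, of length ρ for the treated arm and 1 - ρ for
the control arm. -/
lemma integral_weight {ρ : ℝ} (h : ρ ∈ Set.Ioo (0 : ℝ) 1) (b : Bound) (w : Bool) :
    ∫ u in Set.Ioo (0 : ℝ) 1, weight b w u (1 - ρ) = 1 := by
  have hρ := h.1.ne'
  have hρ' : 1 - ρ ≠ 0 := by linarith [h.2]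
  have key : ∀ s : Set ℝ, MeasurableSet s → ∀ c : ℝ,
      ∫ u in Set.Ioo (0 : ℝ) 1, s.indicator (fun _ => c) u
        = volume.real (s ∩ Set.Ioo 0 1) * c := by
    intro s hs c
    rw [integral_indicator_const _ hs, measureReal_restrict_apply hs, smul_eq_mul]
  cases b <;> cases w
  · have : ∀ u, weight .minus false u (1 - ρ) =
        (Set.Ici ρ).indicator (fun _ => 1 / (1 - ρ)) u := by
      intro u
      have h1 : 1 - u ≤ 1 - ρ ↔ ρ ≤ u := sub_le_sub_iff_left 1
      by_cases hu : ρ ≤ u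
      · simp only [weight, armR, condCopula, h1, hu, Set.indicator, Set.mem_Ici]; simp; grind
      · simp [weight, armR, condCopula, h1, hu, Set.indicator, Set.mem_Ici,
          -tsub_le_iff_right]
    simp_rw [this]
    rw [key _ measurableSet_Ici]
    have : Set.Ici ρ ∩ Set.Ioo 0 1 = Set.Ico ρ 1 := by
      ext u; simp only [Set.mem_inter_iff, Set.mem_Ici, Set.mem_Ioo, Set.mem_Ico]
      exact ⟨fun h' => ⟨h'.1, h'.2.2⟩, fun h' => ⟨h'.1, h.1.trans_le h'.1, h'.2⟩⟩
    rw [this, Real.volume_real_Ico_of_le h.2.le]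
    field_simp
  · have : ∀ u, weight .minus true u (1 - ρ) =
        (Set.Iio ρ).indicator (fun _ => 1 / ρ) u := by
      intro u
      have h1 : 1 - u ≤ 1 - ρ ↔ ¬ u < ρ := (sub_le_sub_iff_left 1).trans not_lt.symm
      by_cases hu : u < ρ <;>
        simp [weight, armR, condCopula, h1, hu, Set.indicator,
          -tsub_le_iff_right]
    simp_rw [this]
    rw [key _ measurableSet_Iio]
    have : Set.Iio ρ ∩ Set.Ioo 0 1 = Set.Ioo 0 ρ := by
      ext u; simp only [Set.mem_inter_iff, Set.mem_Iio, Set.mem_Ioo]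
      exact ⟨fun h' => ⟨h'.2.1, h'.1⟩, fun h' => ⟨h'.2, h'.1, h'.2.trans h.2⟩⟩
    rw [this, Real.volume_real_Ioo_of_le h.1.le]
    field_simp
    ring
  · have : ∀ u, weight .plus false u (1 - ρ) =
        (Set.Iic (1 - ρ)).indicator (fun _ => 1 / (1 - ρ)) u := by
      intro u
      by_cases hu : u ≤ 1 - ρ
      · simp [weight, armR, condCopula, hu]; grind
      · simp [weight, armR, condCopula, hu]
    simp_rw [this]
    rw [key _ measurableSet_Iic]
    have : Set.Iic (1 - ρ) ∩ Set.Ioo 0 1 = Set.Ioc 0 (1 - ρ) := by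
      ext u; simp only [Set.mem_inter_iff, Set.mem_Iic, Set.mem_Ioo, Set.mem_Ioc]
      exact ⟨fun h' => ⟨h'.2.1, h'.1⟩, fun h' => ⟨h'.2, h'.1, by linarith [h.1]⟩⟩
    rw [this, Real.volume_real_Ioc_of_le (by linarith [h.2])]
    field_simp
    ring
  · have : ∀ u, weight .plus true u (1 - ρ) =
        (Set.Ioi (1 - ρ)).indicator (fun _ => 1 / ρ) u := by
      intro u
      by_cases hu : u ≤ 1 - ρ
      · simp [weight, armR, condCopula, hu]
      · simp [weight, armR, condCopula, hu, not_le.1 hu]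
    simp_rw [this]
    rw [key _ measurableSet_Ioi]
    have : Set.Ioi (1 - ρ) ∩ Set.Ioo 0 1 = Set.Ioo (1 - ρ) 1 := by
      ext u; simp only [Set.mem_inter_iff, Set.mem_Ioi, Set.mem_Ioo]
      exact ⟨fun h' => ⟨h'.1, h'.2.2⟩, fun h' => ⟨h'.1, by linarith [h.2], h'.2⟩⟩
    rw [this, Real.volume_real_Ioo_of_le (by linarith [h.1])]
    field_simp
    ring

/-- By monotonicity of the quantile function, the side of the level on which u lies decides the sign
of F⁻¹(u) - q_C, so the positive or negative part in H switches on where the weight does. Ties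
F⁻¹(u) = q_C are harmless. After integration the q_C term vanishes because the weight has mean one.
-/
lemma dualH_quantile (ν : Measure ℝ) {ρ u : ℝ} (h : ρ ∈ Set.Ioo (0 : ℝ) 1)
    (hu : u ∈ Set.Ioo (0 : ℝ) 1) (b : Bound) (w : Bool) :
    dualH b w (quantile ν u) (quantile ν (level b ρ)) (armProb w ρ)
      = quantile ν u * weight b w u (1 - ρ)
        + quantile ν (level b ρ) * (1 - weight b w u (1 - ρ)) := by
  have hl := level_mem h b
  have hρ := h.1.ne'
  have hρ' : 1 - ρ ≠ 0 := by linarith [h.2]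
  have hle : u ≤ level b ρ → quantile ν u ≤ quantile ν (level b ρ) := quantile_mono ν hu hl
  have hge : level b ρ ≤ u → quantile ν (level b ρ) ≤ quantile ν u := quantile_mono ν hl hu
  generalize quantile ν u = a at *
  generalize hq : quantile ν (level b ρ) = q at *
  cases b <;> cases w <;> simp only [level, dualH, HU, HL, armProb, weight, armR, condCopula,
    if_true, Bool.false_eq_true, if_false] at *
  · by_cases hc : ρ ≤ u
    · rw [if_pos (by linarith), max_eq_left (by linarith [hge hc])]; field_simp; grind
    · rw [if_neg (by linarith), max_eq_right (by linarith [hle (by linarith)])]; field_simp; ring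
  · by_cases hc : ρ ≤ u
    · rw [if_pos (by linarith), max_eq_right (by linarith [hge hc])]; field_simp; ring
    · rw [if_neg (by linarith), max_eq_left (by linarith [hle (by linarith)])]; field_simp; grind
  · by_cases hc : u ≤ 1 - ρ
    · rw [if_pos hc, max_eq_left (by linarith [hle hc])]; field_simp; grind
    · rw [if_neg hc, max_eq_right (by linarith [hge (by linarith)])]; field_simp; grind
  · by_cases hc : u ≤ 1 - ρ
    · rw [if_pos hc, max_eq_right (by linarith [hle hc])]; field_simp; grind
    · rw [if_neg hc, max_eq_left (by linarith [hge (by linarith)])]; field_simp; grind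

lemma measurable_weight (b : Bound) (w : Bool) :
    Measurable fun p : ℝ × ℝ => weight b w p.1 p.2 := by
  have h : Measurable fun p : ℝ × ℝ => condCopula b p.2 p.1 := by
    cases b <;> simp only [condCopula]
    · exact Measurable.ite (measurableSet_le (by fun_prop) (by fun_prop)) measurable_const
        measurable_const
    · exact Measurable.ite (measurableSet_le (by fun_prop) (by fun_prop)) measurable_const
        measurable_const
  unfold weight
  fun_prop

lemma continuous_dualH (b : Bound) (w : Bool) (q α : ℝ) : Continuous fun y => dualH b w y q α := by
  cases b <;> cases w <;> simp only [dualH, HU, HL] <;> fun_prop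

lemma abs_weight_le (b : Bound) (w : Bool) (u α : ℝ) :
    |weight b w u α| ≤ 1 / |armR w - α| := by
  unfold weight
  rw [abs_div]
  gcongr
  cases b <;> cases w <;> simp only [armR, condCopula] <;> split_ifs <;> simp_all

/-- The Rockafellar–Uryasev representation
`∫₀¹ F⁻¹(u) σ_{C,w}(u; 1 - ρ) du = E[H(Y, q_C, P(W = w))]`. -/
lemma integral_quantile_mul_weight (ν : Measure ℝ) [IsProbabilityMeasure ν] {M ρ : ℝ}
    (hM : ∀ᵐ y ∂ν, |y| ≤ M) (h : ρ ∈ Set.Ioo (0 : ℝ) 1) (b : Bound) (w : Bool) :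
    ∫ u in (0 : ℝ)..1, quantile ν u * weight b w u (1 - ρ)
      = ∫ y, dualH b w y (quantile ν (level b ρ)) (armProb w ρ) ∂ν := by
  have hm : Measurable (quantile ν) :=
    measurable_quantile (Kernel.const ℝ ν) (u := fun u => u) measurable_id
  have hwm : Measurable fun u => weight b w u (1 - ρ) :=
    (measurable_weight b w).comp (measurable_id.prodMk measurable_const)
  set q := quantile ν (level b ρ)
  have hwi : IntegrableOn (fun u => weight b w u (1 - ρ)) (Set.Ioo (0 : ℝ) 1) volume :=
    Integrable.of_bound hwm.aestronglyMeasurable (1 / |armR w - (1 - ρ)|)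
      (Eventually.of_forall fun u => abs_weight_le b w u _)
  have hqi : IntegrableOn (fun u => quantile ν u * weight b w u (1 - ρ)) (Set.Ioo (0 : ℝ) 1)
      volume := by
    refine Integrable.of_bound (hm.mul hwm).aestronglyMeasurable (M * (1 / |armR w - (1 - ρ)|)) ?_
    filter_upwards [ae_restrict_mem measurableSet_Ioo] with u hu
    rw [Real.norm_eq_abs, abs_mul]
    have hq := abs_quantile_le ν hM hu
    exact mul_le_mul hq (abs_weight_le b w u _) (abs_nonneg _) ((abs_nonneg _).trans hq)
  have hci : IntegrableOn (fun u => q * (1 - weight b w u (1 - ρ))) (Set.Ioo (0 : ℝ) 1) volume :=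
    ((integrable_const (1 : ℝ)).sub hwi).const_mul q
  rw [intervalIntegral.integral_of_le zero_le_one, integral_Ioc_eq_integral_Ioo]
  -- The conditional law of the outcome is written as the law of F⁻¹(U), so both sides become
  -- integrals over (0,1).
  conv_rhs => rw [← map_quantile ν]
  rw [integral_map hm.aemeasurable (continuous_dualH b w _ _).aestronglyMeasurable,
    setIntegral_congr_fun measurableSet_Ioo (fun u hu => dualH_quantile ν h hu b w),
    integral_add hqi hci,
    integral_const_mul, integral_sub (integrable_const (1 : ℝ)) hwi, integral_weight h]
  simp

lemma abs_dualH_le {y q α M ε : ℝ} (hy : |y| ≤ M) (hq : |q| ≤ M) (hε : 0 < ε) (hα : ε ≤ α)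
    (b : Bound) (w : Bool) : |dualH b w y q α| ≤ M + 1 / ε * (2 * M) := by
  have h1 : 1 / α ≤ 1 / ε := one_div_le_one_div_of_le hε hα
  have h2 : 0 ≤ 1 / α := by have := hε.trans_le hα; positivity
  have hM : 0 ≤ M := (abs_nonneg _).trans hy
  have hU : |max (y - q) 0| ≤ 2 * M := by
    rw [abs_of_nonneg (le_max_right _ _)]
    exact max_le (by linarith [(abs_le.1 hy).2, (abs_le.1 hq).1]) (by linarith)
  have hL : |max (-(y - q)) 0| ≤ 2 * M := by
    rw [abs_of_nonneg (le_max_right _ _)]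
    exact max_le (by linarith [(abs_le.1 hy).1, (abs_le.1 hq).2]) (by linarith)
  have hUm : |1 / α * max (y - q) 0| ≤ 1 / ε * (2 * M) := by
    rw [abs_mul, abs_of_nonneg h2]; gcongr
  have hLm : |1 / α * max (-(y - q)) 0| ≤ 1 / ε * (2 * M) := by
    rw [abs_mul, abs_of_nonneg h2]; gcongr
  cases b <;> cases w <;> simp only [dualH, HU, HL]
  · exact (abs_add_le _ _).trans (add_le_add hq hUm)
  · exact (abs_sub _ _).trans (add_le_add hq hLm)
  · exact (abs_sub _ _).trans (add_le_add hq hLm)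
  · exact (abs_add_le _ _).trans (add_le_add hq hUm)

end SurrogateBounds

namespace SurrogateBounds

/-! ### Disintegration -/

section Disintegration

variable {α β γ : Type*} [MeasurableSpace α] [MeasurableSpace β] [MeasurableSpace γ]
  [StandardBorelSpace γ] [Nonempty γ]

lemma integral_eq_integral_condDistrib (Q : Measure α) [IsFiniteMeasure Q] {g : α → β} {Y : α → γ}
    (hg : Measurable g) (hY : Measurable Y) {h : β × γ → ℝ} (hh : Measurable h)
    (hi : Integrable (fun r => h (g r, Y r)) Q) :
    ∫ r, h (g r, Y r) ∂Q = ∫ r, ∫ y, h (g r, y) ∂(condDistrib Y g Q (g r)) ∂Q := by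
  have hp : Measurable fun r => (g r, Y r) := hg.prodMk hY
  have hi' : Integrable h (Q.map g ⊗ₘ condDistrib Y g Q) := by
    rw [compProd_map_condDistrib hY.aemeasurable]
    exact (integrable_map_measure hh.aestronglyMeasurable hp.aemeasurable).2 hi
  have h1 : ∫ r, h (g r, Y r) ∂Q = ∫ p, h p ∂(Q.map fun r => (g r, Y r)) :=
    (integral_map hp.aemeasurable hh.aestronglyMeasurable).symm
  rw [h1, ← compProd_map_condDistrib hY.aemeasurable, Measure.integral_compProd hi',
    integral_map hg.aemeasurable]
  exact (hh.stronglyMeasurable.integral_condDistrib).aestronglyMeasurable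

lemma ae_condDistrib_of_ae (Q : Measure α) [IsFiniteMeasure Q] {g : α → β} {Y : α → γ}
    (hg : Measurable g) (hY : Measurable Y) {p : γ → Prop} (hp : MeasurableSet {y | p y})
    (h : ∀ᵐ r ∂Q, p (Y r)) : ∀ᵐ b ∂(Q.map g), ∀ᵐ y ∂(condDistrib Y g Q b), p y := by
  refine Measure.ae_ae_of_ae_compProd (p := fun x : β × γ => p x.2) ?_
  rw [compProd_map_condDistrib hY.aemeasurable]
  exact (ae_map_iff (hg.prodMk hY).aemeasurable (measurable_snd hp)).2 h

lemma ae_of_ae_imp_eq (Q : Measure α) [IsFiniteMeasure Q] {g : α → β} {t : α → Bool}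
    (hg : Measurable g) (ht : Measurable t) (v : Bool)
    (hpos : ∀ᵐ r ∂Q, 0 < (condDistrib t g Q (g r)).real {v})
    {p : β → Prop} (hp : MeasurableSet {b | p b}) (h : ∀ᵐ r ∂Q, t r = v → p (g r)) :
    ∀ᵐ r ∂Q, p (g r) := by
  have hA : MeasurableSet {b | p b}ᶜ := hp.compl
  have h0 : Q (g ⁻¹' {b | p b}ᶜ ∩ t ⁻¹' {v}) = 0 := by
    refine measure_mono_null (fun r hr => ?_) h
    exact fun hr' => hr.1 (hr' hr.2)
  rw [← setLIntegral_preimage_condDistrib hg ht.aemeasurable (measurableSet_singleton v) hA,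
    lintegral_eq_zero_iff (f := fun a => condDistrib t g Q (g a) {v})
      ((Kernel.measurable_coe _ (measurableSet_singleton v)).comp hg),
    EventuallyEq, ae_restrict_iff' (hg hA)] at h0
  filter_upwards [h0, hpos] with r h1 h2
  by_contra hr
  have := h1 hr
  simp only [Pi.zero_apply] at this
  simp [measureReal_def, this] at h2

lemma condDistrib_real_false (Q : Measure α) [IsFiniteMeasure Q] (g : α → β) (t : α → Bool)
    (b : β) : (condDistrib t g Q b).real {false} = 1 - (condDistrib t g Q b).real {true} := by
  have : ({false} : Set Bool) = {true}ᶜ := by ext x; cases x <;> simp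
  rw [this, probReal_compl_eq_one_sub (measurableSet_singleton _)]

/-- Given g, the indicator of t = true has mean equal to its conditional probability, so the
residual integrates to zero fibre by fibre. -/
lemma integral_indicator_sub_mul_eq_zero (Q : Measure α) [IsFiniteMeasure Q] {g : α → β}
    {t : α → Bool} (hg : Measurable g) (ht : Measurable t) {f : β → ℝ} (hf : Measurable f)
    (hi : Integrable (fun r => ((if t r = true then (1 : ℝ) else 0)
      - (condDistrib t g Q (g r)).real {true}) * f (g r)) Q) :
    ∫ r, ((if t r = true then (1 : ℝ) else 0)
      - (condDistrib t g Q (g r)).real {true}) * f (g r) ∂Q = 0 := by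
  have hb : Measurable fun x : Bool => if x = true then (1 : ℝ) else 0 := measurable_of_countable _
  have hk : Measurable fun b => (condDistrib t g Q b).real {true} :=
    (Kernel.measurable_coe _ (measurableSet_singleton true)).ennreal_toReal
  rw [integral_eq_integral_condDistrib Q hg ht
    (h := fun x => ((if x.2 = true then (1 : ℝ) else 0)
      - (condDistrib t g Q x.1).real {true}) * f x.1)
    (((hb.comp measurable_snd).sub (hk.comp measurable_fst)).mul (hf.comp measurable_fst)) hi]
  refine integral_eq_zero_of_ae (Eventually.of_forall fun r => ?_)
  simp only [Pi.zero_apply]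
  rw [integral_mul_const, integral_sub (Integrable.of_finite) (integrable_const _)]
  have : (fun x : Bool => if x = true then (1 : ℝ) else 0)
      = ({true} : Set Bool).indicator fun _ => 1 := by
    ext x; cases x <;> simp
  rw [this, integral_indicator_const _ (measurableSet_singleton _), integral_const]
  simp only [probReal_univ, smul_eq_mul, mul_one, one_mul, sub_self, zero_mul]

end Disintegration

/-! ### Measurability of the population quantities -/

attribute [fun_prop] measurable_covX measurable_treat measurable_surr measurable_surrX

section Measurability

variable {𝒳 𝒮 : Type*} [MeasurableSpace 𝒳] [MeasurableSpace 𝒮]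

@[fun_prop]
lemma measurable_label : Measurable (label : UnitData 𝒳 𝒮 → Bool) := by
  unfold label; fun_prop

@[fun_prop]
lemma measurable_treatR : Measurable (treatR : UnitData 𝒳 𝒮 → ℝ) :=
  (measurable_of_countable fun x : Bool => if x = true then (1 : ℝ) else 0).comp measurable_treat

@[fun_prop]
lemma measurable_outcome : Measurable (outcome : UnitData 𝒳 𝒮 → ℝ) := by
  unfold outcome
  exact Measurable.ite (measurable_treat (measurableSet_singleton true)) (by fun_prop)
    (by fun_prop)

@[fun_prop]
lemma measurable_observe : Measurable (observe : UnitData 𝒳 𝒮 → ObsData 𝒳 𝒮) := by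
  have hl : MeasurableSet {r : UnitData 𝒳 𝒮 | label r = true} :=
    measurable_label (measurableSet_singleton true)
  exact measurable_label.prodMk (measurable_covX.prodMk (measurable_surr.prodMk
    ((Measurable.ite hl measurable_treatR measurable_const).prodMk
      (Measurable.ite hl measurable_const measurable_outcome))))

variable (P : Measure (UnitData 𝒳 𝒮))

instance : IsMarkovKernel (outcomeKernel P) := by unfold outcomeKernel; infer_instance

@[fun_prop]
lemma measurable_phiSX [IsFiniteMeasure P] : Measurable (phiSX P) :=
  (Kernel.measurable_coe _ (measurableSet_singleton true)).ennreal_toReal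

@[fun_prop]
lemma measurable_phiX [IsFiniteMeasure P] : Measurable (phiX P) :=
  (Kernel.measurable_coe _ (measurableSet_singleton true)).ennreal_toReal

@[fun_prop]
lemma measurable_rhoX : Measurable (rhoX P) :=
  (Kernel.measurable_coe _ (measurableSet_singleton true)).ennreal_toReal

@[fun_prop]
lemma measurable_rhoSX : Measurable (rhoSX P) :=
  (Kernel.measurable_coe _ (measurableSet_singleton true)).ennreal_toReal

@[fun_prop]
lemma measurable_qBound (b : Bound) : Measurable (qBound P b) := by
  cases b
  · exact measurable_quantile (outcomeKernel P) (measurable_rhoSX P)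
  · exact measurable_quantile (outcomeKernel P) (measurable_const.sub (measurable_rhoSX P))

@[fun_prop]
lemma measurable_wsi (b : Bound) (w : Bool) : Measurable (wsi P b w) := by
  have h1 : Measurable fun p : (𝒮 × 𝒳) × ℝ => quantile (outcomeKernel P p.1) p.2 :=
    measurable_quantile ((outcomeKernel P).comap Prod.fst measurable_fst) measurable_snd
  have h2 : Measurable fun p : (𝒮 × 𝒳) × ℝ => weight b w p.2 (1 - rhoSX P p.1) :=
    (measurable_weight b w).comp (f := fun p : (𝒮 × 𝒳) × ℝ => (p.2, 1 - rhoSX P p.1))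
      (by fun_prop)
  have h3 := (h1.mul h2).stronglyMeasurable
  unfold wsi
  simp_rw [intervalIntegral.integral_of_le (zero_le_one' ℝ)]
  exact (h3.integral_prod_right (ν := volume.restrict (Set.Ioc (0 : ℝ) 1))).measurable

lemma measurable_condMean {β : Type*} [MeasurableSpace β] [IsFiniteMeasure P]
    (f : UnitData 𝒳 𝒮 → ℝ) (g : UnitData 𝒳 𝒮 → β) : Measurable (condMean P f g) :=
  (measurable_snd.stronglyMeasurable.integral_condDistrib (Y := f) (X := g) (μ := P)).measurable

@[fun_prop]
lemma measurable_wsiBar (b : Bound) (w : Bool) : Measurable (wsiBar P b w) :=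
  (measurable_condMean (expLaw P) _ _).comp (measurable_const.prodMk measurable_id)

lemma measurable_vec_trueNuisance [IsFiniteMeasure P] : Measurable (trueNuisance P).vec := by
  refine measurable_pi_lambda _ fun i => ?_
  fin_cases i
  · exact measurable_wsi P .minus false
  · exact measurable_wsi P .minus true
  · exact measurable_wsi P .plus false
  · exact measurable_wsi P .plus true
  · exact (measurable_wsiBar P .minus false).comp measurable_snd
  · exact (measurable_wsiBar P .minus true).comp measurable_snd
  · exact (measurable_wsiBar P .plus false).comp measurable_snd
  · exact (measurable_wsiBar P .plus true).comp measurable_snd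
  · exact measurable_qBound P .plus
  · exact measurable_qBound P .minus
  · exact measurable_rhoSX P
  · exact (measurable_rhoX P).comp measurable_snd
  · exact (measurable_phiX P).comp measurable_snd
  · exact measurable_phiSX P
  · exact measurable_const

end Measurability

/-! ### Laws of the two samples -/

section Laws

variable {𝒳 𝒮 : Type*} [MeasurableSpace 𝒳] [MeasurableSpace 𝒮]
  (P : Measure (UnitData 𝒳 𝒮)) [IsProbabilityMeasure P]

lemma ae_cond_label_iff {v : Bool} {p : UnitData 𝒳 𝒮 → Prop} :
    (∀ᵐ r ∂P[|{r | label r = v}], p r) ↔ ∀ᵐ r ∂P, label r = v → p r := by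
  have hE : MeasurableSet {r : UnitData 𝒳 𝒮 | label r = v} :=
    measurable_label (measurableSet_singleton v)
  rw [ProbabilityTheory.cond, Measure.ae_ennreal_smul_measure_iff
    (ENNReal.inv_ne_zero.2 (measure_ne_top _ _)), ae_restrict_iff' hE]
  rfl

lemma integral_cond_label (v : Bool) (h0 : P {r | label r = v} ≠ 0)
    (f : UnitData 𝒳 𝒮 → ℝ) :
    ∫ r, (if label r = v then f r else 0) ∂P
      = P.real {r | label r = v} * ∫ r, f r ∂P[|{r | label r = v}] := by
  have hE : MeasurableSet {r : UnitData 𝒳 𝒮 | label r = v} :=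
    measurable_label (measurableSet_singleton v)
  have h1 : (fun r => if label r = v then f r else 0) = {r | label r = v}.indicator f := by
    ext r; simp [Set.indicator]
  rw [h1, integral_indicator hE, ProbabilityTheory.cond, integral_smul_measure, smul_eq_mul,
    ENNReal.toReal_inv, measureReal_def, mul_inv_cancel_left₀]
  exact ENNReal.toReal_ne_zero.2 ⟨h0, measure_ne_top _ _⟩

end Laws

end SurrogateBounds

namespace SurrogateBounds

/-- The error `η̃ - η` of a candidate nuisance parameter, as a Euclidean vector. -/
def nuisanceError {𝒳 𝒮 : Type*} (η' η : Nuisance 𝒳 𝒮) (z : 𝒮 × 𝒳) : EuclideanSpace ℝ (Fin 15) :=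
  WithLp.toLp 2 (η'.vec z - η.vec z)

lemma abs_vec_sub_le {𝒳 𝒮 : Type*} (η' η : Nuisance 𝒳 𝒮) (z : 𝒮 × 𝒳) (i : Fin 15) :
    |η'.vec z i - η.vec z i| ≤ ‖nuisanceError η' η z‖ :=
  PiLp.norm_apply_le (nuisanceError η' η z) i

variable {𝒳 𝒮 : Type*} [MeasurableSpace 𝒳] [MeasurableSpace 𝒮]

/-! ### Boundedness of the true nuisance parameter -/

/-- The true scores are bounded away from `0` and `1`. -/
structure ScoreBounds (P : Measure (UnitData 𝒳 𝒮)) [IsFiniteMeasure P] (ε : ℝ) : Prop where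
  rhoSX_mem : ∀ᵐ r ∂P, ε ≤ rhoSX P (surrX r) ∧ rhoSX P (surrX r) ≤ 1 - ε
  rhoX_mem : ∀ᵐ r ∂P, ε ≤ rhoX P (covX r) ∧ rhoX P (covX r) ≤ 1 - ε
  phiSX_mem : ∀ᵐ r ∂P, ε ≤ phiSX P (surrX r) ∧ phiSX P (surrX r) ≤ 1 - ε

/-- The distance of f to [a,b] is at most |g - f| for every g with values in [a,b], so its L² norm
is below every κ. The vector v allows the error of one coordinate to be controlled by the norm of
the full error. -/
lemma ae_mem_Icc_of_approx {α : Type*} [MeasurableSpace α] {Q : Measure α} {f : α → ℝ}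
    (hf : Measurable f) {a b : ℝ} {E : Type*} [NormedAddCommGroup E]
    (h : ∀ κ > 0, ∃ (g : α → ℝ) (v : α → E), (∀ᵐ r ∂Q, a ≤ g r ∧ g r ≤ b) ∧
      (∀ r, |g r - f r| ≤ ‖v r‖) ∧ eLpNorm v 2 Q ≤ ENNReal.ofReal κ) :
    ∀ᵐ r ∂Q, a ≤ f r ∧ f r ≤ b := by
  set d : α → ℝ := fun r => max (max (a - f r) (f r - b)) 0 with hd
  have hdm : Measurable d := by fun_prop
  have hle : ∀ κ > 0, eLpNorm d 2 Q ≤ ENNReal.ofReal κ := by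
    intro κ hκ
    obtain ⟨g, v, hg, hv, hn⟩ := h κ hκ
    refine (eLpNorm_mono_ae ?_).trans hn
    filter_upwards [hg] with r hr
    refine le_trans ?_ (hv r)
    have h1 := abs_le.1 (le_refl |g r - f r|)
    rw [Real.norm_eq_abs, abs_of_nonneg (le_max_right _ _)]
    exact max_le (max_le (by linarith [h1.2]) (by linarith [h1.1])) (abs_nonneg _)
  have h0 : eLpNorm d 2 Q = 0 := by
    refine le_antisymm (ENNReal.le_of_forall_pos_le_add fun κ hκ _ => ?_) zero_le
    simpa using hle κ hκ
  rw [eLpNorm_eq_zero_iff hdm.aestronglyMeasurable two_ne_zero] at h0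
  filter_upwards [h0] with r hr
  have hr' : max (max (a - f r) (f r - b)) 0 ≤ 0 := le_of_eq hr
  rw [max_le_iff, max_le_iff] at hr'
  exact ⟨by linarith [hr'.1.1], by linarith [hr'.1.2]⟩

/-- The candidates have scores in [ε, 1 - ε] and come arbitrarily close to the truth in L²; the
uniform bounds pass to the limit. -/
lemma scoreBounds_of_realizationSet (P : Measure (UnitData 𝒳 𝒮)) [IsFiniteMeasure P]
    {kind : OutcomeKind} {q ε C : ℝ}
    (h : ∀ κ > 0, ∃ (n : ℕ) (δ : ℝ) (η : Nuisance 𝒳 𝒮), δ ≤ κ ∧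
      η ∈ realizationSet P kind q ε C n δ) : ScoreBounds P ε := by
  have h' : ∀ κ > 0, ∃ η : Nuisance 𝒳 𝒮,
      (∀ᵐ r ∂P, ε ≤ η.rhoSX (surrX r) ∧ η.rhoSX (surrX r) ≤ 1 - ε) ∧
      (∀ᵐ r ∂P, ε ≤ η.rhoX (covX r) ∧ η.rhoX (covX r) ≤ 1 - ε) ∧
      (∀ᵐ r ∂P, ε ≤ η.phiSX (surrX r) ∧ η.phiSX (surrX r) ≤ 1 - ε) ∧
      eLpNorm (fun r => nuisanceError η (trueNuisance P) (surrX r)) 2 P ≤ ENNReal.ofReal κ := by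
    intro κ hκ
    obtain ⟨n, δ, η, hδ, hη⟩ := h κ hκ
    exact ⟨η, hη.2.1, hη.2.2.1, hη.2.2.2.1,
      hη.2.2.2.2.1.trans (ENNReal.ofReal_le_ofReal hδ)⟩
  refine ⟨ae_mem_Icc_of_approx (E := EuclideanSpace ℝ (Fin 15)) (by fun_prop)
      fun κ hκ => ?_,
    ae_mem_Icc_of_approx (E := EuclideanSpace ℝ (Fin 15)) (by fun_prop)
      fun κ hκ => ?_,
    ae_mem_Icc_of_approx (E := EuclideanSpace ℝ (Fin 15)) (by fun_prop)
      fun κ hκ => ?_⟩ <;> obtain ⟨η, h1, h2, h3, h4⟩ := h' κ hκ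
  -- The positions 10, 11 and 13 are those of ρ(s,x), ρ(x) and φ(s,x) in `Nuisance.vec`.
  · exact ⟨_, _, h1, fun r => abs_vec_sub_le η (trueNuisance P) (surrX r) 10, h4⟩
  · exact ⟨_, _, h2, fun r => abs_vec_sub_le η (trueNuisance P) (surrX r) 11, h4⟩
  · exact ⟨_, _, h3, fun r => abs_vec_sub_le η (trueNuisance P) (surrX r) 13, h4⟩

lemma ae_abs_outcome_le_of_outcomeRegular {P : Measure (UnitData 𝒳 𝒮)} {kind : OutcomeKind}
    (h : OutcomeRegular P kind) :
    ∃ M : ℝ, 0 ≤ M ∧ ∀ᵐ r ∂P, |outcome r| ≤ M := by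
  cases kind
  · obtain ⟨M, hM⟩ := h.2.1
    exact ⟨max M 0, le_max_right _ _, hM.mono fun r hr => hr.trans (le_max_left _ _)⟩
  · refine ⟨1, zero_le_one, h.1.mono fun r hr => ?_⟩
    rcases hr with hr | hr <;> simp [hr]

section

variable {P : Measure (UnitData 𝒳 𝒮)} [IsProbabilityMeasure P] {ε : ℝ}

/-! ### Probabilities of the two samples -/

lemma integral_phiSX (P : Measure (UnitData 𝒳 𝒮)) [IsProbabilityMeasure P] :
    ∫ r, phiSX P (surrX r) ∂P = phi P := by
  have h := setLIntegral_preimage_condDistrib (μ := P) (X := surrX) (Y := label) measurable_surrX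
    measurable_label.aemeasurable (measurableSet_singleton true) MeasurableSet.univ
  rw [Set.preimage_univ, Measure.restrict_univ, Set.univ_inter] at h
  have h2 : phi P = (P (label ⁻¹' {true})).toReal := rfl
  rw [h2, ← h]
  refine integral_toReal (f := fun r => condDistrib label surrX P (surrX r) {true}) ?_
    (Eventually.of_forall fun r => measure_lt_top _ _)
  exact ((Kernel.measurable_coe _ (measurableSet_singleton true)).comp measurable_surrX).aemeasurable

lemma ScoreBounds.phi_mem (h : ScoreBounds P ε) : ε ≤ phi P ∧ phi P ≤ 1 - ε := by
  have hi : Integrable (fun r => phiSX P (surrX r)) P :=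
    Integrable.of_bound ((measurable_phiSX P).comp measurable_surrX).aestronglyMeasurable 1
      (Eventually.of_forall fun r => by
        have h0 : 0 ≤ phiSX P (surrX r) := measureReal_nonneg
        rw [Real.norm_eq_abs, abs_of_nonneg h0]
        exact measureReal_le_one)
  rw [← integral_phiSX]
  constructor
  · have := integral_mono_ae (integrable_const ε) hi (h.phiSX_mem.mono fun r hr => hr.1)
    simpa using this
  · have := integral_mono_ae hi (integrable_const (1 - ε)) (h.phiSX_mem.mono fun r hr => hr.2)
    simpa using this

lemma ScoreBounds.label_true_ne_zero (h : ScoreBounds P ε) (hε : 0 < ε) :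
    P {r | label r = true} ≠ 0 := by
  intro h0
  have : phi P = 0 := by simp [phi, measureReal_def, h0]
  linarith [h.phi_mem.1]

lemma real_label_false (P : Measure (UnitData 𝒳 𝒮)) [IsProbabilityMeasure P] :
    P.real {r | label r = false} = 1 - phi P := by
  have : {r : UnitData 𝒳 𝒮 | label r = false} = {r | label r = true}ᶜ := by ext; simp
  rw [this]
  exact probReal_compl_eq_one_sub (measurable_label (measurableSet_singleton true))

lemma ScoreBounds.label_false_ne_zero (h : ScoreBounds P ε) (hε : 0 < ε) :
    P {r | label r = false} ≠ 0 := by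
  intro h0
  have : P.real {r | label r = false} = 0 := by simp [measureReal_def, h0]
  rw [real_label_false] at this
  linarith [h.phi_mem.2]

/-! ### Passage between the population and the two samples -/

lemma expLaw_absolutelyContinuous (P : Measure (UnitData 𝒳 𝒮)) : expLaw P ≪ P :=
  ProbabilityTheory.cond_absolutelyContinuous

lemma obsLaw_absolutelyContinuous (P : Measure (UnitData 𝒳 𝒮)) : obsLaw P ≪ P :=
  ProbabilityTheory.cond_absolutelyContinuous

lemma ScoreBounds.ae_of_obsLaw (h : ScoreBounds P ε) (hε : 0 < ε) {p : 𝒮 × 𝒳 → Prop}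
    (hp : MeasurableSet {z | p z}) (ho : ∀ᵐ r ∂(obsLaw P), p (surrX r)) :
    ∀ᵐ r ∂P, p (surrX r) := by
  refine ae_of_ae_imp_eq P measurable_surrX measurable_label false ?_ hp ((ae_cond_label_iff P).1 ho)
  filter_upwards [h.phiSX_mem] with r hr
  rw [condDistrib_real_false]
  have := hr.2
  unfold phiSX at this
  linarith

lemma ScoreBounds.ae_of_expLaw (h : ScoreBounds P ε) (hε : 0 < ε) {p : 𝒮 × 𝒳 → Prop}
    (hp : MeasurableSet {z | p z}) (ho : ∀ᵐ r ∂(expLaw P), p (surrX r)) :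
    ∀ᵐ r ∂P, p (surrX r) := by
  refine ae_of_ae_imp_eq P measurable_surrX measurable_label true ?_ hp ((ae_cond_label_iff P).1 ho)
  filter_upwards [h.phiSX_mem] with r hr
  exact hε.trans_le hr.1

/-- Two transfers in a row: from arm w to the experimental sample by the bounds on ρ(x), then to the
population by the bounds on φ(s,x). It serves `wsiBar`, whose defining conditional law is determined
only at pairs (w, x) occurring in the experimental sample. -/
lemma ScoreBounds.ae_of_expLaw_arm (h : ScoreBounds P ε) (hε : 0 < ε) (w : Bool)
    {p : 𝒳 → Prop} (hp : MeasurableSet {x | p x})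
    (ho : ∀ᵐ r ∂(expLaw P), treat r = w → p (covX r)) : ∀ᵐ r ∂P, p (covX r) := by
  refine h.ae_of_expLaw hε (p := fun z => p z.2) (measurable_snd hp) ?_
  refine ae_of_ae_imp_eq (expLaw P) measurable_covX measurable_treat w ?_ hp ho
  filter_upwards [expLaw_absolutelyContinuous P h.rhoX_mem] with r hr
  cases w
  · rw [condDistrib_real_false]
    have := hr.2
    unfold rhoX at this
    linarith
  · exact hε.trans_le hr.1

/-! ### Bounds on quantiles and weighted surrogate indices -/

lemma ScoreBounds.ae_outcomeKernel (h : ScoreBounds P ε) (hε : 0 < ε) {M : ℝ}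
    (hM : ∀ᵐ r ∂P, |outcome r| ≤ M) :
    ∀ᵐ r ∂P, ∀ᵐ y ∂(outcomeKernel P (surrX r)), |y| ≤ M := by
  have hs : MeasurableSet {y : ℝ | |y| ≤ M} := measurableSet_le (by fun_prop) (by fun_prop)
  refine h.ae_of_obsLaw hε (p := fun z => ∀ᵐ y ∂(outcomeKernel P z), |y| ≤ M) ?_ ?_
  · exact measurableSet_eq_fun (Kernel.measurable_coe (outcomeKernel P) hs.compl) measurable_const
  · have := ae_condDistrib_of_ae (obsLaw P) measurable_surrX measurable_outcome hs
      (obsLaw_absolutelyContinuous P hM)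
    exact ae_of_ae_map measurable_surrX.aemeasurable this

lemma qBound_eq_level (P : Measure (UnitData 𝒳 𝒮)) (b : Bound) (z : 𝒮 × 𝒳) :
    qBound P b z = quantile (outcomeKernel P z) (level b (rhoSX P z)) := by
  cases b <;> rfl

lemma ScoreBounds.mem_Ioo {ρ : ℝ} (hε : 0 < ε) (h : ε ≤ ρ ∧ ρ ≤ 1 - ε) :
    ρ ∈ Set.Ioo (0 : ℝ) 1 := ⟨by linarith [h.1], by linarith [h.2]⟩

lemma le_armProb {ρ : ℝ} (h : ε ≤ ρ ∧ ρ ≤ 1 - ε) (w : Bool) : ε ≤ armProb w ρ := by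
  cases w <;> simp [armProb] <;> linarith [h.1, h.2]

/-- `E[H(Y, q_C, P(W = w | S, X)) | S, X, P = O] = μ_{C,w}(S, X)`. -/
lemma ScoreBounds.wsi_eq (h : ScoreBounds P ε) (hε : 0 < ε) {M : ℝ}
    (hM : ∀ᵐ r ∂P, |outcome r| ≤ M) (b : Bound) (w : Bool) :
    ∀ᵐ r ∂P, wsi P b w (surrX r) = ∫ y, dualH b w y (qBound P b (surrX r))
      (armProb w (rhoSX P (surrX r))) ∂(outcomeKernel P (surrX r)) := by
  filter_upwards [h.rhoSX_mem, h.ae_outcomeKernel hε hM] with r hr hy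
  rw [qBound_eq_level]
  exact integral_quantile_mul_weight _ hy (ScoreBounds.mem_Ioo hε hr) b w

lemma ScoreBounds.abs_qBound_le (h : ScoreBounds P ε) (hε : 0 < ε) {M : ℝ}
    (hM : ∀ᵐ r ∂P, |outcome r| ≤ M) (b : Bound) : ∀ᵐ r ∂P, |qBound P b (surrX r)| ≤ M := by
  filter_upwards [h.rhoSX_mem, h.ae_outcomeKernel hε hM] with r hr hy
  rw [qBound_eq_level]
  exact abs_quantile_le _ hy (level_mem (ScoreBounds.mem_Ioo hε hr) b)

lemma ScoreBounds.abs_wsi_le (h : ScoreBounds P ε) (hε : 0 < ε) {M : ℝ}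
    (hM : ∀ᵐ r ∂P, |outcome r| ≤ M) (b : Bound) (w : Bool) :
    ∀ᵐ r ∂P, |wsi P b w (surrX r)| ≤ M + 1 / ε * (2 * M) := by
  filter_upwards [h.rhoSX_mem, h.ae_outcomeKernel hε hM, h.wsi_eq hε hM b w, h.abs_qBound_le hε hM b]
    with r hr hy he hq
  rw [he]
  have := norm_integral_le_of_norm_le_const (μ := outcomeKernel P (surrX r))
    (f := fun y => dualH b w y (qBound P b (surrX r))
      (armProb w (rhoSX P (surrX r)))) (C := M + 1 / ε * (2 * M))
    (hy.mono fun y hy => abs_dualH_le hy hq hε (le_armProb hr w) b w)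
  simpa using this

lemma ScoreBounds.abs_wsiBar_le (h : ScoreBounds P ε) (hε : 0 < ε) {B : ℝ} (b : Bound) (w : Bool)
    (hB : ∀ᵐ r ∂P, |wsi P b w (surrX r)| ≤ B) : ∀ᵐ r ∂P, |wsiBar P b w (covX r)| ≤ B := by
  have hs : MeasurableSet {y : ℝ | |y| ≤ B} := measurableSet_le (by fun_prop) (by fun_prop)
  have hg : Measurable fun r : UnitData 𝒳 𝒮 => (treat r, covX r) := by fun_prop
  have h1 := ae_of_ae_map hg.aemeasurable (ae_condDistrib_of_ae (expLaw P) hg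
    (Y := fun r => wsi P b w (surrX r)) (by fun_prop) hs (expLaw_absolutelyContinuous P hB))
  refine h.ae_of_expLaw_arm hε w (p := fun x => |wsiBar P b w x| ≤ B)
    (measurableSet_le (by fun_prop) (by fun_prop)) ?_
  filter_upwards [h1] with r hr hw
  rw [hw] at hr
  have := norm_integral_le_of_norm_le_const (f := fun y : ℝ => y) (C := B) hr
  simpa [wsiBar, condMean] using this

/-- The true nuisance parameter and the outcome are bounded, and the scores are bounded away from
`0` and `1`. -/
structure TruthBounds (P : Measure (UnitData 𝒳 𝒮)) [IsFiniteMeasure P] (ε B : ℝ) : Prop where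
  score : ScoreBounds P ε
  outcome_le : ∀ᵐ r ∂P, |outcome r| ≤ B
  wsi_le : ∀ b w, ∀ᵐ r ∂P, |wsi P b w (surrX r)| ≤ B
  wsiBar_le : ∀ b w, ∀ᵐ r ∂P, |wsiBar P b w (covX r)| ≤ B
  qBound_le : ∀ b, ∀ᵐ r ∂P, |qBound P b (surrX r)| ≤ B

lemma ScoreBounds.exists_truthBounds (h : ScoreBounds P ε) (hε : 0 < ε) {kind : OutcomeKind}
    (hreg : OutcomeRegular P kind) : ∃ B, TruthBounds P ε B := by
  obtain ⟨M, hM0, hM⟩ := ae_abs_outcome_le_of_outcomeRegular hreg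
  have hle : M ≤ M + 1 / ε * (2 * M) := by
    have : 0 ≤ 1 / ε * (2 * M) := by positivity
    linarith
  exact ⟨M + 1 / ε * (2 * M), h, hM.mono fun r hr => hr.trans hle, h.abs_wsi_le hε hM,
    fun b w => h.abs_wsiBar_le hε b w (h.abs_wsi_le hε hM b w),
    fun b => (h.abs_qBound_le hε hM b).mono fun r hr => hr.trans hle⟩

/-! ### Residuals of the treatment -/

end

lemma integral_treatR_sub_rhoX_mul (P : Measure (UnitData 𝒳 𝒮)) (f : 𝒳 → ℝ) (hf : Measurable f)
    (hi : Integrable (fun r => (treatR r - rhoX P (covX r)) * f (covX r)) (expLaw P)) :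
    ∫ r, (treatR r - rhoX P (covX r)) * f (covX r) ∂(expLaw P) = 0 :=
  integral_indicator_sub_mul_eq_zero (expLaw P) measurable_covX measurable_treat hf hi

lemma integral_treatR_sub_rhoSX_mul (P : Measure (UnitData 𝒳 𝒮)) (f : 𝒮 × 𝒳 → ℝ) (hf : Measurable f)
    (hi : Integrable (fun r => (treatR r - rhoSX P (surrX r)) * f (surrX r)) (expLaw P)) :
    ∫ r, (treatR r - rhoSX P (surrX r)) * f (surrX r) ∂(expLaw P) = 0 :=
  integral_indicator_sub_mul_eq_zero (expLaw P) measurable_surrX measurable_treat hf hi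

end SurrogateBounds

namespace SurrogateBounds

/-! ### Locally Lipschitz dependence of the moment functions on the nuisance parameter -/

/-- `f` is bounded and `|f' - f|` is at most a constant multiple of `D`. -/
def LipApprox {ι : Type*} (D f' f : ι → ℝ) : Prop :=
  ∃ c, 0 ≤ c ∧ ∀ i, |f i| ≤ c ∧ |f' i - f i| ≤ c * D i

/-- `f` and `f'` are bounded and `|f' - f|` is at most a constant multiple of `D`. -/
def BddLipApprox {ι : Type*} (D f' f : ι → ℝ) : Prop :=
  LipApprox D f' f ∧ ∃ c, 0 ≤ c ∧ ∀ i, |f' i| ≤ c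

namespace LipApprox

variable {ι : Type*} {D f' f g' g : ι → ℝ}

lemma of_bound (c : ℝ) (hc : 0 ≤ c) (h : ∀ i, |f i| ≤ c) (hD : ∀ i, |f' i - f i| ≤ D i) :
    LipApprox D f' f := by
  -- One constant has to bound |f| and be a Lipschitz factor at least 1.
  refine ⟨c + 1, by linarith, fun i => ⟨by linarith [h i], ?_⟩⟩
  have h0 := (abs_nonneg _).trans (hD i)
  nlinarith [hD i]

lemma add (hf : LipApprox D f' f) (hg : LipApprox D g' g) :
    LipApprox D (fun i => f' i + g' i) (fun i => f i + g i) := by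
  obtain ⟨a, ha, ha'⟩ := hf
  obtain ⟨b, hb, hb'⟩ := hg
  refine ⟨a + b, by positivity, fun i => ⟨?_, ?_⟩⟩
  · exact (abs_add_le _ _).trans (add_le_add (ha' i).1 (hb' i).1)
  · have : f' i + g' i - (f i + g i) = (f' i - f i) + (g' i - g i) := by ring
    rw [this, add_mul]
    exact (abs_add_le _ _).trans (add_le_add (ha' i).2 (hb' i).2)

lemma neg (hf : LipApprox D f' f) : LipApprox D (fun i => -f' i) (fun i => -f i) := by
  obtain ⟨a, ha, ha'⟩ := hf
  refine ⟨a, ha, fun i => ⟨by simpa using (ha' i).1, ?_⟩⟩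
  have : -f' i - -f i = -(f' i - f i) := by ring
  rw [this, abs_neg]
  exact (ha' i).2

lemma sub (hf : LipApprox D f' f) (hg : LipApprox D g' g) :
    LipApprox D (fun i => f' i - g' i) (fun i => f i - g i) := by
  simpa only [sub_eq_add_neg] using hf.add hg.neg

lemma posPart (hf : LipApprox D f' f) :
    LipApprox D (fun i => max (f' i) 0) (fun i => max (f i) 0) := by
  obtain ⟨a, ha, ha'⟩ := hf
  refine ⟨a, ha, fun i => ⟨?_, (abs_max_sub_max_le_abs _ _ _).trans (ha' i).2⟩⟩
  rw [abs_of_nonneg (le_max_right _ _)]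
  exact max_le ((le_abs_self _).trans (ha' i).1) ha

end LipApprox

namespace BddLipApprox

variable {ι : Type*} {D f' f g' g : ι → ℝ}

lemma self (hD : ∀ i, 0 ≤ D i) (c : ℝ) (h : ∀ i, |f i| ≤ c) : BddLipApprox D f f := by
  have h' : ∀ i, |f i| ≤ |c| := fun i => (h i).trans (le_abs_self c)
  exact ⟨LipApprox.of_bound |c| (abs_nonneg _) h' (fun i => by simpa using hD i), |c|,
    abs_nonneg _, h'⟩

lemma of_bound (c : ℝ) (hc : 0 ≤ c) (h : ∀ i, |f i| ≤ c) (h' : ∀ i, |f' i| ≤ c)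
    (hD : ∀ i, |f' i - f i| ≤ D i) : BddLipApprox D f' f :=
  ⟨LipApprox.of_bound c hc h hD, c, hc, h'⟩

lemma sub (hf : BddLipApprox D f' f) (hg : BddLipApprox D g' g) :
    BddLipApprox D (fun i => f' i - g' i) (fun i => f i - g i) := by
  refine ⟨hf.1.sub hg.1, ?_⟩
  obtain ⟨-, a, ha, ha'⟩ := hf
  obtain ⟨-, b, hb, hb'⟩ := hg
  exact ⟨a + b, by positivity, fun i => (abs_sub _ _).trans (add_le_add (ha' i) (hb' i))⟩

/-- In f'g' - fg = f'(g' - g) + (f' - f)g only one perturbed factor has to be bounded. This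
asymmetry admits unbounded estimates of conditional means and quantiles next to bounded estimated
scores. -/
lemma mul_lip (hf : BddLipApprox D f' f) (hg : LipApprox D g' g) :
    LipApprox D (fun i => f' i * g' i) (fun i => f i * g i) := by
  obtain ⟨⟨a, ha, ha'⟩, c, hc, hc'⟩ := hf
  obtain ⟨b, hb, hb'⟩ := hg
  refine ⟨a * b + c * b, by positivity, fun i => ⟨?_, ?_⟩⟩
  · rw [abs_mul]
    have h1 := mul_le_mul (ha' i).1 (hb' i).1 (abs_nonneg _) ha
    have h2 : 0 ≤ c * b := by positivity
    linarith
  · have : f' i * g' i - f i * g i = f' i * (g' i - g i) + (f' i - f i) * g i := by ring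
    rw [this]
    refine (abs_add_le _ _).trans ?_
    rw [abs_mul, abs_mul]
    have h1 := mul_le_mul (hc' i) (hb' i).2 (abs_nonneg _) hc
    have h2 := mul_le_mul (ha' i).2 (hb' i).1 (abs_nonneg _)
      ((abs_nonneg _).trans (ha' i).2)
    linarith

lemma lip_mul (hf : LipApprox D f' f) (hg : BddLipApprox D g' g) :
    LipApprox D (fun i => f' i * g' i) (fun i => f i * g i) := by
  simpa only [mul_comm] using hg.mul_lip hf

lemma mul (hf : BddLipApprox D f' f) (hg : BddLipApprox D g' g) :
    BddLipApprox D (fun i => f' i * g' i) (fun i => f i * g i) := by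
  refine ⟨hf.mul_lip hg.1, ?_⟩
  obtain ⟨-, a, ha, ha'⟩ := hf
  obtain ⟨-, b, hb, hb'⟩ := hg
  refine ⟨a * b, by positivity, fun i => ?_⟩
  rw [abs_mul]
  exact mul_le_mul (ha' i) (hb' i) (abs_nonneg _) ha

lemma inv (hD : ∀ i, 0 ≤ D i) (hf : BddLipApprox D f' f) {ε : ℝ} (hε : 0 < ε) (h' : ∀ i, ε ≤ f' i)
    (h : ∀ i, ε ≤ f i) : BddLipApprox D (fun i => (f' i)⁻¹) (fun i => (f i)⁻¹) := by
  obtain ⟨⟨a, ha, ha'⟩, -⟩ := hf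
  have hb : ∀ x, ε ≤ x → |x⁻¹| ≤ ε⁻¹ := fun x hx => by
    rw [abs_of_pos (inv_pos.2 (hε.trans_le hx))]
    exact inv_anti₀ hε hx
  have hε' : 0 ≤ ε⁻¹ := (inv_pos.2 hε).le
  have h2 : 0 ≤ ε⁻¹ * ε⁻¹ * a := by positivity
  refine ⟨⟨ε⁻¹ + ε⁻¹ * ε⁻¹ * a, by positivity, fun i => ⟨?_, ?_⟩⟩, ε⁻¹, hε',
    fun i => hb _ (h' i)⟩
  · linarith [hb _ (h i)]
  · have hf0 : f i ≠ 0 := (hε.trans_le (h i)).ne'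
    have hf0' : f' i ≠ 0 := (hε.trans_le (h' i)).ne'
    have heq : (f' i)⁻¹ - (f i)⁻¹ = -((f' i)⁻¹ * (f i)⁻¹ * (f' i - f i)) := by
      field_simp
      ring
    rw [heq, abs_neg, abs_mul, abs_mul]
    have h1 := mul_le_mul (hb _ (h' i)) (hb _ (h i)) (abs_nonneg _) hε'
    have h3 := mul_le_mul h1 (ha' i).2 (abs_nonneg _) (by positivity)
    nlinarith [mul_nonneg hε' (hD i)]

lemma div (hD : ∀ i, 0 ≤ D i) (hf : BddLipApprox D f' f) (hg : BddLipApprox D g' g) {ε : ℝ}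
    (hε : 0 < ε) (h' : ∀ i, ε ≤ g' i) (h : ∀ i, ε ≤ g i) :
    BddLipApprox D (fun i => f' i / g' i) (fun i => f i / g i) := by
  simpa only [div_eq_mul_inv] using hf.mul (hg.inv hD hε h' h)

end BddLipApprox

/-- Bounds on an observation `d`, a candidate nuisance parameter `η'` and a bounded nuisance
parameter `η` under which the moment functions are Lipschitz. -/
structure Admissible {𝒳 𝒮 : Type*} (ε B : ℝ) (d : ObsData 𝒳 𝒮) (η' η : Nuisance 𝒳 𝒮) : Prop where
  w : |d.2.2.2.1| ≤ 1
  y : |d.2.2.2.2| ≤ B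
  mu : ∀ b w, |η.mu b w (d.2.2.1, d.2.1)| ≤ B
  mubar : ∀ b w, |η.mubar b w d.2.1| ≤ B
  q : ∀ b, |η.q b (d.2.2.1, d.2.1)| ≤ B
  rhoSX : ε ≤ η.rhoSX (d.2.2.1, d.2.1) ∧ η.rhoSX (d.2.2.1, d.2.1) ≤ 1 - ε
  rhoX : ε ≤ η.rhoX d.2.1 ∧ η.rhoX d.2.1 ≤ 1 - ε
  phiSX : ε ≤ η.phiSX (d.2.2.1, d.2.1) ∧ η.phiSX (d.2.2.1, d.2.1) ≤ 1 - ε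
  phi : ε ≤ η.phi ∧ η.phi ≤ 2
  rhoSX' : ε ≤ η'.rhoSX (d.2.2.1, d.2.1) ∧ η'.rhoSX (d.2.2.1, d.2.1) ≤ 1 - ε
  rhoX' : ε ≤ η'.rhoX d.2.1 ∧ η'.rhoX d.2.1 ≤ 1 - ε
  phiSX' : ε ≤ η'.phiSX (d.2.2.1, d.2.1) ∧ η'.phiSX (d.2.2.1, d.2.1) ≤ 1 - ε
  phi' : ε ≤ η'.phi ∧ η'.phi ≤ 2

/-- The moment function is built by sums, products, quotients with denominators at least ε, and
positive parts. In each product at most one factor, made of μ, μ̄, q or H, lacks a bound at η', so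
the product rule for one bounded factor applies throughout. -/
lemma exists_lipschitz_moment (𝒳 𝒮 : Type*) {ε B : ℝ} (hε : 0 < ε) (hB : 0 ≤ B) (b : Bound)
    (τ : ℝ) : ∃ c, 0 ≤ c ∧ ∀ (d : ObsData 𝒳 𝒮) (η' η : Nuisance 𝒳 𝒮), Admissible ε B d η' η →
      |moment b d τ η| ≤ c ∧ |moment b d τ η' - moment b d τ η|
        ≤ c * ‖nuisanceError η' η (d.2.2.1, d.2.1)‖ := by
  -- Indexing by all admissible triples makes the constants uniform in the observation and in both
  -- nuisance parameters.
  let ι := {p : ObsData 𝒳 𝒮 × Nuisance 𝒳 𝒮 × Nuisance 𝒳 𝒮 // Admissible ε B p.1 p.2.1 p.2.2}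
  let x : ι → 𝒳 := fun i => i.1.1.2.1
  let z : ι → 𝒮 × 𝒳 := fun i => (i.1.1.2.2.1, i.1.1.2.1)
  let η' : ι → Nuisance 𝒳 𝒮 := fun i => i.1.2.1
  let η : ι → Nuisance 𝒳 𝒮 := fun i => i.1.2.2
  let D : ι → ℝ := fun i => ‖nuisanceError (η' i) (η i) (z i)‖
  have hD : ∀ i, 0 ≤ D i := fun i => norm_nonneg _
  have hv : ∀ (j : Fin 15) (i : ι), |(η' i).vec (z i) j - (η i).vec (z i) j| ≤ D i :=
    fun j i => abs_vec_sub_le _ _ _ j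
  have habs : ∀ t : ℝ, ε ≤ t ∧ t ≤ 1 - ε → |t| ≤ 1 := fun t ht => by
    rw [abs_of_nonneg (hε.le.trans ht.1)]; linarith [ht.2]
  have h1 : BddLipApprox D (fun _ => 1) (fun _ => 1) := .self hD 1 (by simp)
  have hτ : BddLipApprox D (fun _ => τ) (fun _ => τ) := .self hD |τ| (fun _ => le_rfl)
  have hw : BddLipApprox D (fun i => i.1.1.2.2.2.1) (fun i => i.1.1.2.2.2.1) :=
    .self hD 1 fun i => i.2.w
  have hy : BddLipApprox D (fun i => i.1.1.2.2.2.2) (fun i => i.1.1.2.2.2.2) :=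
    .self hD B fun i => i.2.y
  have he : BddLipApprox D (fun i => if i.1.1.1 = true then (1 : ℝ) else 0)
      (fun i => if i.1.1.1 = true then (1 : ℝ) else 0) :=
    .self hD 1 fun i => by split_ifs <;> simp
  have ho : BddLipApprox D (fun i => if i.1.1.1 = true then (0 : ℝ) else 1)
      (fun i => if i.1.1.1 = true then (0 : ℝ) else 1) :=
    .self hD 1 fun i => by split_ifs <;> simp
  have hmu : ∀ w, LipApprox D (fun i => (η' i).mu b w (z i)) (fun i => (η i).mu b w (z i)) := by
    intro w
    refine .of_bound B hB (fun i => i.2.mu b w) ?_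
    cases b <;> cases w
    · exact hv 0
    · exact hv 1
    · exact hv 2
    · exact hv 3
  have hmubar : ∀ w, LipApprox D (fun i => (η' i).mubar b w (x i))
      (fun i => (η i).mubar b w (x i)) := by
    intro w
    refine .of_bound B hB (fun i => i.2.mubar b w) ?_
    cases b <;> cases w
    · exact hv 4
    · exact hv 5
    · exact hv 6
    · exact hv 7
  have hq : LipApprox D (fun i => (η' i).q b (z i)) (fun i => (η i).q b (z i)) := by
    refine .of_bound B hB (fun i => i.2.q b) ?_
    cases b
    · exact hv 9
    · exact hv 8
  have hrs : BddLipApprox D (fun i => (η' i).rhoSX (z i)) (fun i => (η i).rhoSX (z i)) :=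
    .of_bound 1 zero_le_one (fun i => habs _ i.2.rhoSX) (fun i => habs _ i.2.rhoSX') (hv 10)
  have hrx : BddLipApprox D (fun i => (η' i).rhoX (x i)) (fun i => (η i).rhoX (x i)) :=
    .of_bound 1 zero_le_one (fun i => habs _ i.2.rhoX) (fun i => habs _ i.2.rhoX') (hv 11)
  have hps : BddLipApprox D (fun i => (η' i).phiSX (z i)) (fun i => (η i).phiSX (z i)) :=
    .of_bound 1 zero_le_one (fun i => habs _ i.2.phiSX) (fun i => habs _ i.2.phiSX') (hv 13)
  have hp : BddLipApprox D (fun i => (η' i).phi) (fun i => (η i).phi) := by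
    refine .of_bound 2 zero_le_two (fun i => ?_) (fun i => ?_) (hv 14)
    · rw [abs_of_nonneg (hε.le.trans i.2.phi.1)]; exact i.2.phi.2
    · rw [abs_of_nonneg (hε.le.trans i.2.phi'.1)]; exact i.2.phi'.2
  have hep := he.div hD hp hε (fun i => i.2.phi'.1) (fun i => i.2.phi.1)
  have hop := ho.div hD hp hε (fun i => i.2.phi'.1) (fun i => i.2.phi.1)
  have hx' : ∀ i : ι, ε ≤ 1 - (η' i).rhoX (x i) := fun i => by linarith [i.2.rhoX'.2]
  have hx : ∀ i : ι, ε ≤ 1 - (η i).rhoX (x i) := fun i => by linarith [i.2.rhoX.2]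
  have h1rs := h1.sub hrs
  have h1rx := h1.sub hrx
  have hU : ∀ {a' a : ι → ℝ}, BddLipApprox D a' a → (∀ i, ε ≤ a' i) → (∀ i, ε ≤ a i) →
      LipApprox D (fun i => HU i.1.1.2.2.2.2 ((η' i).q b (z i)) (a' i))
        (fun i => HU i.1.1.2.2.2.2 ((η i).q b (z i)) (a i)) := fun h hl' hl =>
    hq.add ((h1.div hD h hε hl' hl).mul_lip (hy.1.sub hq).posPart)
  have hL : ∀ {a' a : ι → ℝ}, BddLipApprox D a' a → (∀ i, ε ≤ a' i) → (∀ i, ε ≤ a i) →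
      LipApprox D (fun i => HL i.1.1.2.2.2.2 ((η' i).q b (z i)) (a' i))
        (fun i => HL i.1.1.2.2.2.2 ((η i).q b (z i)) (a i)) := fun h hl' hl =>
    hq.sub ((h1.div hD h hε hl' hl).mul_lip (hy.1.sub hq).neg.posPart)
  have hH : ∀ (w : Bool) {a' a : ι → ℝ}, BddLipApprox D a' a → (∀ i, ε ≤ a' i) → (∀ i, ε ≤ a i) →
      LipApprox D (fun i => dualH b w i.1.1.2.2.2.2 ((η' i).q b (z i)) (a' i))
        (fun i => dualH b w i.1.1.2.2.2.2 ((η i).q b (z i)) (a i)) := by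
    intro w a' a h hl' hl
    cases b <;> cases w
    · exact hU h hl' hl
    · exact hL h hl' hl
    · exact hL h hl' hl
    · exact hU h hl' hl
  have hH1 := hH true hrs (fun i => i.2.rhoSX'.1) (fun i => i.2.rhoSX.1)
  have hH0 := hH false h1rs (fun i => by linarith [i.2.rhoSX'.2])
    (fun i => by linarith [i.2.rhoSX.2])
  have hwx := hw.div hD hrx hε (fun i => i.2.rhoX'.1) (fun i => i.2.rhoX.1)
  have hwx' := (h1.sub hw).div hD h1rx hε hx' hx
  have hsx := hrs.div hD hrx hε (fun i => i.2.rhoX'.1) (fun i => i.2.rhoX.1)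
  have hsx' := h1rs.div hD h1rx hε hx' hx
  have hix := h1.div hD hrx hε (fun i => i.2.rhoX'.1) (fun i => i.2.rhoX.1)
  have hix' := h1.div hD h1rx hε hx' hx
  have hodds := hps.div hD (h1.sub hps) hε (fun i => by linarith [i.2.phiSX'.2])
    (fun i => by linarith [i.2.phiSX.2])
  have t1 := hep.mul_lip ((hwx.mul_lip ((hmu true).sub (hmubar true))).sub
    (hwx'.mul_lip ((hmu false).sub (hmubar false))))
  have t2 := hep.mul_lip (((hmubar true).sub (hmubar false)).sub hτ.1)
  have t3 := (hop.mul hodds).mul_lip ((hsx.mul_lip (hH1.sub (hmu true))).sub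
    (hsx'.mul_lip (hH0.sub (hmu false))))
  have t4 := BddLipApprox.lip_mul ((hep.mul hix).mul_lip (hq.sub (hmu true))) (hw.sub hrs)
  have t5 := BddLipApprox.lip_mul ((hep.mul hix').mul_lip (hq.sub (hmu false))) (hw.sub hrs)
  obtain ⟨c, hc, hc'⟩ := (((t1.add t2).add t3).add t4).add t5
  exact ⟨c, hc, fun d η' η h => hc' ⟨(d, η', η), h⟩⟩

section

variable {𝒳 𝒮 : Type*} [MeasurableSpace 𝒳] [MeasurableSpace 𝒮]

/-! ### The moment functions as functions of the observation and the nuisance vector -/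

/-- The nuisance parameter all of whose entries are constant, with values the entries of `v`. -/
def Nuisance.ofVec {𝒳 𝒮 : Type*} (v : Fin 15 → ℝ) : Nuisance 𝒳 𝒮 where
  mu
    | .minus, false, _ => v 0
    | .minus, true, _ => v 1
    | .plus, false, _ => v 2
    | .plus, true, _ => v 3
  mubar
    | .minus, false, _ => v 4
    | .minus, true, _ => v 5
    | .plus, false, _ => v 6
    | .plus, true, _ => v 7
  q
    | .plus, _ => v 8
    | .minus, _ => v 9
  rhoSX _ := v 10
  rhoX _ := v 11
  phiX _ := v 12
  phiSX _ := v 13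
  phi := v 14
  muO _ := 0

/-- The moment function sees η only through its fifteen values at the observed point. Measurability
can thus be checked on a finite-dimensional space, with no σ-algebra on nuisance parameters. -/
lemma moment_eq_ofVec {𝒳 𝒮 : Type*} (b : Bound) (d : ObsData 𝒳 𝒮) (τ : ℝ) (η : Nuisance 𝒳 𝒮) :
    moment b d τ η = moment b d τ (Nuisance.ofVec (η.vec (d.2.2.1, d.2.1))) := by
  cases b <;> rfl

lemma measurable_moment_ofVec (b : Bound) (τ : ℝ) : Measurable fun p : ObsData 𝒳 𝒮 × (Fin 15 → ℝ) =>
    moment b p.1 τ (Nuisance.ofVec p.2) := by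
  have he : Measurable fun p : ObsData 𝒳 𝒮 × (Fin 15 → ℝ) =>
      if p.1.1 = true then (1 : ℝ) else 0 :=
    (measurable_of_countable fun x : Bool => if x = true then (1 : ℝ) else 0).comp
      (by fun_prop : Measurable fun p : ObsData 𝒳 𝒮 × (Fin 15 → ℝ) => p.1.1)
  have ho : Measurable fun p : ObsData 𝒳 𝒮 × (Fin 15 → ℝ) =>
      if p.1.1 = true then (0 : ℝ) else 1 :=
    (measurable_of_countable fun x : Bool => if x = true then (0 : ℝ) else 1).comp
      (by fun_prop : Measurable fun p : ObsData 𝒳 𝒮 × (Fin 15 → ℝ) => p.1.1)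
  cases b <;> simp only [moment, Nuisance.ofVec, dualH, HU, HL] <;> fun_prop

lemma measurable_moment_comp {α : Type*} [MeasurableSpace α] (b : Bound) (τ : ℝ)
    {d : α → ObsData 𝒳 𝒮} {η : α → Nuisance 𝒳 𝒮} (hd : Measurable d)
    (hη : Measurable fun a => (η a).vec ((d a).2.2.1, (d a).2.1)) :
    Measurable fun a => moment b (d a) τ (η a) := by
  have h := (measurable_moment_ofVec (𝒳 := 𝒳) (𝒮 := 𝒮) b τ).comp (hd.prodMk hη)
  have heq : (fun a => moment b (d a) τ (η a)) = fun a =>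
      moment b (d a) τ (Nuisance.ofVec ((η a).vec ((d a).2.2.1, (d a).2.1))) :=
    funext fun a => moment_eq_ofVec b (d a) τ (η a)
  rw [heq]
  exact h

/-! ### The Lipschitz bound on the realization set -/

variable {P : Measure (UnitData 𝒳 𝒮)} [IsProbabilityMeasure P] {ε B : ℝ}

lemma measurable_trueMoment (P : Measure (UnitData 𝒳 𝒮)) [IsProbabilityMeasure P] (b : Bound) :
    Measurable (trueMoment P b) := by
  refine measurable_moment_comp b _ measurable_observe ?_
  exact (measurable_vec_trueNuisance P).comp measurable_surrX

/-- The entry φ is a constant function, so its L² error is an absolute error. -/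
lemma abs_phi_sub_le {kind : OutcomeKind} {q C δ : ℝ} {n : ℕ} {η : Nuisance 𝒳 𝒮} (hδ : 0 ≤ δ)
    (hη : η ∈ realizationSet P kind q ε C n δ) : |η.phi - phi P| ≤ δ := by
  have h1 : eLpNorm (fun _ : UnitData 𝒳 𝒮 => η.phi - phi P) 2 P ≤ ENNReal.ofReal δ :=
    (eLpNorm_mono_ae (Eventually.of_forall fun r =>
      abs_vec_sub_le η (trueNuisance P) (surrX r) 14)).trans hη.2.2.2.2.1
  rw [eLpNorm_const _ two_ne_zero (IsProbabilityMeasure.ne_zero P), measure_univ,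
    ENNReal.one_rpow, mul_one, Real.enorm_eq_ofReal_abs] at h1
  exact (ENNReal.ofReal_le_ofReal_iff hδ).1 h1

instance : Finite Bound :=
  Finite.of_injective (fun b : Bound => match b with | .minus => false | .plus => true) fun a b h => by
    cases a <;> cases b <;> simp_all

/-- The realization set does not directly confine φ̃ to an interval away from 0. Its lower bound
comes from |φ̃ - φ| ≤ ε/2 and φ ≥ ε, which is why ε is halved. -/
lemma TruthBounds.admissible (h : TruthBounds P ε B) (hε : 0 < ε) {η : Nuisance 𝒳 𝒮}
    (h1 : ∀ᵐ r ∂P, ε ≤ η.rhoSX (surrX r) ∧ η.rhoSX (surrX r) ≤ 1 - ε)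
    (h2 : ∀ᵐ r ∂P, ε ≤ η.rhoX (covX r) ∧ η.rhoX (covX r) ≤ 1 - ε)
    (h3 : ∀ᵐ r ∂P, ε ≤ η.phiSX (surrX r) ∧ η.phiSX (surrX r) ≤ 1 - ε)
    (h4 : |η.phi - phi P| ≤ ε / 2) :
    ∀ᵐ r ∂P, Admissible (ε / 2) B (observe r) η (trueNuisance P) := by
  have hb : ∀ t : ℝ, ε ≤ t ∧ t ≤ 1 - ε → ε / 2 ≤ t ∧ t ≤ 1 - ε / 2 :=
    fun t ht => ⟨by linarith [ht.1], by linarith [ht.2]⟩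
  have hmu := ae_all_iff.2 fun b => ae_all_iff.2 (h.wsi_le b)
  have hmubar := ae_all_iff.2 fun b => ae_all_iff.2 (h.wsiBar_le b)
  have hφ := h.score.phi_mem
  have h4' := abs_le.1 h4
  filter_upwards [h1, h2, h3, h.outcome_le, hmu, hmubar, ae_all_iff.2 h.qBound_le, h.score.rhoSX_mem,
    h.score.rhoX_mem, h.score.phiSX_mem] with r g1 g2 g3 g4 g5 g6 g7 g8 g9 g10
  refine ⟨?_, ?_, g5, g6, g7, hb _ g8, hb _ g9, hb _ g10, ⟨?_, ?_⟩, hb _ g1, hb _ g2, hb _ g3,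
    ⟨?_, ?_⟩⟩
  · simp only [observe, treatR]; split_ifs <;> simp
  · simp only [observe]
    split_ifs
    · simpa using (abs_nonneg _).trans g4
    · exact g4
  · change ε / 2 ≤ phi P; linarith [hφ.1]
  · change phi P ≤ 2; linarith [hφ.2]
  · linarith [h4'.1, hφ.1]
  · linarith [h4'.2, hφ.2, h4]

lemma TruthBounds.nonneg (h : TruthBounds P ε B) : 0 ≤ B := by
  obtain ⟨r, hr⟩ := h.outcome_le.exists
  exact (abs_nonneg _).trans hr

/-- On the realization set the moment functions are within a constant multiple of the nuisance
error of the true, bounded, moment functions. -/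
lemma TruthBounds.exists_moment_bound (h : TruthBounds P ε B) (hε : 0 < ε) :
    ∃ c, 0 ≤ c ∧ ∀ b, (∀ᵐ r ∂P, |trueMoment P b r| ≤ c) ∧
      ∀ (kind : OutcomeKind) (q C δ : ℝ) (n : ℕ) (η : Nuisance 𝒳 𝒮), 0 ≤ δ → δ ≤ ε / 2 →
        η ∈ realizationSet P kind q ε C n δ → ∀ᵐ r ∂P,
          |moment b (observe r) (tauBound P b) η - trueMoment P b r|
            ≤ c * ‖nuisanceError η (trueNuisance P) (surrX r)‖ := by
  have key : ∀ b, ∃ c, 0 ≤ c ∧ (∀ᵐ r ∂P, |trueMoment P b r| ≤ c) ∧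
      ∀ (kind : OutcomeKind) (q C δ : ℝ) (n : ℕ) (η : Nuisance 𝒳 𝒮), 0 ≤ δ → δ ≤ ε / 2 →
        η ∈ realizationSet P kind q ε C n δ → ∀ᵐ r ∂P,
          |moment b (observe r) (tauBound P b) η - trueMoment P b r|
            ≤ c * ‖nuisanceError η (trueNuisance P) (surrX r)‖ := by
    intro b
    obtain ⟨c, hc, hc'⟩ := exists_lipschitz_moment 𝒳 𝒮 (half_pos hε) h.nonneg b (tauBound P b)
    refine ⟨c, hc, ?_, fun kind q C δ n η hδ hδ' hη => ?_⟩
    · have h0 : |(trueNuisance P).phi - phi P| ≤ ε / 2 := by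
        change |phi P - phi P| ≤ ε / 2
        rw [sub_self, abs_zero]
        exact (half_pos hε).le
      filter_upwards [h.admissible hε h.score.rhoSX_mem h.score.rhoX_mem h.score.phiSX_mem h0] with r hr
      exact (hc' _ _ _ hr).1
    · filter_upwards [h.admissible hε hη.2.1 hη.2.2.1 hη.2.2.2.1
        ((abs_phi_sub_le hδ hη).trans hδ')] with r hr
      exact (hc' _ _ _ hr).2
  obtain ⟨c, hc, hc1, hc2⟩ := key .plus
  obtain ⟨c', hc', hc1', hc2'⟩ := key .minus
  refine ⟨max c c', hc.trans (le_max_left _ _), fun b => ?_⟩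
  cases b
  · refine ⟨hc1'.mono fun r hr => hr.trans (le_max_right _ _), ?_⟩
    intro kind q C δ n η h1 h2 h3
    filter_upwards [hc2' kind q C δ n η h1 h2 h3] with r hr
    exact hr.trans (mul_le_mul_of_nonneg_right (le_max_right _ _) (norm_nonneg _))
  · refine ⟨hc1.mono fun r hr => hr.trans (le_max_left _ _), ?_⟩
    intro kind q C δ n η h1 h2 h3
    filter_upwards [hc2 kind q C δ n η h1 h2 h3] with r hr
    exact hr.trans (mul_le_mul_of_nonneg_right (le_max_left _ _) (norm_nonneg _))

end

end SurrogateBounds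

namespace SurrogateBounds

noncomputable section

/-! ### The moment functions are centred -/

/-- `f` is measurable and essentially bounded. -/
def EssBdd {α : Type*} [MeasurableSpace α] (Q : Measure α) (f : α → ℝ) : Prop :=
  Measurable f ∧ ∃ c, ∀ᵐ r ∂Q, |f r| ≤ c

namespace EssBdd

variable {α : Type*} [MeasurableSpace α] {Q : Measure α} {f g : α → ℝ}

lemma add (hf : EssBdd Q f) (hg : EssBdd Q g) : EssBdd Q fun r => f r + g r := by
  obtain ⟨hf, a, ha⟩ := hf
  obtain ⟨hg, b, hb⟩ := hg
  refine ⟨hf.add hg, a + b, ?_⟩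
  filter_upwards [ha, hb] with r h1 h2
  exact (abs_add_le _ _).trans (add_le_add h1 h2)

lemma neg (hf : EssBdd Q f) : EssBdd Q fun r => -f r := by
  obtain ⟨hf, a, ha⟩ := hf
  exact ⟨hf.neg, a, by simpa using ha⟩

lemma sub (hf : EssBdd Q f) (hg : EssBdd Q g) : EssBdd Q fun r => f r - g r := by
  simpa only [sub_eq_add_neg] using hf.add hg.neg

lemma mul (hf : EssBdd Q f) (hg : EssBdd Q g) : EssBdd Q fun r => f r * g r := by
  obtain ⟨hf, a, ha⟩ := hf
  obtain ⟨hg, b, hb⟩ := hg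
  refine ⟨hf.mul hg, a * b, ?_⟩
  filter_upwards [ha, hb] with r h1 h2
  rw [abs_mul]
  exact mul_le_mul h1 h2 (abs_nonneg _) ((abs_nonneg _).trans h1)

lemma div (hf : EssBdd Q f) (hg : Measurable g) {ε : ℝ} (hε : 0 < ε) (h : ∀ᵐ r ∂Q, ε ≤ g r) :
    EssBdd Q fun r => f r / g r := by
  have : EssBdd Q fun r => (g r)⁻¹ := by
    refine ⟨hg.inv, ε⁻¹, h.mono fun r hr => ?_⟩
    rw [abs_of_pos (inv_pos.2 (hε.trans_le hr))]
    exact inv_anti₀ hε hr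
  simpa only [div_eq_mul_inv] using hf.mul this

lemma const (Q : Measure α) (c : ℝ) : EssBdd Q fun _ => c :=
  ⟨measurable_const, |c|, Eventually.of_forall fun _ => le_rfl⟩

lemma integrable [IsFiniteMeasure Q] (hf : EssBdd Q f) : Integrable f Q := by
  obtain ⟨hf, a, ha⟩ := hf
  exact Integrable.of_bound hf.aestronglyMeasurable a ha

lemma mono {Q' : Measure α} (hf : EssBdd Q f) (h : Q' ≪ Q) : EssBdd Q' f :=
  ⟨hf.1, hf.2.choose, h hf.2.choose_spec⟩

end EssBdd

variable {𝒳 𝒮 : Type*} [MeasurableSpace 𝒳] [MeasurableSpace 𝒮]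
  {P : Measure (UnitData 𝒳 𝒮)} [IsProbabilityMeasure P] {ε B : ℝ}

lemma isProbabilityMeasure_expLaw (h : ScoreBounds P ε) (hε : 0 < ε) :
    IsProbabilityMeasure (expLaw P) :=
  cond_isProbabilityMeasure (h.label_true_ne_zero hε)

@[fun_prop]
lemma measurable_dualH (b : Bound) (w : Bool) :
    Measurable fun p : ℝ × ℝ × ℝ => dualH b w p.1 p.2.1 p.2.2 := by
  cases b <;> cases w <;> simp only [dualH, HU, HL] <;> fun_prop

namespace TruthBounds

lemma essBdd_wsi (h : TruthBounds P ε B) (b : Bound) (w : Bool) :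
    EssBdd P fun r => wsi P b w (surrX r) :=
  ⟨by fun_prop, B, h.wsi_le b w⟩

lemma essBdd_wsiBar (h : TruthBounds P ε B) (b : Bound) (w : Bool) :
    EssBdd P fun r => wsiBar P b w (covX r) :=
  ⟨by fun_prop, B, h.wsiBar_le b w⟩

lemma essBdd_qBound (h : TruthBounds P ε B) (b : Bound) :
    EssBdd P fun r => qBound P b (surrX r) :=
  ⟨by fun_prop, B, h.qBound_le b⟩

lemma essBdd_treatR (P : Measure (UnitData 𝒳 𝒮)) : EssBdd P treatR :=
  ⟨by fun_prop, 1, Eventually.of_forall fun r => by unfold treatR; split_ifs <;> simp⟩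

lemma essBdd_rhoX (h : TruthBounds P ε B) (hε : 0 < ε) : EssBdd P fun r => rhoX P (covX r) :=
  ⟨by fun_prop, 1, h.score.rhoX_mem.mono fun r hr => by
    rw [abs_of_pos (hε.trans_le hr.1)]; linarith [hr.2]⟩

lemma essBdd_rhoSX (h : TruthBounds P ε B) (hε : 0 < ε) : EssBdd P fun r => rhoSX P (surrX r) :=
  ⟨by fun_prop, 1, h.score.rhoSX_mem.mono fun r hr => by
    rw [abs_of_pos (hε.trans_le hr.1)]; linarith [hr.2]⟩

lemma essBdd_phiSX (h : TruthBounds P ε B) (hε : 0 < ε) : EssBdd P fun r => phiSX P (surrX r) :=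
  ⟨by fun_prop, 1, h.score.phiSX_mem.mono fun r hr => by
    rw [abs_of_pos (hε.trans_le hr.1)]; linarith [hr.2]⟩

lemma essBdd_dualH (h : TruthBounds P ε B) (hε : 0 < ε) (b : Bound) (w : Bool) :
    EssBdd P fun r => dualH b w (outcome r) (qBound P b (surrX r))
      (armProb w (rhoSX P (surrX r))) := by
  have hm : Measurable fun r : UnitData 𝒳 𝒮 => armProb w (rhoSX P (surrX r)) := by
    cases w <;> simp only [armProb, if_true, Bool.false_eq_true, if_false] <;> fun_prop
  refine ⟨(measurable_dualH b w).comp (measurable_outcome.prodMk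
    (((measurable_qBound P b).comp measurable_surrX).prodMk hm)), B + 1 / ε * (2 * B), ?_⟩
  filter_upwards [h.score.rhoSX_mem, h.outcome_le, h.qBound_le b] with r h1 h2 h3
  exact abs_dualH_le h2 h3 hε (le_armProb h1 w) b w

end TruthBounds

/-- The contribution of the experimental sample to the moment function, rearranged into the
inverse-probability-weighted representation of `τ_C` and residuals of `W`. -/
def expPart (P : Measure (UnitData 𝒳 𝒮)) (b : Bound) (r : UnitData 𝒳 𝒮) : ℝ :=
  wsi P b true (surrX r) * (treatR r / rhoX P (covX r))
    - wsi P b false (surrX r) * ((1 - treatR r) / (1 - rhoX P (covX r)))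
    - tauBound P b
    - (treatR r - rhoX P (covX r)) * (wsiBar P b true (covX r) / rhoX P (covX r)
      + wsiBar P b false (covX r) / (1 - rhoX P (covX r)))
    + (treatR r - rhoSX P (surrX r)) *
      ((qBound P b (surrX r) - wsi P b true (surrX r)) / rhoX P (surrX r).2
        + (qBound P b (surrX r) - wsi P b false (surrX r)) / (1 - rhoX P (surrX r).2))

/-- The contribution of the observational sample to the moment function. -/
def obsPart (P : Measure (UnitData 𝒳 𝒮)) [IsProbabilityMeasure P] (b : Bound)
    (p : (𝒮 × 𝒳) × ℝ) : ℝ :=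
  phiSX P p.1 / (1 - phiSX P p.1) *
    (rhoSX P p.1 / rhoX P p.1.2 *
        (dualH b true p.2 (qBound P b p.1) (armProb true (rhoSX P p.1)) - wsi P b true p.1)
      - (1 - rhoSX P p.1) / (1 - rhoX P p.1.2) *
        (dualH b false p.2 (qBound P b p.1) (armProb false (rhoSX P p.1)) - wsi P b false p.1))

/-- The rearrangement rests on (W/ρ)(μ₁ - μ̄₁) + μ̄₁ = (W/ρ)μ₁ - (W - ρ)μ̄₁/ρ and its analogue for
the control arm, with ρ = ρ(X): each regression μ̄ is then multiplied by the residual W - ρ(X). -/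
lemma TruthBounds.trueMoment_eq (h : TruthBounds P ε B) (hε : 0 < ε) (b : Bound) :
    ∀ᵐ r ∂P, trueMoment P b r = (phi P)⁻¹ * ((if label r = true then expPart P b r else 0)
      + if label r = false then obsPart P b (surrX r, outcome r) else 0) := by
  filter_upwards [h.score.rhoX_mem] with r hr
  have h1 : rhoX P (covX r) ≠ 0 := (hε.trans_le hr.1).ne'
  have h2 : 1 - rhoX P (covX r) ≠ 0 := by linarith [hr.2]
  have h3 : phi P ≠ 0 := (hε.trans_le h.score.phi_mem.1).ne'
  have hz : (surr r, covX r) = surrX r := rfl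
  have hz2 : (surrX r).2 = covX r := rfl
  cases hl : label r
  · simp only [trueMoment, moment, observe, trueNuisance, hl, obsPart, armProb, hz, hz2]
    simp
    ring
  · simp only [trueMoment, moment, observe, trueNuisance, hl, expPart, hz, hz2]
    simp
    field_simp
    ring

/-- The weighted difference has mean τ_C by the definition of `tauBound`; the other two terms are
residuals of W, given X and given (S,X), times functions of the conditioning variable. -/
lemma TruthBounds.expPart_centred (h : TruthBounds P ε B) (hε : 0 < ε) (b : Bound) :
    EssBdd P (expPart P b) ∧ ∫ r, expPart P b r ∂(expLaw P) = 0 := by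
  have := isProbabilityMeasure_expLaw h.score hε
  have hac := expLaw_absolutelyContinuous P
  have hl : ∀ᵐ r ∂P, ε ≤ rhoX P (covX r) := h.score.rhoX_mem.mono fun r hr => hr.1
  have hl' : ∀ᵐ r ∂P, ε ≤ 1 - rhoX P (covX r) :=
    h.score.rhoX_mem.mono fun r hr => by linarith [hr.2]
  have hW := TruthBounds.essBdd_treatR P
  have hρm : Measurable fun r : UnitData 𝒳 𝒮 => rhoX P (covX r) := by fun_prop
  have hρm' : Measurable fun r : UnitData 𝒳 𝒮 => 1 - rhoX P (covX r) := by fun_prop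
  have i1 := (h.essBdd_wsi b true).mul (hW.div hρm hε hl)
  have i2 := (h.essBdd_wsi b false).mul (((EssBdd.const P 1).sub hW).div hρm' hε hl')
  have i3 := (hW.sub (h.essBdd_rhoX hε)).mul (((h.essBdd_wsiBar b true).div hρm hε hl).add
    ((h.essBdd_wsiBar b false).div hρm' hε hl'))
  have i4 := (hW.sub (h.essBdd_rhoSX hε)).mul
    ((((h.essBdd_qBound b).sub (h.essBdd_wsi b true)).div hρm hε hl).add
    (((h.essBdd_qBound b).sub (h.essBdd_wsi b false)).div hρm' hε hl'))
  have j2 := i1.sub i2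
  have jc := j2.sub (EssBdd.const P (tauBound P b))
  have j3 := jc.sub i3
  refine ⟨j3.add i4, ?_⟩
  have z3 := integral_treatR_sub_rhoX_mul P (fun x => wsiBar P b true x / rhoX P x
    + wsiBar P b false x / (1 - rhoX P x)) (by fun_prop) (i3.mono hac).integrable
  have z4 := integral_treatR_sub_rhoSX_mul P
    (fun z => (qBound P b z - wsi P b true z) / rhoX P z.2
      + (qBound P b z - wsi P b false z) / (1 - rhoX P z.2)) (by fun_prop)
    (i4.mono hac).integrable
  unfold expPart
  refine (integral_add (j3.mono hac).integrable (i4.mono hac).integrable).trans ?_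
  rw [integral_sub (jc.mono hac).integrable (i3.mono hac).integrable,
    integral_sub (j2.mono hac).integrable (integrable_const _),
    integral_sub (i1.mono hac).integrable (i2.mono hac).integrable, z3, integral_const]
  erw [z4]
  simp [tauBound]

lemma TruthBounds.essBdd_obsPart (h : TruthBounds P ε B) (hε : 0 < ε) (b : Bound) :
    EssBdd P fun r => obsPart P b (surrX r, outcome r) := by
  have hl : ∀ᵐ r ∂P, ε ≤ rhoX P (covX r) := h.score.rhoX_mem.mono fun r hr => hr.1
  have hl' : ∀ᵐ r ∂P, ε ≤ 1 - rhoX P (covX r) := h.score.rhoX_mem.mono fun r hr => by linarith [hr.2]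
  have hp' : ∀ᵐ r ∂P, ε ≤ 1 - phiSX P (surrX r) :=
    h.score.phiSX_mem.mono fun r hr => by linarith [hr.2]
  have hS := h.essBdd_rhoSX hε
  exact ((h.essBdd_phiSX hε).div (by fun_prop) hε hp').mul
    (((hS.div (by fun_prop) hε hl).mul ((h.essBdd_dualH hε b true).sub (h.essBdd_wsi b true))).sub
      ((((EssBdd.const P 1).sub hS).div (by fun_prop) hε hl').mul
        ((h.essBdd_dualH hε b false).sub (h.essBdd_wsi b false))))

lemma measurable_obsPart (P : Measure (UnitData 𝒳 𝒮)) [IsProbabilityMeasure P] (b : Bound) :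
    Measurable (obsPart P b) := by
  cases b <;> unfold obsPart <;> simp only [dualH, HU, HL, armProb, if_true, Bool.false_eq_true, if_false] <;>
    fun_prop

/-- Given (S,X), the factors outside the two differences are constants, and H has conditional mean
μ_{C,w} by `ScoreBounds.wsi_eq`; hence the conditional mean of each difference is zero. -/
lemma TruthBounds.integral_obsPart (h : TruthBounds P ε B) (hε : 0 < ε) (b : Bound) :
    ∫ r, obsPart P b (surrX r, outcome r) ∂(obsLaw P) = 0 := by
  have hac := obsLaw_absolutelyContinuous P
  rw [integral_eq_integral_condDistrib (obsLaw P) measurable_surrX measurable_outcome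
    (measurable_obsPart P b) ((h.essBdd_obsPart hε b).mono hac).integrable]
  refine integral_eq_zero_of_ae ?_
  filter_upwards [hac h.score.rhoSX_mem, hac (h.score.ae_outcomeKernel hε h.outcome_le),
    hac (h.score.wsi_eq hε h.outcome_le b true), hac (h.score.wsi_eq hε h.outcome_le b false),
    hac (h.qBound_le b)] with r h1 h2 h3 h4 h5
  have hi : ∀ w, Integrable (fun y => dualH b w y (qBound P b (surrX r))
      (armProb w (rhoSX P (surrX r)))) (outcomeKernel P (surrX r)) := fun w =>
    Integrable.of_bound (continuous_dualH b w _ _).aestronglyMeasurable (B + 1 / ε * (2 * B))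
      (h2.mono fun y hy => abs_dualH_le hy h5 hε (le_armProb h1 w) b w)
  change ∫ y, obsPart P b (surrX r, y) ∂(outcomeKernel P (surrX r)) = 0
  have hc : ∀ w, Integrable (fun y => dualH b w y (qBound P b (surrX r))
      (armProb w (rhoSX P (surrX r))) - wsi P b w (surrX r)) (outcomeKernel P (surrX r)) :=
    fun w => (hi w).sub (integrable_const _)
  simp only [obsPart]
  rw [integral_const_mul, integral_sub ((hc true).const_mul _) ((hc false).const_mul _),
    integral_const_mul, integral_const_mul, integral_sub (hi true) (integrable_const _),
    integral_sub (hi false) (integrable_const _), integral_const, integral_const, ← h3, ← h4]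
  simp

lemma TruthBounds.integral_trueMoment (h : TruthBounds P ε B) (hε : 0 < ε) (b : Bound) :
    ∫ r, trueMoment P b r ∂P = 0 := by
  have h1 := integral_cond_label P true (h.score.label_true_ne_zero hε) (expPart P b)
  have h2 := integral_cond_label P false (h.score.label_false_ne_zero hε)
    (fun r => obsPart P b (surrX r, outcome r))
  have h1' : ∫ r, (if label r = true then expPart P b r else 0) ∂P = 0 := by
    rw [h1]; exact mul_eq_zero_of_right _ (h.expPart_centred hε b).2
  have h2' : ∫ r, (if label r = false then
      obsPart P b (surrX r, outcome r) else 0) ∂P = 0 := by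
    rw [h2]; exact mul_eq_zero_of_right _ (h.integral_obsPart hε b)
  have hi : ∀ (v : Bool) {f : UnitData 𝒳 𝒮 → ℝ}, EssBdd P f →
      Integrable (fun r => if label r = v then f r else 0) P := by
    intro v f hf
    refine (hf.integrable.indicator (measurable_label (measurableSet_singleton v))).congr
      (Eventually.of_forall fun r => ?_)
    simp [Set.indicator]
  rw [integral_congr_ae (h.trueMoment_eq hε b), integral_const_mul,
    integral_add (hi true (h.expPart_centred hε b).1) (hi false (h.essBdd_obsPart hε b)), h1', h2']
  simp

end

end SurrogateBounds

namespace SurrogateBounds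

/-! ### Events of probability tending to one -/

/-- The (outer) probability that `p n` fails tends to zero. -/
def WHP {Ω : Type*} [MeasurableSpace Ω] (μ : Measure Ω) (p : ℕ → Ω → Prop) : Prop :=
  Tendsto (fun n => μ {ω | ¬ p n ω}) atTop (𝓝 0)

namespace WHP

variable {Ω : Type*} [MeasurableSpace Ω] {μ : Measure Ω} {p q : ℕ → Ω → Prop}

lemma of_le {u : ℕ → ℝ≥0∞} (hu : Tendsto u atTop (𝓝 0))
    (h : ∀ᶠ n in atTop, μ {ω | ¬ p n ω} ≤ u n) : WHP μ p :=
  tendsto_of_tendsto_of_tendsto_of_le_of_le' tendsto_const_nhds hu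
    (Eventually.of_forall fun _ => zero_le) h

lemma and (hp : WHP μ p) (hq : WHP μ q) : WHP μ fun n ω => p n ω ∧ q n ω := by
  have h0 := Tendsto.add hp hq
  rw [add_zero] at h0
  refine of_le h0 (Eventually.of_forall fun n => ?_)
  refine (measure_mono fun ω hω => ?_).trans (measure_union_le _ _)
  simp only [Set.mem_union, Set.mem_ofPred_eq] at hω ⊢
  tauto

lemma mono (hp : WHP μ p) (h : ∀ᶠ n in atTop, ∀ ω, p n ω → q n ω) : WHP μ q :=
  of_le hp (h.mono fun _ hn => measure_mono fun ω hω hp' => hω (hn ω hp'))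

lemma of_ae (h : ∀ᶠ n in atTop, ∀ᵐ ω ∂μ, p n ω) : WHP μ p :=
  of_le tendsto_const_nhds (h.mono fun _ hn => le_of_eq (ae_iff.1 hn))

lemma forall_finite {ι : Type*} [Finite ι] {p : ι → ℕ → Ω → Prop} (h : ∀ k, WHP μ (p k)) :
    WHP μ fun n ω => ∀ k, p k n ω := by
  cases nonempty_fintype ι
  have h0 := tendsto_finsetSum (Finset.univ : Finset ι) fun k _ => h k
  rw [Finset.sum_const_zero] at h0
  refine of_le h0 (Eventually.of_forall fun n => ?_)
  refine (measure_mono fun ω hω => ?_).trans (measure_biUnion_finset_le _ _)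
  simpa using hω

end WHP

/-! ### A weak law of large numbers over index sets of growing size -/

section WeakLaw

variable {Ω α : Type*} [MeasurableSpace Ω] [MeasurableSpace α] {μ : Measure Ω}
  [IsProbabilityMeasure μ] {P : Measure α} {D : ℕ → Ω → α}

/-- Chebyshev's inequality: by independence the variance of the sum is at most c² times the number
of terms. The bound depends on the index set only through its cardinality, so folds may be arbitrary
sets that change with n. -/
lemma measure_sum_sub_gt_le (hm : ∀ i, Measurable (D i)) (hlaw : ∀ i, μ.map (D i) = P)
    (hind : iIndepFun D μ) {f : α → ℝ} (hf : Measurable f) {c : ℝ} (hc : ∀ᵐ r ∂P, |f r| ≤ c)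
    (S : Finset ℕ) (hS : 0 < S.card) {x : ℝ} (hx : 0 < x) :
    μ {ω | ¬ |∑ i ∈ S, f (D i ω) - S.card * ∫ r, f r ∂P| ≤ x * S.card}
      ≤ ENNReal.ofReal (c ^ 2 / x ^ 2 * (S.card : ℝ)⁻¹) := by
  have hmi : ∀ i, Measurable fun ω => f (D i ω) := fun i => hf.comp (hm i)
  have hb : ∀ i, ∀ᵐ ω ∂μ, |f (D i ω)| ≤ c := fun i => by
    have := hlaw i ▸ hc
    exact ae_of_ae_map (hm i).aemeasurable this
  have hL : ∀ i, MemLp (fun ω => f (D i ω)) 2 μ := fun i =>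
    MemLp.of_bound (hmi i).aestronglyMeasurable c (hb i)
  have hmean : ∀ i, ∫ ω, f (D i ω) ∂μ = ∫ r, f r ∂P := fun i => by
    rw [← hlaw i, integral_map (hm i).aemeasurable hf.aestronglyMeasurable]
  have hvar : ∀ i, variance (fun ω => f (D i ω)) μ ≤ c ^ 2 := fun i => by
    refine (variance_le_expectation_sq (hmi i).aestronglyMeasurable).trans ?_
    have := integral_mono_ae (hL i).integrable_sq (integrable_const (c ^ 2))
      ((hb i).mono fun ω hω => sq_le_sq' (abs_le.1 hω).1 (abs_le.1 hω).2)
    simpa using this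
  have hsum : MemLp (∑ i ∈ S, fun ω => f (D i ω)) 2 μ := memLp_finsetSum' S fun i _ => hL i
  have hN : (0 : ℝ) < S.card := by exact_mod_cast hS
  have hE : ∫ ω, (∑ i ∈ S, fun ω => f (D i ω)) ω ∂μ = S.card * ∫ r, f r ∂P := by
    simp only [Finset.sum_apply]
    rw [integral_finsetSum S fun i _ => (hL i).integrable one_le_two]
    simp [hmean]
  have hV : variance (∑ i ∈ S, fun ω => f (D i ω)) μ ≤ S.card * c ^ 2 := by
    rw [IndepFun.variance_sum (fun i _ => hL i) fun i _ j _ hij =>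
      (hind.indepFun hij).comp hf hf]
    refine (Finset.sum_le_sum fun i _ => hvar i).trans ?_
    simp
  have key := meas_ge_le_variance_div_sq hsum (mul_pos hx hN)
  rw [hE] at key
  refine (measure_mono fun ω hω => ?_).trans (key.trans (ENNReal.ofReal_le_ofReal ?_))
  · simp only [Set.mem_ofPred_eq, not_le, Finset.sum_apply] at hω ⊢
    exact hω.le
  · calc variance (∑ i ∈ S, fun ω => f (D i ω)) μ / (x * S.card) ^ 2
        ≤ S.card * c ^ 2 / (x * S.card) ^ 2 := by gcongr
      _ = c ^ 2 / x ^ 2 * (S.card : ℝ)⁻¹ := by field_simp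

lemma whp_sum_sub_le (hm : ∀ i, Measurable (D i)) (hlaw : ∀ i, μ.map (D i) = P)
    (hind : iIndepFun D μ) {f : α → ℝ} (hf : Measurable f) {c : ℝ} (hc : ∀ᵐ r ∂P, |f r| ≤ c)
    {G : ℕ → Finset ℕ} (hG : Tendsto (fun n => (G n).card) atTop atTop) {x : ℝ} (hx : 0 < x) :
    WHP μ fun n ω => |∑ i ∈ G n, f (D i ω) - (G n).card * ∫ r, f r ∂P| ≤ x * (G n).card := by
  have h1 : Tendsto (fun n => ENNReal.ofReal (c ^ 2 / x ^ 2 * ((G n).card : ℝ)⁻¹)) atTop (𝓝 0) := by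
    have := ((tendsto_inv_atTop_zero.comp
      (tendsto_natCast_atTop_atTop (R := ℝ))).comp hG).const_mul (c ^ 2 / x ^ 2)
    rw [mul_zero] at this
    simpa using ENNReal.tendsto_ofReal this
  refine WHP.of_le h1 ?_
  filter_upwards [hG.eventually (eventually_gt_atTop 0)] with n hn
  exact measure_sum_sub_gt_le hm hlaw hind hf hc (G n) hn hx

end WeakLaw

/-! ### Cross-fitting -/

section CrossFit

/-- Under independence the joint law is a product, so Y can be frozen while X is integrated out. -/
lemma lintegral_comp_of_indepFun {Ω α β : Type*} [MeasurableSpace Ω] [MeasurableSpace α]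
    [MeasurableSpace β] {μ : Measure Ω} [IsProbabilityMeasure μ] {Y : Ω → β} {X : Ω → α}
    (hY : Measurable Y) (hX : Measurable X) (h : IndepFun Y X μ) {g : β × α → ℝ≥0∞}
    (hg : Measurable g) :
    ∫⁻ ω, g (Y ω, X ω) ∂μ = ∫⁻ ω, ∫⁻ r, g (Y ω, r) ∂(μ.map X) ∂μ := by
  have h1 := h.map_prod_eq_prod_map_map hY.aemeasurable hX.aemeasurable
  rw [← lintegral_map (f := g) hg (hY.prodMk hX), h1, lintegral_prod _ hg.aemeasurable,
    lintegral_map hg.lintegral_prod_right' hY]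

/-- The sum of squared errors over a fold is small with high probability if, with high
probability, its conditional expectation given the data outside the fold is small. -/
lemma measure_sum_gt_le {Ω α : Type*} {m : MeasurableSpace Ω} [mΩ : MeasurableSpace Ω]
    [MeasurableSpace α] {μ : Measure Ω} [IsProbabilityMeasure μ] {P : Measure α}
    [IsProbabilityMeasure P]
    (hm : m ≤ mΩ) {X : ℕ → Ω → α} (hX : ∀ i, Measurable (X i)) (hlaw : ∀ i, μ.map (X i) = P)
    {S : Finset ℕ} (hind : ∀ i ∈ S, Indep m (MeasurableSpace.comap (X i) inferInstance) μ)
    {g : Ω × α → ℝ≥0∞} (hg : @Measurable (Ω × α) ℝ≥0∞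
      (@Prod.instMeasurableSpace _ _ m inferInstance) inferInstance g)
    (κ : ℝ≥0∞) {x : ℝ≥0∞} (hx : x ≠ 0) (hx' : x ≠ ∞) :
    μ {ω | ¬ ∑ i ∈ S, g (ω, X i ω) ≤ x}
      ≤ μ {ω | κ < ∫⁻ r, g (ω, r) ∂P} + S.card * κ / x := by
  set I : Ω → ℝ≥0∞ := fun ω => ∫⁻ r, g (ω, r) ∂P with hI
  have hIm : Measurable[m] I := @Measurable.lintegral_prod_right' Ω α m _ P _ g hg
  set A : Set Ω := {ω | I ω ≤ κ} with hA
  have hAm : MeasurableSet[m] A := measurableSet_le hIm measurable_const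
  -- Truncation to the event that the conditional expectation is at most κ. This event lies in `m`,
  -- so `g'` still depends on its first argument through `m` only, and its conditional expectation
  -- is at most κ everywhere.
  set g' : Ω × α → ℝ≥0∞ := (Prod.fst ⁻¹' A).indicator g with hg'
  have hg'm : @Measurable (Ω × α) ℝ≥0∞
      (@Prod.instMeasurableSpace _ _ m inferInstance) inferInstance g' :=
    @Measurable.indicator _ _ _ g (@Prod.instMeasurableSpace _ _ m inferInstance) _ _ hg
      (@measurable_fst Ω α m _ A hAm)
  have hle : @Measurable (Ω × α) (Ω × α) inferInstance
      (@Prod.instMeasurableSpace _ _ m inferInstance) id :=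
    measurable_id'' (sup_le_sup (MeasurableSpace.comap_mono hm) le_rfl)
  have hg'm' : Measurable g' := hg'm.comp hle
  have hXm : ∀ i ∈ S, Measurable fun ω => g' (ω, X i ω) := fun i _ =>
    hg'm'.comp (measurable_id.prodMk (hX i))
  have hint : ∀ i ∈ S, ∫⁻ ω, g' (ω, X i ω) ∂μ ≤ κ := by
    intro i hi
    -- The identity is regarded as a random element of Ω with the σ-algebra `m`; its independence
    -- from `X i` is then exactly `hind`.
    have h1 : @IndepFun Ω Ω α mΩ m inferInstance id (X i) μ := by
      have h0 := hind i hi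
      have h0' : Indep (MeasurableSpace.comap id m) (MeasurableSpace.comap (X i) inferInstance) μ := by
        rwa [@MeasurableSpace.comap_id _ m]
      exact h0'
    have h2 := @lintegral_comp_of_indepFun Ω α Ω mΩ inferInstance m μ inferInstance id (X i)
      (measurable_id'' hm) (hX i) h1 g' hg'm
    simp only [id] at h2
    rw [h2, hlaw i]
    calc ∫⁻ ω, ∫⁻ r, g' (ω, r) ∂P ∂μ ≤ ∫⁻ _, κ ∂μ := by
          refine lintegral_mono fun ω => ?_
          by_cases hω : ω ∈ A
          · have : ∀ r, g' (ω, r) = g (ω, r) := fun r => by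
              simp [hg', hω]
            simp_rw [this]
            exact hω
          · have : ∀ r, g' (ω, r) = 0 := fun r => by simp [hg', hω]
            simp [this]
      _ = κ := by simp
  have hsum : ∫⁻ ω, ∑ i ∈ S, g' (ω, X i ω) ∂μ ≤ S.card * κ := by
    rw [lintegral_finsetSum S hXm]
    refine (Finset.sum_le_sum hint).trans ?_
    simp
  have hmk := meas_ge_le_lintegral_div
    (Finset.measurable_fun_sum S hXm).aemeasurable hx hx' (μ := μ)
  have hcover : {ω | ¬ ∑ i ∈ S, g (ω, X i ω) ≤ x}
      ⊆ {ω | κ < I ω} ∪ {ω | x ≤ ∑ i ∈ S, g' (ω, X i ω)} := by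
    intro ω hω
    by_cases hωA : ω ∈ A
    · right
      have : ∀ i, g' (ω, X i ω) = g (ω, X i ω) := fun i => by simp [hg', hωA]
      simp only [Set.mem_ofPred_eq, this]
      exact (not_le.1 hω).le
    · left
      exact not_le.1 (show ¬ I ω ≤ κ from hωA)
  refine (measure_mono hcover).trans ((measure_union_le _ _).trans ?_)
  gcongr
  refine le_trans ?_ (ENNReal.div_le_div_right hsum x)
  simpa using hmk

/-- Intersections s ∩ t with s in a and t in b form a π-system generating a ⊔ b. On it, P(s ∩ t ∩ u)
= P(s)P(t ∩ u) = P(s)P(t)P(u) = P(s ∩ t)P(u). -/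
lemma indep_sup_left {Ω : Type*} {mΩ : MeasurableSpace Ω} {μ : Measure Ω} [IsProbabilityMeasure μ]
    {a b c : MeasurableSpace Ω} (ha : a ≤ mΩ) (hb : b ≤ mΩ) (hc : c ≤ mΩ)
    (h1 : Indep a (b ⊔ c) μ) (h2 : Indep b c μ) : Indep (a ⊔ b) c μ := by
  set p : Set (Set Ω) := Set.image2 (· ∩ ·) {s | MeasurableSet[a] s} {s | MeasurableSet[b] s}
    with hp
  have hpi : IsPiSystem p := by
    rintro _ ⟨s, hs, t, ht, rfl⟩ _ ⟨s', hs', t', ht', rfl⟩ -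
    refine ⟨s ∩ s', hs.inter hs', t ∩ t', ht.inter ht', ?_⟩
    exact Set.inter_inter_inter_comm _ _ _ _
  have hgen : a ⊔ b = MeasurableSpace.generateFrom p := by
    refine le_antisymm (sup_le (fun s hs => ?_) (fun s hs => ?_))
      (MeasurableSpace.generateFrom_le ?_)
    · exact MeasurableSpace.measurableSet_generateFrom
        ⟨s, hs, Set.univ, MeasurableSet.univ, Set.inter_univ s⟩
    · exact MeasurableSpace.measurableSet_generateFrom
        ⟨Set.univ, MeasurableSet.univ, s, hs, Set.univ_inter s⟩
    · rintro _ ⟨s, hs, t, ht, rfl⟩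
      have hs' : MeasurableSet[a ⊔ b] s := (le_sup_left : a ≤ a ⊔ b) s hs
      have ht' : MeasurableSet[a ⊔ b] t := (le_sup_right : b ≤ a ⊔ b) t ht
      exact hs'.inter ht'
  refine IndepSets.indep (sup_le ha hb) hc hpi (@MeasurableSpace.isPiSystem_measurableSet Ω c) hgen
    (@MeasurableSpace.generateFrom_measurableSet Ω c).symm ?_
  rw [IndepSets_iff]
  rintro _ u ⟨s, hs, t, ht, rfl⟩ hu
  have htu : MeasurableSet[b ⊔ c] (t ∩ u) :=
    ((le_sup_left : b ≤ b ⊔ c) t ht).inter ((le_sup_right : c ≤ b ⊔ c) u hu)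
  have ht' : MeasurableSet[b ⊔ c] t := (le_sup_left : b ≤ b ⊔ c) t ht
  rw [Indep_iff] at h1 h2
  simp only
  rw [Set.inter_assoc, h1 s (t ∩ u) hs htu, h2 t u ht hu, h1 s t hs ht', mul_assoc]

/-! ### Independence of a fold from the data used for its nuisance estimate -/

variable {𝒳 𝒮 : Type*} [MeasurableSpace 𝒳] [MeasurableSpace 𝒮] {Ω : Type*} [mΩ : MeasurableSpace Ω]
  {μ : Measure Ω} [IsProbabilityMeasure μ] {D : ℕ → Ω → UnitData 𝒳 𝒮}

lemma comap_observe_le {Ω : Type*} {D : ℕ → Ω → UnitData 𝒳 𝒮} (i : ℕ) : MeasurableSpace.comap (fun ω => observe (D i ω)) inferInstance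
    ≤ MeasurableSpace.comap (D i) inferInstance := by
  have : (fun ω => observe (D i ω)) = observe ∘ D i := rfl
  rw [this, ← MeasurableSpace.comap_comp]
  exact MeasurableSpace.comap_mono measurable_observe.comap_le

lemma outOfFold_le (hD : ∀ i, Measurable (D i)) {aux : MeasurableSpace Ω} (haux : aux ≤ mΩ) (n : ℕ)
    (S : Finset ℕ) : outOfFold D aux n S ≤ mΩ :=
  sup_le haux (iSup₂_le fun i _ => (comap_observe_le i).trans (hD i).comap_le)

lemma indep_outOfFold (hD : ∀ i, Measurable (D i)) (hind : iIndepFun D μ)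
    {aux : MeasurableSpace Ω} (haux : aux ≤ mΩ) {n : ℕ}
    (hauxi : Indep aux (⨆ i ∈ Finset.range n, MeasurableSpace.comap (D i) inferInstance) μ)
    {S : Finset ℕ} (hS : S ⊆ Finset.range n) {i : ℕ} (hi : i ∈ S) :
    Indep (outOfFold D aux n S) (MeasurableSpace.comap (D i) inferInstance) μ := by
  set m : ℕ → MeasurableSpace Ω := fun j => MeasurableSpace.comap (D j) inferInstance with hm
  have hmle : ∀ j, m j ≤ mΩ := fun j => (hD j).comap_le
  -- Independence is proved for the complete data outside the fold and then restricted to the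
  -- coarser observed data.
  set b : MeasurableSpace Ω := ⨆ j ∈ Finset.range n \ S, m j with hb
  have hbc : Indep b (m i) μ := by
    have hdis : Disjoint (↑(Finset.range n \ S) : Set ℕ) {i} := by
      simp [hi]
    have := indep_iSup_of_disjoint (m := m) hmle hind hdis
    simpa only [Finset.mem_coe, Set.mem_singleton_iff, iSup_iSup_eq_left] using this
  have ha : Indep aux (b ⊔ m i) μ := by
    refine indep_of_indep_of_le_right hauxi (sup_le (iSup₂_le fun j hj => ?_) ?_)
    · exact le_iSup₂_of_le (f := fun j (_ : j ∈ Finset.range n) => m j) j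
        (Finset.sdiff_subset hj) le_rfl
    · exact le_iSup₂_of_le (f := fun j (_ : j ∈ Finset.range n) => m j) i (hS hi) le_rfl
  have hab := indep_sup_left haux (iSup₂_le fun j _ => hmle j) (hmle i) ha hbc
  refine indep_of_indep_of_le_left hab (sup_le_sup le_rfl ?_)
  exact iSup₂_mono fun j _ => comap_observe_le j

end CrossFit

end SurrogateBounds

namespace SurrogateBounds

noncomputable section

/-! ### Folds -/

section Folds

variable {K n : ℕ} {F : Fin K → Finset ℕ}

lemma IsFoldPartition.subset_range (h : IsFoldPartition n F) (k : Fin K) :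
    F k ⊆ Finset.range n := by
  rw [← h.union]
  exact Finset.subset_biUnion_of_mem F (Finset.mem_univ k)

lemma IsFoldPartition.sum_sum (h : IsFoldPartition n F) (f : ℕ → ℝ) :
    ∑ k, ∑ i ∈ F k, f i = ∑ i ∈ Finset.range n, f i := by
  rw [← h.union, Finset.sum_biUnion fun k _ l _ hkl => h.disjoint k l hkl]

lemma IsFoldPartition.card_le_two_mul (h : IsFoldPartition n F) (hn : 1 ≤ n / K) (k : Fin K) :
    ((F k).card : ℝ) ≤ 2 * ((n / K : ℕ) : ℝ) := by
  have := h.card_le k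
  exact_mod_cast (by omega : (F k).card ≤ 2 * (n / K))

lemma tendsto_foldSize {K : ℕ} (hK : 0 < K) : Tendsto (fun n : ℕ => n / K) atTop atTop :=
  Nat.tendsto_div_const_atTop hK.ne'

end Folds

/-- Each term satisfies |x| ≤ s + x²/s. This turns mean-square control into control of the mean
absolute value. -/
lemma sum_abs_le_of_sum_sq_le {ι : Type*} (S : Finset ι) (x : ι → ℝ) {s : ℝ} (hs : 0 < s) :
    ∑ i ∈ S, |x i| ≤ S.card * s + (∑ i ∈ S, x i ^ 2) / s := by
  have h : ∀ i ∈ S, |x i| ≤ s + x i ^ 2 / s := fun i _ => by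
    rw [← sub_nonneg]
    have : s + x i ^ 2 / s - |x i| = ((|x i| - s / 2) ^ 2 + 3 / 4 * s ^ 2) / s := by
      rw [← sq_abs (x i)]
      field_simp
      ring
    rw [this]
    positivity
  refine (Finset.sum_le_sum h).trans (le_of_eq ?_)
  rw [Finset.sum_add_distrib, Finset.sum_const, nsmul_eq_mul, Finset.sum_div]

/-! ### Dependence of the moment functions on `τ` -/

variable {𝒳 𝒮 : Type*} [MeasurableSpace 𝒳] [MeasurableSpace 𝒮]

/-- The indicator of the experimental sample. -/
def labelR {𝒳 𝒮 : Type*} (r : UnitData 𝒳 𝒮) : ℝ := if label r = true then 1 else 0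

/-- Affinity in τ serves twice: to solve the estimating equation explicitly, and to bound the effect
of replacing τ_C by τ̂ in the variance estimator. -/
lemma moment_eq_sub {𝒳 𝒮 : Type*} (b : Bound) (r : UnitData 𝒳 𝒮) (t τ : ℝ) (η : Nuisance 𝒳 𝒮) :
    moment b (observe r) t η = moment b (observe r) τ η - labelR r / η.phi * (t - τ) := by
  cases hl : label r <;>
    simp only [moment, observe, labelR, hl, if_true, Bool.false_eq_true, if_false] <;> ring

lemma abs_labelR_le {𝒳 𝒮 : Type*} (r : UnitData 𝒳 𝒮) : |labelR r| ≤ 1 := by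
  unfold labelR; split_ifs <;> simp

lemma labelR_nonneg {𝒳 𝒮 : Type*} (r : UnitData 𝒳 𝒮) : 0 ≤ labelR r := by
  unfold labelR; split_ifs <;> simp

lemma measurable_labelR : Measurable (labelR : UnitData 𝒳 𝒮 → ℝ) :=
  (measurable_of_countable fun x : Bool => if x = true then (1 : ℝ) else 0).comp measurable_label

lemma integral_labelR (P : Measure (UnitData 𝒳 𝒮)) : ∫ r, labelR r ∂P = phi P := by
  have : (labelR : UnitData 𝒳 𝒮 → ℝ) = {r | label r = true}.indicator 1 := by
    ext r; simp [labelR, Set.indicator]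
  rw [this]
  exact integral_indicator_one (measurable_label (measurableSet_singleton true))

/-! ### The error from estimating the nuisance parameter -/

/-- The error of the moment function at `τ_C` caused by the error of the nuisance parameter. -/
def momentError (P : Measure (UnitData 𝒳 𝒮)) [IsFiniteMeasure P] (b : Bound) (η : Nuisance 𝒳 𝒮)
    (r : UnitData 𝒳 𝒮) : ℝ :=
  moment b (observe r) (tauBound P b) η - trueMoment P b r

lemma measurable_momentError {Ω : Type*} [MeasurableSpace Ω] (P : Measure (UnitData 𝒳 𝒮))
    [IsProbabilityMeasure P] (b : Bound) {η : Ω → Nuisance 𝒳 𝒮}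
    (hη : Measurable fun p : Ω × (𝒮 × 𝒳) => (η p.1).vec p.2) :
    Measurable fun p : Ω × UnitData 𝒳 𝒮 => momentError P b (η p.1) p.2 := by
  refine (measurable_moment_comp b _ (measurable_observe.comp measurable_snd) ?_).sub
    ((measurable_trueMoment P b).comp measurable_snd)
  exact hη.comp (measurable_fst.prodMk (measurable_surrX.comp measurable_snd))

lemma lintegral_momentError_sq_le {P : Measure (UnitData 𝒳 𝒮)} [IsProbabilityMeasure P]
    {b : Bound} {η : Nuisance 𝒳 𝒮} {c δ : ℝ} (hδ0 : 0 ≤ δ)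
    (hb : ∀ᵐ r ∂P, |momentError P b η r| ≤ c * ‖nuisanceError η (trueNuisance P) (surrX r)‖)
    (hδ : lpDist P 2 η.vec (trueNuisance P).vec ≤ ENNReal.ofReal δ) :
    ∫⁻ r, ENNReal.ofReal (momentError P b η r ^ 2) ∂P ≤ ENNReal.ofReal (c ^ 2 * δ ^ 2) := by
  have h1 := eLpNorm_nnreal_pow_eq_lintegral (μ := P) (p := 2) two_ne_zero
    (f := fun r => nuisanceError η (trueNuisance P) (surrX r))
  have h2 : eLpNorm (fun r => nuisanceError η (trueNuisance P) (surrX r)) ((2 : ℝ≥0) : ℝ≥0∞) P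
      ≤ ENNReal.ofReal δ := hδ
  have h3 : ∫⁻ r, ENNReal.ofReal (‖nuisanceError η (trueNuisance P) (surrX r)‖ ^ 2) ∂P
      ≤ ENNReal.ofReal (δ ^ 2) := by
    calc ∫⁻ r, ENNReal.ofReal (‖nuisanceError η (trueNuisance P) (surrX r)‖ ^ 2) ∂P
        = ∫⁻ r, ‖nuisanceError η (trueNuisance P) (surrX r)‖ₑ ^ ((2 : ℝ≥0) : ℝ) ∂P := by
          refine lintegral_congr fun r => ?_
          rw [ENNReal.ofReal_pow (norm_nonneg _), ofReal_norm]
          simp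
      _ ≤ ENNReal.ofReal δ ^ ((2 : ℝ≥0) : ℝ) := by
          rw [← h1]
          gcongr
      _ = ENNReal.ofReal (δ ^ 2) := by
          rw [ENNReal.ofReal_pow hδ0]
          simp
  calc ∫⁻ r, ENNReal.ofReal (momentError P b η r ^ 2) ∂P
      ≤ ∫⁻ r, ENNReal.ofReal (c ^ 2)
          * ENNReal.ofReal (‖nuisanceError η (trueNuisance P) (surrX r)‖ ^ 2) ∂P := by
        refine lintegral_mono_ae (hb.mono fun r hr => ?_)
        rw [← ENNReal.ofReal_mul (sq_nonneg _), ← mul_pow]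
        exact ENNReal.ofReal_le_ofReal (sq_le_sq' (abs_le.1 hr).1 (abs_le.1 hr).2)
    _ ≤ ENNReal.ofReal (c ^ 2 * δ ^ 2) := by
        rw [lintegral_const_mul' _ _ ENNReal.ofReal_ne_top, ENNReal.ofReal_mul (sq_nonneg _)]
        gcongr

/-! ### Consistency of the debiased estimator -/

/-- A bound on `τ̂ - τ_C` on the event that all empirical averages are close to their limits. -/
lemma abs_tauhat_sub_le {Ω : Type*} {P : Measure (UnitData 𝒳 𝒮)} [IsProbabilityMeasure P]
    {D : ℕ → Ω → UnitData 𝒳 𝒮} {K : ℕ} {F : ℕ → Fin K → Finset ℕ}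
    {ηhat : ℕ → Fin K → Ω → Nuisance 𝒳 𝒮} {τhat : Bound → ℕ → Ω → ℝ} {ε : ℝ} (hF : ∀ n, IsFoldPartition n (F n))
    (hτhat : IsDebiasedEstimator D F ηhat τhat) (hε : 0 < ε) {n : ℕ} (hn : 1 ≤ n / K) {ω : Ω}
    {b : Bound} (hφ : ε ≤ phi P) (hφ' : ∀ k, ε / 2 ≤ (ηhat n k ω).phi ∧ (ηhat n k ω).phi ≤ 2)
    {y : ℝ} (hy : 0 < y)
    (h1 : ∀ k, ∑ i ∈ F n k, momentError P b (ηhat n k ω) (D i ω) ^ 2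
      ≤ y ^ 2 * ((n / K : ℕ) : ℝ))
    (h2 : |∑ i ∈ Finset.range n, trueMoment P b (D i ω)| ≤ y * n)
    (h3 : |∑ i ∈ Finset.range n, labelR (D i ω) - n * phi P| ≤ ε / 2 * n) :
    |τhat b n ω - tauBound P b| ≤ 12 * y / ε := by
  have hKr : (K : ℝ) * ((n / K : ℕ) : ℝ) ≤ n := by exact_mod_cast Nat.mul_div_le n K
  have hn0 : (0 : ℝ) < n := by
    have : 1 ≤ n := hn.trans (Nat.div_le_self n K)
    exact_mod_cast this
  set N : ℝ := ∑ k, ∑ i ∈ F n k, moment b (observe (D i ω)) (tauBound P b) (ηhat n k ω) with hN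
  set E : ℝ := ∑ k, ∑ i ∈ F n k, labelR (D i ω) / (ηhat n k ω).phi with hE
  have hemp : ∀ t, empMoment D F ηhat b n ω t = 1 / (n : ℝ) * (N - E * (t - tauBound P b)) := by
    intro t
    simp only [empMoment]
    congr 1
    rw [hN, hE, Finset.sum_mul, ← Finset.sum_sub_distrib]
    refine Finset.sum_congr rfl fun k _ => ?_
    rw [Finset.sum_mul, ← Finset.sum_sub_distrib]
    exact Finset.sum_congr rfl fun i _ => moment_eq_sub b _ t _ _
  -- By `h3` at least (φ - ε/2)n ≥ εn/2 units are experimental, and each contributes at least 1/2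
  -- because φ̂ ≤ 2.
  have hEge : n * (ε / 4) ≤ E := by
    have hge : (∑ i ∈ Finset.range n, labelR (D i ω)) / 2 ≤ E := by
      rw [← (hF n).sum_sum, Finset.sum_div]
      refine Finset.sum_le_sum fun k _ => ?_
      rw [Finset.sum_div]
      refine Finset.sum_le_sum fun i _ => ?_
      exact div_le_div_of_nonneg_left (labelR_nonneg _) (by linarith [(hφ' k).1]) (hφ' k).2
    have h3' := (abs_le.1 h3).1
    nlinarith
  have hEpos : 0 < E := lt_of_lt_of_le (by positivity) hEge
  -- One yn comes from the centred true moment functions. The nuisance error adds two more: Σ|F_k| y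
  -- = yn and K r y ≤ yn, where r = ⌊n/K⌋.
  have hNle : |N| ≤ 3 * y * n := by
    have hdec : N = ∑ i ∈ Finset.range n, trueMoment P b (D i ω)
        + ∑ k, ∑ i ∈ F n k, momentError P b (ηhat n k ω) (D i ω) := by
      rw [hN, ← (hF n).sum_sum, ← Finset.sum_add_distrib]
      refine Finset.sum_congr rfl fun k _ => ?_
      rw [← Finset.sum_add_distrib]
      exact Finset.sum_congr rfl fun i _ => by simp [momentError]
    have hk : ∀ k, |∑ i ∈ F n k, momentError P b (ηhat n k ω) (D i ω)|
        ≤ (∑ _i ∈ F n k, y) + y * ((n / K : ℕ) : ℝ) := by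
      intro k
      refine (Finset.abs_sum_le_sum_abs _ _).trans
        ((sum_abs_le_of_sum_sq_le _ _ hy).trans ?_)
      rw [Finset.sum_const, nsmul_eq_mul]
      gcongr
      rw [div_le_iff₀ hy]
      linarith [h1 k]
    have hsum : |∑ k, ∑ i ∈ F n k, momentError P b (ηhat n k ω) (D i ω)| ≤ y * n + y * n := by
      refine (Finset.abs_sum_le_sum_abs _ _).trans ((Finset.sum_le_sum fun k _ => hk k).trans ?_)
      rw [Finset.sum_add_distrib, (hF n).sum_sum]
      simp only [Finset.sum_const, Finset.card_range, nsmul_eq_mul, Finset.card_univ,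
        Fintype.card_fin]
      nlinarith
    rw [hdec]
    refine (abs_add_le _ _).trans ?_
    linarith
  -- The slope `E` is nonzero, so the equation has the solution τ_C + N/E, and the defining property
  -- of τ̂ takes effect.
  have hzero : empMoment D F ηhat b n ω (τhat b n ω) = 0 := by
    refine hτhat b n ω ⟨tauBound P b + N / E, ?_⟩
    rw [hemp]
    field_simp
    ring
  rw [hemp, mul_eq_zero] at hzero
  have hlin : N = E * (τhat b n ω - tauBound P b) := by
    rcases hzero with h | h
    · exact absurd h (by positivity)
    · linarith
  have habs : E * |τhat b n ω - tauBound P b| = |N| := by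
    rw [hlin, abs_mul, abs_of_pos hEpos]
  rw [le_div_iff₀ hε]
  have h4 : n * (ε / 4) * |τhat b n ω - tauBound P b| ≤ 3 * y * n := by
    refine le_trans ?_ hNle
    rw [← habs]
    exact mul_le_mul_of_nonneg_right hEge (abs_nonneg _)
  have h5 : n * (|τhat b n ω - tauBound P b| * ε) ≤ n * (12 * y) := by linarith
  exact le_of_mul_le_mul_left h5 hn0

/-! ### Consequences of membership in the realization set with high probability -/

variable {Ω : Type*} [MeasurableSpace Ω] {μ : Measure Ω} [IsProbabilityMeasure μ]
  {P : Measure (UnitData 𝒳 𝒮)} [IsProbabilityMeasure P] {D : ℕ → Ω → UnitData 𝒳 𝒮} {K : ℕ}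
  {F : ℕ → Fin K → Finset ℕ} {aux : ℕ → MeasurableSpace Ω} {ηhat : ℕ → Fin K → Ω → Nuisance 𝒳 𝒮}
  {kind : OutcomeKind} {q ε C : ℝ} {δ Δ : ℕ → ℝ}

/-- Once Δₙ < 1, the estimator cannot fail to lie in the realization set at every ω; any ω where it
succeeds supplies a candidate, with δₙ as small as desired. -/
lemma scoreBounds_of_estimator (hK : 0 < K) (hδ : Tendsto δ atTop (𝓝 0))
    (hΔ : Tendsto Δ atTop (𝓝 0))
    (hreal : ∀ n : ℕ, 1 ≤ n → ∀ k : Fin K,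
      μ {ω | ηhat n k ω ∉ realizationSet P kind q ε C n (δ n)} ≤ ENNReal.ofReal (Δ n)) :
    ScoreBounds P ε := by
  refine scoreBounds_of_realizationSet (kind := kind) (q := q) (C := C) P fun κ hκ => ?_
  obtain ⟨n, ⟨hn1, hn2⟩, hn3⟩ := (((hδ.eventually (gt_mem_nhds hκ)).and
    (hΔ.eventually (gt_mem_nhds one_pos))).and (eventually_ge_atTop 1)).exists
  by_contra hcon
  have huniv : {ω | ηhat n ⟨0, hK⟩ ω ∉ realizationSet P kind q ε C n (δ n)} = Set.univ :=
    Set.eq_univ_of_forall fun ω hω => hcon ⟨n, δ n, _, hn1.le, hω⟩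
  have h1 := hreal n hn3 ⟨0, hK⟩
  rw [huniv, measure_univ] at h1
  have h2 : ENNReal.ofReal (Δ n) < 1 := by
    rw [← ENNReal.ofReal_one]
    exact (ENNReal.ofReal_lt_ofReal_iff one_pos).2 hn2
  exact absurd h1 (not_le.2 h2)

lemma whp_realizationSet {μ : Measure Ω} (hΔ : Tendsto Δ atTop (𝓝 0))
    (hreal : ∀ n : ℕ, 1 ≤ n → ∀ k : Fin K,
      μ {ω | ηhat n k ω ∉ realizationSet P kind q ε C n (δ n)} ≤ ENNReal.ofReal (Δ n)) :
    WHP μ fun n ω => ∀ k, ηhat n k ω ∈ realizationSet P kind q ε C n (δ n) := by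
  refine WHP.forall_finite fun k => WHP.of_le (u := fun n => ENNReal.ofReal (Δ n)) ?_ ?_
  · simpa using ENNReal.tendsto_ofReal hΔ
  · filter_upwards [eventually_ge_atTop 1] with n hn using hreal n hn k

/-- The average squared error of the moment functions at `τ_C` over each fold tends to zero. -/
lemma whp_sum_momentError_sq_le (hK : 0 < K) (hD : ∀ i, Measurable (D i))
    (hlaw : ∀ i, μ.map (D i) = P) (hind : iIndepFun D μ) (hF : ∀ n, IsFoldPartition n (F n))
    (hηhat : IsCrossFitted μ D F aux ηhat) (hε : 0 < ε) (hδ : Tendsto δ atTop (𝓝 0))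
    (hΔ : Tendsto Δ atTop (𝓝 0)) (hδ0 : ∀ n, 1 ≤ n → 0 ≤ δ n)
    (hreal : ∀ n : ℕ, 1 ≤ n → ∀ k : Fin K,
      μ {ω | ηhat n k ω ∉ realizationSet P kind q ε C n (δ n)} ≤ ENNReal.ofReal (Δ n))
    {c : ℝ} {b : Bound}
    (hlip : ∀ (δ : ℝ) (n : ℕ) (η : Nuisance 𝒳 𝒮), 0 ≤ δ → δ ≤ ε / 2 →
        η ∈ realizationSet P kind q ε C n δ → ∀ᵐ r ∂P,
          |momentError P b η r| ≤ c * ‖nuisanceError η (trueNuisance P) (surrX r)‖)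
    (k : Fin K) {y : ℝ} (hy : 0 < y) :
    WHP μ fun n ω => ∑ i ∈ F n k, momentError P b (ηhat n k ω) (D i ω) ^ 2
      ≤ y * ((n / K : ℕ) : ℝ) := by
  -- The second term is the Markov bound: at most 2r units with expected squared error c²δₙ² each,
  -- divided by the threshold yr.
  have hu : Tendsto (fun n => ENNReal.ofReal (Δ n) + ENNReal.ofReal (2 * c ^ 2 / y * δ n ^ 2))
      atTop (𝓝 0) := by
    have h1 := ENNReal.tendsto_ofReal hΔ
    have h2 := ENNReal.tendsto_ofReal ((hδ.pow 2).const_mul (2 * c ^ 2 / y))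
    simpa using h1.add h2
  refine WHP.of_le hu ?_
  filter_upwards [hδ.eventually (ge_mem_nhds (half_pos hε)), eventually_ge_atTop 1,
    (tendsto_foldSize hK).eventually (eventually_ge_atTop 1)] with n hn1 hn2 hn3
  have hr : (0 : ℝ) < ((n / K : ℕ) : ℝ) := by exact_mod_cast hn3
  set g : Ω × UnitData 𝒳 𝒮 → ℝ≥0∞ := fun p =>
    ENNReal.ofReal (momentError P b (ηhat n k p.1) p.2 ^ 2) with hg
  have hgm : @Measurable (Ω × UnitData 𝒳 𝒮) ℝ≥0∞ (@Prod.instMeasurableSpace _ _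
      (outOfFold D (aux n) n (F n k)) inferInstance) inferInstance g :=
    ENNReal.measurable_ofReal.comp ((@measurable_momentError 𝒳 𝒮 _ _ Ω
      (outOfFold D (aux n) n (F n k)) P _ b (ηhat n k) (hηhat.measurable_vec n k)).pow_const 2)
  have key := measure_sum_gt_le (outOfFold_le hD (hηhat.aux_le n) n (F n k)) hD hlaw
    (fun i hi => indep_outOfFold hD hind (hηhat.aux_le n) (hηhat.aux_indep n)
      ((hF n).subset_range k) hi) hgm (ENNReal.ofReal (c ^ 2 * δ n ^ 2))
    (x := ENNReal.ofReal (y * ((n / K : ℕ) : ℝ))) (by simpa using mul_pos hy hr)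
    ENNReal.ofReal_ne_top
  have hset : {ω | ¬ ∑ i ∈ F n k, momentError P b (ηhat n k ω) (D i ω) ^ 2
      ≤ y * ((n / K : ℕ) : ℝ)}
      = {ω | ¬ ∑ i ∈ F n k, g (ω, D i ω) ≤ ENNReal.ofReal (y * ((n / K : ℕ) : ℝ))} := by
    ext ω
    simp only [Set.mem_ofPred_eq, hg]
    rw [← ENNReal.ofReal_sum_of_nonneg fun i _ => sq_nonneg _,
      ENNReal.ofReal_le_ofReal_iff (mul_pos hy hr).le]
  rw [hset]
  refine key.trans (add_le_add ?_ ?_)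
  -- A conditional mean squared error above c²δₙ² forces η̂ out of the realization set, an event of
  -- probability at most Δₙ.
  · refine (measure_mono fun ω hω hin => ?_).trans (hreal n hn2 k)
    exact absurd (lintegral_momentError_sq_le (hδ0 n hn2) (hlip (δ n) n _ (hδ0 n hn2) hn1 hin)
      hin.2.2.2.2.1) (not_le.2 hω)
  · have hcard : ((F n k).card : ℝ≥0∞) = ENNReal.ofReal ((F n k).card : ℝ) := by simp
    rw [hcard, ← ENNReal.ofReal_mul (Nat.cast_nonneg _),
      ← ENNReal.ofReal_div_of_pos (mul_pos hy hr)]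
    refine ENNReal.ofReal_le_ofReal ?_
    rw [div_le_iff₀ (mul_pos hy hr)]
    have h2 := (hF n).card_le_two_mul hn3 k
    have h3 : 2 * c ^ 2 / y * δ n ^ 2 * (y * ((n / K : ℕ) : ℝ))
        = 2 * ((n / K : ℕ) : ℝ) * (c ^ 2 * δ n ^ 2) := by field_simp
    rw [h3]
    exact mul_le_mul_of_nonneg_right h2 (by positivity)

end

end SurrogateBounds

namespace SurrogateBounds

noncomputable section

/-! ### Consistency of the variance estimator -/

/-- Only a and b are bounded, so a'b' - ab is split as a(b' - b) + b(a' - a) + (a' - a)(b' - b).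
Each linear term sums to at most c · 3sr, and the last, by 2|xy| ≤ x² + y², to at most s²r. -/
lemma abs_sum_mul_sub_le {ι : Type*} (S : Finset ι) {a b a' b' : ι → ℝ} {c s r : ℝ} (hs : 0 < s)
    (hc : 0 ≤ c) (ha : ∀ i ∈ S, |a i| ≤ c) (hb : ∀ i ∈ S, |b i| ≤ c) (hS : (S.card : ℝ) ≤ 2 * r)
    (ha' : ∑ i ∈ S, (a' i - a i) ^ 2 ≤ s ^ 2 * r) (hb' : ∑ i ∈ S, (b' i - b i) ^ 2 ≤ s ^ 2 * r) :
    |∑ i ∈ S, a' i * b' i - ∑ i ∈ S, a i * b i| ≤ (6 * c * s + s ^ 2) * r := by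
  have h1 : ∀ {x : ι → ℝ}, ∑ i ∈ S, x i ^ 2 ≤ s ^ 2 * r → ∑ i ∈ S, |x i| ≤ 3 * s * r := by
    intro x hx
    refine (sum_abs_le_of_sum_sq_le S x hs).trans ?_
    have h2 : (∑ i ∈ S, x i ^ 2) / s ≤ s * r := by
      rw [div_le_iff₀ hs]; linarith
    nlinarith
  have hterm : ∀ i ∈ S, |a' i * b' i - a i * b i| ≤ c * |b' i - b i| + c * |a' i - a i|
      + ((a' i - a i) ^ 2 / 2 + (b' i - b i) ^ 2 / 2) := by
    intro i hi
    have heq : a' i * b' i - a i * b i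
        = a i * (b' i - b i) + b i * (a' i - a i) + (a' i - a i) * (b' i - b i) := by ring
    rw [heq]
    refine (abs_add_le _ _).trans (add_le_add ((abs_add_le _ _).trans (add_le_add ?_ ?_)) ?_)
    · rw [abs_mul]; exact mul_le_mul_of_nonneg_right (ha i hi) (abs_nonneg _)
    · rw [abs_mul]; exact mul_le_mul_of_nonneg_right (hb i hi) (abs_nonneg _)
    · rw [abs_le]
      constructor
      · linarith [sq_nonneg (a' i - a i + (b' i - b i))]
      · linarith [sq_nonneg (a' i - a i - (b' i - b i))]
  rw [← Finset.sum_sub_distrib]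
  refine (Finset.abs_sum_le_sum_abs _ _).trans ((Finset.sum_le_sum hterm).trans ?_)
  simp only [Finset.sum_add_distrib, ← Finset.mul_sum, ← Finset.sum_div]
  have h3 := mul_le_mul_of_nonneg_left (h1 ha') hc
  have h4 := mul_le_mul_of_nonneg_left (h1 hb') hc
  linarith

variable {𝒳 𝒮 : Type*} [MeasurableSpace 𝒳] [MeasurableSpace 𝒮]

/-- The squared error of the estimated moment functions over a fold. -/
lemma sum_moment_tauhat_sub_sq_le {P : Measure (UnitData 𝒳 𝒮)} [IsProbabilityMeasure P] {b : Bound}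
    {η : Nuisance 𝒳 𝒮} {t ε s R : ℝ} (hε : 0 < ε) (hφ : ε / 2 ≤ η.phi) {ι : Type*} (S : Finset ι)
    (d : ι → UnitData 𝒳 𝒮) (hS : (S.card : ℝ) ≤ 2 * R)
    (h1 : ∑ i ∈ S, momentError P b η (d i) ^ 2 ≤ s ^ 2 / 4 * R)
    (h2 : |t - tauBound P b| ≤ s * ε / 8) :
    ∑ i ∈ S, (moment b (observe (d i)) t η - trueMoment P b (d i)) ^ 2 ≤ s ^ 2 * R := by
  have hterm : ∀ i ∈ S, (moment b (observe (d i)) t η - trueMoment P b (d i)) ^ 2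
      ≤ 2 * momentError P b η (d i) ^ 2 + s ^ 2 / 8 := by
    intro i _
    -- The slope is at most 2/ε, and (2/ε)(sε/8) = s/4. With (v - u)² ≤ 2v² + 2u² this adds s²/8 per
    -- unit.
    have hx : |labelR (d i) / η.phi * (t - tauBound P b)| ≤ s / 4 := by
      rw [abs_mul, abs_div]
      have hp : 0 < η.phi := by linarith
      have h3 : |labelR (d i)| / |η.phi| ≤ 1 / (ε / 2) := by
        rw [abs_of_pos hp]
        exact div_le_div₀ zero_le_one (abs_labelR_le _) (half_pos hε) hφ
      refine (mul_le_mul h3 h2 (abs_nonneg _) (by positivity)).trans (le_of_eq ?_)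
      field_simp
      ring
    have hx2 : (labelR (d i) / η.phi * (t - tauBound P b)) ^ 2 ≤ (s / 4) ^ 2 :=
      sq_le_sq' (abs_le.1 hx).1 (abs_le.1 hx).2
    rw [moment_eq_sub b (d i) t (tauBound P b) η]
    simp only [momentError]
    generalize labelR (d i) / η.phi * (t - tauBound P b) = u at hx2
    generalize moment b (observe (d i)) (tauBound P b) η = v
    nlinarith [sq_nonneg (v - trueMoment P b (d i) + u)]
  refine (Finset.sum_le_sum hterm).trans ?_
  rw [Finset.sum_add_distrib, ← Finset.mul_sum, Finset.sum_const, nsmul_eq_mul]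
  nlinarith [sq_nonneg s]

/-- The error of the variance estimator on the event that all fold averages are close to their
limits. -/
lemma abs_covEstimator_sub_le {Ω : Type*} {P : Measure (UnitData 𝒳 𝒮)} [IsProbabilityMeasure P]
    {D : ℕ → Ω → UnitData 𝒳 𝒮} {K : ℕ} {F : ℕ → Fin K → Finset ℕ}
    {ηhat : ℕ → Fin K → Ω → Nuisance 𝒳 𝒮} {τhat : Bound → ℕ → Ω → ℝ} (hK : 0 < K) {a b : Bound}
    {n : ℕ} (hF : IsFoldPartition n (F n)) (hn : 1 ≤ n / K) {ω : Ω} {c s : ℝ} (hs : 0 < s)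
    (hc : 0 ≤ c) (hbd : ∀ b i, |trueMoment P b (D i ω)| ≤ c)
    (herr : ∀ b k, ∑ i ∈ F n k, (moment b (observe (D i ω)) (τhat b n ω) (ηhat n k ω)
      - trueMoment P b (D i ω)) ^ 2 ≤ s ^ 2 * ((n / K : ℕ) : ℝ))
    (havg : ∀ k, |∑ i ∈ F n k, trueMoment P a (D i ω) * trueMoment P b (D i ω)
      - (F n k).card * asympCov P a b| ≤ s * (F n k).card)
    (hV : |asympCov P a b| ≤ s * ((n / K : ℕ) : ℝ)) :
    |covEstimator D F ηhat τhat a b n ω - asympCov P a b| ≤ 6 * c * s + s ^ 2 + 3 * s := by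
  have hr : (0 : ℝ) < ((n / K : ℕ) : ℝ) := by exact_mod_cast hn
  have hK' : (0 : ℝ) < K := by exact_mod_cast hK
  have hfold : ∀ k, |((n / K : ℕ) : ℝ)⁻¹ * ∑ i ∈ F n k,
      moment a (observe (D i ω)) (τhat a n ω) (ηhat n k ω) *
      moment b (observe (D i ω)) (τhat b n ω) (ηhat n k ω) - asympCov P a b|
      ≤ 6 * c * s + s ^ 2 + 3 * s := by
    intro k
    have hcard := hF.card_le_two_mul hn k
    have h1 := abs_sum_mul_sub_le (F n k) hs hc (fun i _ => hbd a i) (fun i _ => hbd b i) hcard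
      (herr a k) (herr b k)
    -- The fold size is r or r + 1, so the discrepancy is at most |V|, which `hV` makes small
    -- relative to r.
    have h2 : |(F n k).card * asympCov P a b - ((n / K : ℕ) : ℝ) * asympCov P a b|
        ≤ s * ((n / K : ℕ) : ℝ) := by
      rw [← sub_mul, abs_mul]
      have h3 : |((F n k).card : ℝ) - ((n / K : ℕ) : ℝ)| ≤ 1 := by
        have hge : ((n / K : ℕ) : ℝ) ≤ (F n k).card := by exact_mod_cast hF.card_ge k
        have hle : ((F n k).card : ℝ) ≤ ((n / K : ℕ) : ℝ) + 1 := by exact_mod_cast hF.card_le k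
        rw [abs_le]
        constructor <;> linarith
      refine (mul_le_mul_of_nonneg_right h3 (abs_nonneg _)).trans ?_
      rw [one_mul]
      exact hV
    have h4 := havg k
    have h5 : s * ((F n k).card : ℝ) ≤ s * (2 * ((n / K : ℕ) : ℝ)) :=
      mul_le_mul_of_nonneg_left hcard hs.le
    set A := ∑ i ∈ F n k, moment a (observe (D i ω)) (τhat a n ω) (ηhat n k ω) *
      moment b (observe (D i ω)) (τhat b n ω) (ηhat n k ω)
    -- The term 3sr collects 2sr from the weak law over at most 2r units and sr from the fold size.
    have h6 : |A - ((n / K : ℕ) : ℝ) * asympCov P a b|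
        ≤ ((n / K : ℕ) : ℝ) * (6 * c * s + s ^ 2 + 3 * s) := by
      rw [abs_le] at h1 h2 h4 ⊢
      constructor <;> nlinarith [h1.1, h1.2, h2.1, h2.2, h4.1, h4.2]
    have h7 : ((n / K : ℕ) : ℝ)⁻¹ * A - asympCov P a b
        = ((n / K : ℕ) : ℝ)⁻¹ * (A - ((n / K : ℕ) : ℝ) * asympCov P a b) := by
      field_simp
    rw [h7, abs_mul, abs_of_pos (inv_pos.2 hr), inv_mul_le_iff₀ hr]
    exact h6
  have hdec : covEstimator D F ηhat τhat a b n ω - asympCov P a b = 1 / (K : ℝ) *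
      ∑ k, (((n / K : ℕ) : ℝ)⁻¹ * ∑ i ∈ F n k,
        moment a (observe (D i ω)) (τhat a n ω) (ηhat n k ω) *
        moment b (observe (D i ω)) (τhat b n ω) (ηhat n k ω) - asympCov P a b) := by
    rw [Finset.sum_sub_distrib]
    simp only [covEstimator, Finset.sum_const, Finset.card_univ, Fintype.card_fin, nsmul_eq_mul]
    field_simp
  rw [hdec, abs_mul, abs_of_pos (by positivity : (0 : ℝ) < 1 / K), one_div, inv_mul_le_iff₀ hK']
  refine (Finset.abs_sum_le_sum_abs _ _).trans ((Finset.sum_le_sum fun k _ => hfold k).trans (le_of_eq ?_))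
  rw [Finset.sum_const, Finset.card_univ, Fintype.card_fin, nsmul_eq_mul]

end

end SurrogateBounds

/-! ### Consistency of the covariance estimator -/

theorem mainTheorem10
    {𝒳 𝒮 : Type*} [MeasurableSpace 𝒳] [StandardBorelSpace 𝒳]
    [MeasurableSpace 𝒮] [StandardBorelSpace 𝒮]
    {Ω : Type*} [MeasurableSpace Ω] (μ : Measure Ω) [IsProbabilityMeasure μ]
    -- the law of a unit and a random sample from it
    (P : Measure (UnitData 𝒳 𝒮)) [IsProbabilityMeasure P]
    (D : ℕ → Ω → UnitData 𝒳 𝒮) (hD_meas : ∀ i, Measurable (D i))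
    (hD_law : ∀ i, μ.map (D i) = P) (hD_indep : iIndepFun D μ)
    -- unconfoundedness, comparability, regularity
    (hunc : Unconfounded P) (hcomp : Comparable P)
    (kind : OutcomeKind) (hreg : OutcomeRegular P kind) (hnd : NonDegenerate P)
    -- folds, cross-fitted nuisance estimators, debiased estimators
    (K : ℕ) (hK : 2 ≤ K) (F : ℕ → Fin K → Finset ℕ) (hF : ∀ n, IsFoldPartition n (F n))
    (aux : ℕ → MeasurableSpace Ω) (ηhat : ℕ → Fin K → Ω → Nuisance 𝒳 𝒮)
    (hηhat : IsCrossFitted μ D F aux ηhat)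
    (τhat : Bound → ℕ → Ω → ℝ) (hτhat : IsDebiasedEstimator D F ηhat τhat)
    -- realization set
    (q ε C : ℝ) (hq : 2 < q) (hε : 0 < ε) (hε' : ε < 1 / 2)
    (δ Δ : ℕ → ℝ) (hδ : Tendsto δ atTop (𝓝 0)) (hΔ : Tendsto Δ atTop (𝓝 0))
    (hδ_ge : ∀ n : ℕ, 1 ≤ n → (n : ℝ) ^ (-(1 / 2) : ℝ) ≤ δ n)
    (hreal : ∀ n : ℕ, 1 ≤ n → ∀ k : Fin K,
      μ {ω | ηhat n k ω ∉ realizationSet P kind q ε C n (δ n)} ≤ ENNReal.ofReal (Δ n))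
    -- additional rate condition
    (hδ_rate : ∀ n : ℕ, 1 ≤ n → (n : ℝ) ^ (-(min (1 - 2 / q) (1 / 2))) ≤ δ n) :
    ∀ a b : Bound,
      Integrable (fun r => trueMoment P a r * trueMoment P b r) P ∧
      TendstoInMeasure μ (fun n ω => covEstimator D F ηhat τhat a b n ω) atTop
        (fun _ => asympCov P a b) := by
  have hK0 : 0 < K := by omega
  have hδ0 : ∀ n, 1 ≤ n → 0 ≤ δ n := fun n hn =>
    (Real.rpow_nonneg (Nat.cast_nonneg n) _).trans (hδ_ge n hn)
  have hscore : ScoreBounds P ε := scoreBounds_of_estimator hK0 hδ hΔ hreal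
  obtain ⟨B, hT⟩ := hscore.exists_truthBounds hε hreg
  obtain ⟨c, hc, hcb⟩ := hT.exists_moment_bound hε
  have hM : ∀ b, EssBdd P (trueMoment P b) := fun b =>
    ⟨measurable_trueMoment P b, c, (hcb b).1⟩
  have hφ := hscore.phi_mem
  intro a b
  obtain ⟨hABm, cAB, hAB⟩ := (hM a).mul (hM b)
  refine ⟨((hM a).mul (hM b)).integrable, ?_⟩
  rw [tendstoInMeasure_iff_norm]
  intro e he
  -- The final error bound of `abs_covEstimator_sub_le` is continuous in s and vanishes at 0.
  obtain ⟨s, hs, hse⟩ : ∃ s : ℝ, 0 < s ∧ 6 * c * s + s ^ 2 + 3 * s < e := by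
    have hcont : Tendsto (fun s : ℝ => 6 * c * s + s ^ 2 + 3 * s) (𝓝[>] 0) (𝓝 0) := by
      have : ContinuousAt (fun s : ℝ => 6 * c * s + s ^ 2 + 3 * s) 0 := by fun_prop
      have h0 := this.tendsto
      simp only [mul_zero, ne_eq, OfNat.ofNat_ne_zero, not_false_eq_true, zero_pow, add_zero] at h0
      exact h0.mono_left nhdsWithin_le_nhds
    obtain ⟨s, h1, h2⟩ := ((hcont.eventually (gt_mem_nhds he)).and self_mem_nhdsWithin).exists
    exact ⟨s, h2, h1⟩
  -- Chosen so that the bound 12y/ε on |τ̂ - τ_C| equals sε/8, the accuracy required by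
  -- `sum_moment_tauhat_sub_sq_le`.
  set y : ℝ := s * ε ^ 2 / 96 with hy
  have hy0 : 0 < y := by positivity
  have w1 := whp_realizationSet hΔ hreal
  have werr : ∀ {x : ℝ}, 0 < x → WHP μ fun n ω => ∀ b k,
      ∑ i ∈ F n k, momentError P b (ηhat n k ω) (D i ω) ^ 2 ≤ x * ((n / K : ℕ) : ℝ) :=
    fun hx => WHP.forall_finite fun b => WHP.forall_finite fun k =>
      whp_sum_momentError_sq_le hK0 hD_meas hD_law hD_indep hF hηhat hε hδ hΔ hδ0 hreal
        ((hcb b).2 kind q C) k hx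
  -- The nuisance error is needed at two accuracies: y² for the consistency of τ̂, and s²/4 for the
  -- squared error of the moment functions.
  have w2 := werr (sq_pos_of_pos hy0)
  have w3 := werr (show 0 < s ^ 2 / 4 by positivity)
  have hcardn : Tendsto (fun n => (Finset.range n).card) atTop atTop := by
    simp only [Finset.card_range]
    exact tendsto_id
  have hcardF : ∀ k, Tendsto (fun n => (F n k).card) atTop atTop := fun k =>
    tendsto_atTop_mono (fun n => (hF n).card_ge k) (tendsto_foldSize hK0)
  have w4 : WHP μ fun n ω => ∀ b, |∑ i ∈ Finset.range n, trueMoment P b (D i ω)| ≤ y * n :=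
    WHP.forall_finite fun b => by
      have := whp_sum_sub_le hD_meas hD_law hD_indep (hM b).1 (hcb b).1 hcardn hy0
      simpa [hT.integral_trueMoment hε b] using this
  have w5 : WHP μ fun n ω => |∑ i ∈ Finset.range n, labelR (D i ω) - n * phi P| ≤ ε / 2 * n := by
    have := whp_sum_sub_le hD_meas hD_law hD_indep measurable_labelR
      (Eventually.of_forall fun r => abs_labelR_le r) hcardn (half_pos hε)
    simpa [integral_labelR] using this
  have w6 : WHP μ fun n ω => ∀ k, |∑ i ∈ F n k, trueMoment P a (D i ω) * trueMoment P b (D i ω)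
      - (F n k).card * asympCov P a b| ≤ s * (F n k).card :=
    WHP.forall_finite fun k =>
      whp_sum_sub_le hD_meas hD_law hD_indep hABm hAB (hcardF k) hs
  have w7 : WHP μ fun _ ω => ∀ b i, |trueMoment P b (D i ω)| ≤ c := by
    refine WHP.of_ae (Eventually.of_forall fun _ => ?_)
    refine ae_all_iff.2 fun b => ae_all_iff.2 fun i => ?_
    have h : ∀ᵐ r ∂(μ.map (D i)), |trueMoment P b r| ≤ c := by
      rw [hD_law i]
      exact (hcb b).1
    exact ae_of_ae_map (hD_meas i).aemeasurable h
  have w8 : WHP μ fun n ω => ‖covEstimator D F ηhat τhat a b n ω - asympCov P a b‖ < e := by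
    refine ((((w1.and w2).and w3).and (w4.and w5)).and (w6.and w7)).mono ?_
    have hVev : ∀ᶠ n : ℕ in atTop, |asympCov P a b| ≤ s * ((n / K : ℕ) : ℝ) :=
      (((tendsto_natCast_atTop_atTop (R := ℝ)).comp (tendsto_foldSize hK0)).const_mul_atTop
        hs).eventually (eventually_ge_atTop _)
    filter_upwards [hVev, (tendsto_foldSize hK0).eventually (eventually_ge_atTop 1),
      eventually_ge_atTop 1, hδ.eventually (ge_mem_nhds (half_pos hε))] with n hV hn hn1 hδn
    rintro ω ⟨⟨⟨⟨g1, g2⟩, g3⟩, g4, g5⟩, g6, g7⟩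
    have hphi : ∀ k, ε / 2 ≤ (ηhat n k ω).phi ∧ (ηhat n k ω).phi ≤ 2 := fun k => by
      have h := abs_le.1 (abs_phi_sub_le (hδ0 n hn1) (g1 k))
      exact ⟨by linarith [h.1, hφ.1], by linarith [h.2, hφ.2]⟩
    have hτ : ∀ b, |τhat b n ω - tauBound P b| ≤ s * ε / 8 := fun b => by
      refine (abs_tauhat_sub_le hF hτhat hε hn hφ.1 hphi hy0 (g2 b) (g4 b) g5).trans (le_of_eq ?_)
      rw [hy]
      field_simp
      ring
    rw [Real.norm_eq_abs]
    refine lt_of_le_of_lt (abs_covEstimator_sub_le hK0 (hF n) hn hs hc g7 (fun b k => ?_) g6 hV) hse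
    exact sum_moment_tauhat_sub_sq_le hε (hphi k).1 (F n k) (fun i => D i ω)
      ((hF n).card_le_two_mul hn k) (g3 b k) (hτ b)
  simpa only [WHP, not_lt] using w8
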